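/- Let $d\ge 1$, let $\Omega\subset\mathbb{R}^d$ be a bounded open set with Lipschitz boundary, let $\nu$ be its outward unit normal, and let $\partial\Omega=\partial\Omega_D\cup\partial\Omega_N$ with $\partial\Omega_N=\partial\Omega\setminus\partial\Omega_D$. (Conditions involving $\nu$ are imposed at the boundary points where $\nu$ exists; boundary values of derivatives are limits from inside $\Omega$.) Let $P\in C^1((0,\infty))$ with $P>0$, let $c\le 0$ be a constant, and let $s>d/2$ be real. Let $a\in C^3(\overline\Omega)\cap C^4(\Omega)$ be a nonnegative function such that $\mathrm{Hess}(a)$ is negative-semidefinite in $\Omega$, $\Delta a=-g\le 0$ in $\Omega$, $a=0$ on $\partial\Omega_D$, $\nabla a\cdot\nu=0$ on $\partial\Omega_N$, and $\Delta g\le 0$ in $\Omega$, $\frac{\partial g}{\partial\nu}\ge 0$ on $\partial\Omega$. Let $\rho_I\in L^2(\Omega)$ with $\rho_I>0$ a.e., and $u_I\in L^2(\Omega)^d$. For $T>0$, a \emph{positive solution on $[0,T]$} is a pair $(\rho,u)$ with $$\rho\in H^1(0,T;L^2(\Omega))\cap L^2(0,T;H^{s+2}(\Omega)),\qquad u\in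 H^1(0,T;L^2(\Omega)^d)\cap L^2(0,T;H^{s+1}(\Omega)^d),$$ $\rho(t)>0$ on $\overline\Omega$ for a.e. $t\in(0,T)$, which satisfies the quantum hydrodynamic system $$\rho_t+\mathrm{div}(\rho u)=0,\qquad (\rho u)_t+\mathrm{div}(\rho u\otimes u)+\nabla P(\rho)=\rho\,\nabla\Big(\frac{\Delta\sqrt\rho}{\sqrt\rho}\Big)\quad\text{in }\Omega$$ for a.e. $t\in(0,T)$ (the second equation in the sense of distributions in $\Omega$), the initial conditions $\rho(\cdot,0)=\rho_I$, $u(\cdot,0)=u_I$, and, for a.e. $t\in(0,T)$, the boundary conditions $$\frac{\partial a}{\partial\nu}\Big(\frac{\Delta\sqrt\rho}{\sqrt\rho}+\frac{|\nabla\sqrt\rho|^2}{\rho}-\frac{P(\rho)}{\rho}\Big)-(u\cdot\nabla a)(u\cdot\nu)=c\ \text{ on }\partial\Omega_D,\qquad u\cdot\nu=0\ \text{ on }\partial\Omega_N,\qquad \frac{\partial\sqrt\rho}{\partial\nu}=0\ \text{ on }\partial\Omega .$$ Suppose that $M:=\int_\Omega\rho_I u_I\cdot\nabla a\,dx<0$,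 and put $T^*:=-\frac1M\int_\Omega a\rho_I\,dx$. Then $0<T^*<\infty$, and: 1. Every positive solution on an interval $[0,T]$ satisfies $T\le T^*$ and $\int_\Omega a\,\rho(x,t)\,dx\le\int_\Omega a\rho_I\,dx+tM$ for all $t\in[0,T]$. In particular, no positive solution exists beyond the time $T^*$, which depends only on $\Omega$, $a$ and the initial data. 2. If $(\rho,u)$ is a positive solution on $[0,T]$ for every $T<T^*$, then $\lim_{t\uparrow T^*}\rho(x,t)=0$ for almost every $x\in\Omega$. -/

import Mathlib

open MeasureTheory Set Filter Topology
open scoped Laplacian Gradient RealInnerProductSpace ContDiff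

noncomputable section

namespace QHD

/-- The Euclidean space `ℝ^d`. -/
abbrev Space (d : ℕ) : Type := EuclideanSpace ℝ (Fin d)

variable {d : ℕ}

/-! ### Bounded Lipschitz open sets and their outward normals -/

/-- `Ω` is a bounded open set with Lipschitz boundary: near every boundary point, and for a suitable
unit vector `n`, it is the strict subgraph, in the direction `n`, of a Lipschitz function `γ` of the
variables orthogonal to `n` (that is, `γ` is constant along `n`). -/
structure IsLipschitzDomain (Ω : Set (Space d)) : Prop where
  isOpen : IsOpen Ω
  bounded : Bornology.IsBounded Ω
  chart : ∀ x ∈ frontier Ω, ∃ (n : Space d) (r : ℝ) (K : NNReal) (γ : Space d → ℝ),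
    ‖n‖ = 1 ∧ 0 < r ∧ LipschitzWith K γ ∧ (∀ (y : Space d) (h : ℝ), γ (y + h • n) = γ y) ∧
    ∀ y ∈ Metric.ball x r, (y ∈ Ω ↔ ⟪y, n⟫ < γ y)

/-- `ν` is the outward unit normal of `Ω` at the boundary point `x`: infinitesimally at `x`, the set
`Ω` is the half-space `{y | ⟪y - x, ν⟫ < 0}`. For a set with Lipschitz boundary, such a vector exists
at exactly those boundary points where the local graph function is differentiable, hence at almost
every boundary point (and at every boundary point if the boundary is of class `C^1`). -/
def IsOuterUnitNormal (Ω : Set (Space d)) (x ν : Space d) : Prop :=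
  ‖ν‖ = 1 ∧ ∀ ε > 0, ∀ᶠ y in 𝓝 x,
    (⟪y - x, ν⟫ < -ε * ‖y - x‖ → y ∈ Ω) ∧ (ε * ‖y - x‖ < ⟪y - x, ν⟫ → y ∉ Ω)

/-! ### Function spaces and differential operators -/

/-- `f ∈ C^k(closure Ω)`: `f` is `C^k` in the open set `Ω`, and all its derivatives of order at most
`k` extend continuously from `Ω` to the closure of `Ω`. -/
def ContDiffUpToBoundary (k : ℕ) (Ω : Set (Space d)) (f : Space d → ℝ) : Prop :=
  ContDiffOn ℝ k f Ω ∧ ∀ j ≤ k, ∃ D : Space d → (Space d) [×j]→L[ℝ] ℝ,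
    ContinuousOn D (closure Ω) ∧ ∀ x ∈ Ω, D x = iteratedFDeriv ℝ j f x

/-- The divergence of a vector field. -/
def divergence (F : Space d → Space d) (x : Space d) : ℝ :=
  ∑ i : Fin d, fderiv ℝ F x (EuclideanSpace.single i 1) i

/-- Lebesgue measure on the space-time cylinder `(0,T) × Ω`. -/
def cylinder (T : ℝ) (Ω : Set (Space d)) : Measure (ℝ × Space d) :=
  (volume.restrict (Ioo 0 T)).prod (volume.restrict Ω)

/-- `f' ∈ L^1((0,T) × Ω)` is the time derivative of `f`, and `f` is the representative that is
absolutely continuous in time: `f(t) = f(0) + ∫₀ᵗ f'(s) ds` almost everywhere in `Ω`, for every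
`t ∈ [0,T]`. -/
def IsTimeDeriv {F : Type*} [NormedAddCommGroup F] [NormedSpace ℝ F] (T : ℝ) (Ω : Set (Space d))
    (f f' : ℝ → Space d → F) : Prop :=
  Integrable (Function.uncurry f') (cylinder T Ω) ∧
    ∀ t ∈ Icc 0 T, ∀ᵐ x ∂volume.restrict Ω, f t x = f 0 x + ∫ s in (0 : ℝ)..t, f' s x

/-- `f ∈ H^1(0,T; L^2(Ω))`, where `f` is the representative that is continuous from `[0,T]` to
`L^2(Ω)`. -/
def MemH1L2 {F : Type*} [NormedAddCommGroup F] [NormedSpace ℝ F] (T : ℝ) (Ω : Set (Space d))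
    (f : ℝ → Space d → F) : Prop :=
  MemLp (Function.uncurry f) 2 (cylinder T Ω) ∧
    ∃ f' : ℝ → Space d → F, MemLp (Function.uncurry f') 2 (cylinder T Ω) ∧ IsTimeDeriv T Ω f f'

/-- `f ∈ L^2(0,T; H^σ(Ω))` for real `σ ≥ 0`. Here `H^σ(Ω)` consists of the restrictions to `Ω` of the
elements of `H^σ(ℝ^d)`, and `H^σ(ℝ^d)` is isometric to `L^2(ℝ^d)` through the Bessel potential `J_σ`,
the Fourier multiplier `(1 + |ξ|^2)^(σ/2)`. So the condition is that `f(t)` is the restriction to `Ω`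
of some `w ∈ H^σ(ℝ^d)` with `J_σ w = G(t)`, where `G ∈ L^2(0,T; L^2(ℝ^d))` in the sense of Bochner. -/
def MemL2Sobolev (T : ℝ) (Ω : Set (Space d)) (σ : ℝ) (f : ℝ → Space d → ℝ) : Prop :=
  ∃ G : ℝ → Lp ℂ 2 (volume : Measure (Space d)), MemLp G 2 (volume.restrict (Ioo 0 T)) ∧
    ∀ᵐ t ∂volume.restrict (Ioo 0 T), ∃ w : Lp ℂ 2 (volume : Measure (Space d)),
      TemperedDistribution.besselPotential (Space d) ℂ σ (Lp.toTemperedDistribution w)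
        = Lp.toTemperedDistribution (G t) ∧
      ∀ᵐ x ∂volume.restrict Ω, w x = (f t x : ℂ)

/-! ### The weight -/

/-- `a` is an admissible weight on `Ω` with Dirichlet part `ΓD` of the boundary; here
`g = -Δ a`. Boundary values of derivatives are limits from inside `Ω`, and conditions that
involve the normal are imposed at the boundary points that have one. -/
structure IsWeight (Ω ΓD : Set (Space d)) (a : Space d → ℝ) : Prop where
  smooth_interior : ContDiffOn ℝ 4 a Ω
  smooth_closure : ContDiffUpToBoundary 3 Ω a
  continuousOn : ContinuousOn a (closure Ω)
  nonneg : ∀ x ∈ closure Ω, 0 ≤ a x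
  hess_nonpos : ∀ x ∈ Ω, ∀ v : Space d, fderiv ℝ (fderiv ℝ a) x v v ≤ 0
  g_nonneg : ∀ x ∈ Ω, 0 ≤ -(Δ a) x
  dirichlet_subset : ΓD ⊆ frontier Ω
  dirichlet : ∀ x ∈ ΓD, a x = 0
  neumann : ∀ x ∈ frontier Ω \ ΓD, ∀ ν : Space d, IsOuterUnitNormal Ω x ν →
    Tendsto (fun y => ⟪∇ a y, ν⟫) (𝓝[Ω] x) (𝓝 0)
  laplacian_g_nonpos : ∀ x ∈ Ω, (Δ (fun y => -(Δ a) y)) x ≤ 0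
  normal_deriv_g_nonneg : ∀ x ∈ frontier Ω, ∀ ν : Space d, IsOuterUnitNormal Ω x ν →
    ∃ l : ℝ, 0 ≤ l ∧ Tendsto (fun y => ⟪∇ (fun z => -(Δ a) z) y, ν⟫) (𝓝[Ω] x) (𝓝 l)

/-! ### The quantum hydrodynamic system -/

/-- The Bohm potential `Δ√r / √r` of a density `r`. -/
def bohm (r : Space d → ℝ) (x : Space d) : ℝ :=
  (Δ (fun y => √(r y))) x / √(r x)

/-- The continuity equation `ρ_t + div (ρ u) = 0` in `(0,T) × Ω`. -/
def MassEquation (T : ℝ) (Ω : Set (Space d)) (ρ : ℝ → Space d → ℝ) (u : ℝ → Space d → Space d) :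
    Prop :=
  ∃ r : ℝ → Space d → ℝ, IsTimeDeriv T Ω ρ r ∧
    ∀ᵐ t ∂volume.restrict (Ioo 0 T), ∀ᵐ x ∂volume.restrict Ω,
      r t x + divergence (fun y => ρ t y • u t y) x = 0

/-- The momentum equation `(ρ u)_t + div (ρ u ⊗ u) + ∇ P(ρ) = ρ ∇ (Δ√ρ / √ρ)` in `(0,T) × Ω`, in the
sense of distributions in `Ω` for almost every `t` (for `ρ(t) ∈ H^(s+2)`, the third derivatives in the
last term need not be functions). -/
def MomentumEquation (T : ℝ) (Ω : Set (Space d)) (P : ℝ → ℝ) (ρ : ℝ → Space d → ℝ)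
    (u : ℝ → Space d → Space d) : Prop :=
  ∃ m : ℝ → Space d → Space d, IsTimeDeriv T Ω (fun t x => ρ t x • u t x) m ∧
    ∀ᵐ t ∂volume.restrict (Ioo 0 T), ∀ φ : Space d → Space d,
      ContDiff ℝ ∞ φ → HasCompactSupport φ → tsupport φ ⊆ Ω →
      ∫ x in Ω, ⟪m t x, φ x⟫ =
        ∫ x in Ω, (ρ t x * ⟪u t x, fderiv ℝ φ x (u t x)⟫ + P (ρ t x) * divergence φ x
          - bohm (ρ t) x * divergence (fun y => ρ t y • φ y) x)

/-- `(ρ, u)` is a positive solution on `[0,T]` of the initial boundary value problem. Values at the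
boundary are those of the representatives of `ρ(t)` and `u(t)` that are continuous on the closure of
`Ω`; boundary values of derivatives are limits from inside `Ω`. -/
structure IsSolution (Ω ΓD : Set (Space d)) (a : Space d → ℝ) (P : ℝ → ℝ) (c s : ℝ)
    (ρI : Space d → ℝ) (uI : Space d → Space d) (T : ℝ)
    (ρ : ℝ → Space d → ℝ) (u : ℝ → Space d → Space d) : Prop where
  rho_memH1L2 : MemH1L2 T Ω ρ
  rho_memL2Sobolev : MemL2Sobolev T Ω (s + 2) ρ
  u_memH1L2 : MemH1L2 T Ω u
  u_memL2Sobolev : ∀ i : Fin d, MemL2Sobolev T Ω (s + 1) (fun t x => u t x i)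
  rho_continuousOn : ∀ᵐ t ∂volume.restrict (Ioo 0 T), ContinuousOn (ρ t) (closure Ω)
  u_continuousOn : ∀ᵐ t ∂volume.restrict (Ioo 0 T), ContinuousOn (u t) (closure Ω)
  pos : ∀ᵐ t ∂volume.restrict (Ioo 0 T), ∀ x ∈ closure Ω, 0 < ρ t x
  mass : MassEquation T Ω ρ u
  momentum : MomentumEquation T Ω P ρ u
  rho_initial : ∀ᵐ x ∂volume.restrict Ω, ρ 0 x = ρI x
  u_initial : ∀ᵐ x ∂volume.restrict Ω, u 0 x = uI x
  boundary_dirichlet : ∀ᵐ t ∂volume.restrict (Ioo 0 T), ∀ x ∈ ΓD, ∀ ν : Space d,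
    IsOuterUnitNormal Ω x ν →
    Tendsto (fun y => ⟪∇ a y, ν⟫ * (bohm (ρ t) y + ‖∇ (fun z => √(ρ t z)) y‖ ^ 2 / ρ t y
        - P (ρ t y) / ρ t y) - ⟪u t y, ∇ a y⟫ * ⟪u t y, ν⟫) (𝓝[Ω] x) (𝓝 c)
  boundary_neumann : ∀ᵐ t ∂volume.restrict (Ioo 0 T), ∀ x ∈ frontier Ω \ ΓD, ∀ ν : Space d,
    IsOuterUnitNormal Ω x ν → ⟪u t x, ν⟫ = 0
  boundary_rho : ∀ᵐ t ∂volume.restrict (Ioo 0 T), ∀ x ∈ frontier Ω, ∀ ν : Space d,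
    IsOuterUnitNormal Ω x ν →
    Tendsto (fun y => ⟪∇ (fun z => √(ρ t z)) y, ν⟫) (𝓝[Ω] x) (𝓝 0)

end QHD

end

/-! This is a virial argument. Put `A(t) = ∫ a ρ` and `J(t) = ∫ ρ u · ∇a`. The continuity equation
gives `A' ≤ J`: the boundary term `a ρ u · ν` vanishes, on the Dirichlet part through `a` and
elsewhere through `u · ν`. The momentum equation tested with `∇a` gives `J' ≤ -∫ P(ρ) g ≤ 0`. The
convective term is signed by the concavity of `a`. For the Bohm term, `bohm_identity` writes `-(Δr /
r) div (r² ∇a)`, with `r = √ρ`, as the divergence of `bohmFlux` plus `2 Hess a (∇r, ∇r) + (1/2) ρ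
Δg`, and both remainders are nonpositive. The total normal flux at the boundary tends to `-ρ c +
(1/2) ρ ∂g/∂ν ≥ 0` on the Dirichlet part and to `(1/2) ρ ∂g/∂ν ≥ 0` elsewhere (`virialFlux_normal`).
Hence `0 ≤ A(T) ≤ A(0) + T M`, which bounds `T`.

For the second assertion, `J' < 0` almost everywhere as soon as `Δa` is not identically zero. If `Δa
= 0`, integrating `div (a ∇a) = |∇a|²` yields `∇a = 0` and so `M = 0`, which is excluded. So `J`
drops below `M` at any positive time, and `A` would be driven negative strictly before `T*`: no
solution lives on every `[0,T]` with `T < T*`, and the assertion holds vacuously.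

The analytic core is `divergence_ineq`, a one-sided divergence theorem on Lipschitz domains that
needs neither traces nor surface measure. It asks only for a bounded field whose normal component
has a nonnegative limit wherever a normal exists. A partition of unity reduces it to a boundary
chart. There the test function is cut off at depth of order `ε` below the graph, and Rademacher's
theorem and dominated convergence show that the inward flux through this layer tends to zero.

Regularity comes from the Sobolev embedding: `s > d/2` makes `ρ(t)` of class `C²` and `u(t)` of
class `C¹` up to the boundary. The momentum equation stays distributional, so test fields built from
`∇a` are reached by mollification (`momentum_balance_C1`). -/

namespace QHD

/-! ### Sobolev embedding through the Fourier transform -/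

section SobolevEmbedding

open FourierTransform SchwartzMap

/-- The symbol `(1 + |ξ|²)^(-σ/2)` times an `L²` function has integrable moments up to order `k`
when `σ > d/2 + k`. -/
lemma integrable_pow_mul_bessel_mul {E : Type*} [NormedAddCommGroup E] [InnerProductSpace ℝ E]
    [FiniteDimensional ℝ E] [MeasurableSpace E] [BorelSpace E] {σ : ℝ} {k n : ℕ} (hn : n ≤ k)
    (hσ : (Module.finrank ℝ E : ℝ) / 2 + k < σ) {u : E → ℂ} (hu : MemLp u 2 volume) :
    Integrable (fun ξ : E => ‖ξ‖ ^ n * ‖(((1 + ‖ξ‖ ^ 2) ^ (-σ / 2) : ℝ) : ℂ) * u ξ‖) := by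
  have h2 : MemLp (fun ξ : E => (1 + ‖ξ‖ ^ 2) ^ (-(σ - k) / 2)) 2 volume := by
    have hc : Continuous (fun ξ : E => (1 + ‖ξ‖ ^ 2) ^ (-(σ - k) / 2)) := by
      refine Continuous.rpow_const (by fun_prop) fun x => Or.inl (by positivity)
    rw [memLp_two_iff_integrable_sq hc.aestronglyMeasurable]
    -- The square of the weight has exponent `-(σ - k) = -r / 2`; the requirement `r > dim E` is
    -- exactly `σ > dim E / 2 + k`.
    have h := integrable_rpow_neg_one_add_norm_sq (E := E) (μ := volume) (r := 2 * (σ - k))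
      (by linarith)
    refine h.congr (Eventually.of_forall fun x => ?_)
    simp only
    rw [← Real.rpow_mul_natCast (by positivity)]
    congr 1
    push_cast
    ring
  have h3 := h2.integrable_mul hu.norm
  refine h3.mono' ?_ (Eventually.of_forall fun ξ => ?_)
  · refine (by fun_prop : Continuous fun ξ : E => ‖ξ‖ ^ n).aestronglyMeasurable.mul ?_
    refine (AEStronglyMeasurable.mul ?_ hu.1).norm
    refine (Complex.continuous_ofReal.comp ?_).aestronglyMeasurable
    exact Continuous.rpow_const (by fun_prop) fun x => Or.inl (by positivity)
  · simp only [Pi.mul_apply, norm_mul, norm_pow, Complex.norm_real, Real.norm_eq_abs,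
      abs_norm, abs_abs]
    rw [abs_of_nonneg (a := (1 + ‖ξ‖ ^ 2) ^ (-σ / 2)) (by positivity), ← mul_assoc]
    gcongr
    have h1 : (1 : ℝ) ≤ 1 + ‖ξ‖ ^ 2 := by nlinarith [sq_nonneg ‖ξ‖]
    have h4 : ‖ξ‖ ^ n ≤ (1 + ‖ξ‖ ^ 2) ^ ((k : ℝ) / 2) := by
      calc ‖ξ‖ ^ n = (‖ξ‖ ^ 2) ^ ((n : ℝ) / 2) := by
            rw [← Real.rpow_natCast, ← Real.rpow_natCast, ← Real.rpow_mul (by positivity)]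
            congr 1
            push_cast
            ring
        _ ≤ (1 + ‖ξ‖ ^ 2) ^ ((n : ℝ) / 2) := by
            gcongr
            linarith
        _ ≤ _ := by
            apply Real.rpow_le_rpow_of_exponent_le h1
            have : (n : ℝ) ≤ k := by exact_mod_cast hn
            linarith
    calc ‖ξ‖ ^ n * (1 + ‖ξ‖ ^ 2) ^ (-σ / 2)
        ≤ (1 + ‖ξ‖ ^ 2) ^ ((k : ℝ) / 2) * (1 + ‖ξ‖ ^ 2) ^ (-σ / 2) := by gcongr
      _ = (1 + ‖ξ‖ ^ 2) ^ (-(σ - k) / 2) := by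
          rw [← Real.rpow_add (by positivity)]
          congr 1
          ring

/-- The Sobolev embedding: an element of `H^σ(ℝ^d)` with `σ > d/2 + k` agrees almost everywhere
with a function of class `C^k`. -/
theorem exists_contDiff_ae_eq_of_besselPotential {E : Type*} [NormedAddCommGroup E]
    [InnerProductSpace ℝ E] [FiniteDimensional ℝ E] [MeasurableSpace E] [BorelSpace E] {σ : ℝ}
    {k : ℕ} (hσ : (Module.finrank ℝ E : ℝ) / 2 + k < σ) (w G : Lp ℂ 2 (volume : Measure E))
    (h : TemperedDistribution.besselPotential E ℂ σ (Lp.toTemperedDistribution w)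
        = Lp.toTemperedDistribution G) :
    ∃ f : E → ℂ, ContDiff ℝ k f ∧ w =ᵐ[volume] f := by
  set u : Lp ℂ 2 (volume : Measure E) := 𝓕 G with hu
  -- Formally `w = 𝓕⁻ v`. Integrable moments of `v` up to order `k` make `𝓕⁻ v` of class `C^k`, and
  -- it remains to identify it with `w`.
  set v : E → ℂ := fun ξ => (((1 + ‖ξ‖ ^ 2) ^ (-σ / 2) : ℝ) : ℂ) * u ξ with hv
  have hint : ∀ n ≤ k, Integrable (fun ξ : E => ‖ξ‖ ^ n * ‖v ξ‖) := fun n hn =>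
    integrable_pow_mul_bessel_mul hn hσ (Lp.memLp u)
  have hvm : AEStronglyMeasurable v volume := by
    refine AEStronglyMeasurable.mul ?_ (Lp.memLp u).1
    refine (Complex.continuous_ofReal.comp ?_).aestronglyMeasurable
    exact Continuous.rpow_const (by fun_prop) fun x => Or.inl (by positivity)
  have hvi : Integrable v := by
    have := hint 0 (Nat.zero_le _)
    simp only [pow_zero, one_mul] at this
    exact (integrable_norm_iff hvm).1 this
  have hcd : ContDiff ℝ k (𝓕⁻ v) := by
    have h1 : ContDiff ℝ k (𝓕 v) :=
      Real.contDiff_fourier (N := k) fun n hn => hint n (by exact_mod_cast hn)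
    have : (𝓕⁻ v) = fun x => 𝓕 v (-x) := by
      ext x
      exact Real.fourierInv_eq_fourier_neg v x
    rw [this]
    exact h1.comp contDiff_neg
  refine ⟨𝓕⁻ v, hcd, ?_⟩
  rw [← TemperedDistribution.besselPotential_neg_apply_eq_iff] at h
  -- The identification is by duality: against a test function, `w` is the Bessel potential of order
  -- `-σ` of `G`, whose multiplier acts on the Fourier side and produces `v`.
  apply ae_eq_of_integral_contDiff_smul_eq
  · exact (Lp.memLp w).locallyIntegrable one_le_two
  · exact hcd.continuous.locallyIntegrable
  · intro g g_smooth g_cpt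
    have hg₁ : HasCompactSupport (Complex.ofRealCLM ∘ g) := g_cpt.comp_left rfl
    have hg₂ : ContDiff ℝ ∞ (Complex.ofRealCLM ∘ g) := by fun_prop
    set S : 𝓢(E, ℂ) := hg₁.toSchwartzMap hg₂ with hS
    have hSg : ∀ x, S x = (g x : ℂ) := fun x => rfl
    have e1 : ∫ x, g x • w x = Lp.toTemperedDistribution w S := by
      rw [Lp.toTemperedDistribution_apply]
      rfl
    have e2 : Lp.toTemperedDistribution w S = ∫ ξ, (𝓕⁻ S) ξ • v ξ := by
      rw [← h, TemperedDistribution.besselPotential,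
        TemperedDistribution.fourierMultiplierCLM_apply, TemperedDistribution.fourierInv_apply,
        TemperedDistribution.smulLeftCLM_apply_apply, Lp.fourier_toTemperedDistribution_eq,
        Lp.toTemperedDistribution_apply]
      refine integral_congr_ae (Eventually.of_forall fun ξ => ?_)
      simp only
      rw [SchwartzMap.smulLeftCLM_apply_apply (by fun_prop)]
      simp only [hv, smul_eq_mul]
      ring
    have e3 : ∫ ξ, (𝓕⁻ S) ξ • v ξ = ∫ x, S x • (𝓕⁻ v) x := by
      -- The self-adjointness of the Fourier integral, taken with the form `-⟪·,·⟫`, is the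
      -- self-adjointness of the inverse transform.
      have := VectorFourier.integral_fourierIntegral_smul_eq_flip (μ := volume) (ν := volume)
        (e := Real.fourierChar) (L := -(innerₗ E)) (f := (S : E → ℂ)) (g := v)
        Real.continuous_fourierChar (by simpa using! continuous_inner.neg) S.integrable hvi
      convert! this using 3 with ξ x
      · rw [SchwartzMap.fourierInv_coe, Real.fourierInv_eq]
        simp [VectorFourier.fourierIntegral]
      · rw [Real.fourierInv_eq]
        simp [VectorFourier.fourierIntegral, real_inner_comm]
    rw [e1, e2, e3]
    rfl

end SobolevEmbedding

/-! ### Mollification of Lipschitz functions -/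

section Mollification

open scoped Convolution
open ContinuousLinearMap (lsmul)

variable {E F : Type*} [NormedAddCommGroup E] [InnerProductSpace ℝ E] [FiniteDimensional ℝ E]
  [MeasurableSpace E] [BorelSpace E] [NormedAddCommGroup F] [NormedSpace ℝ F]

lemma integrable_bump_smul (η : ContDiffBump (0 : E)) {g : E → F} {C : ℝ}
    (hg : AEStronglyMeasurable g (volume : Measure E)) (hC : ∀ x, ‖g x‖ ≤ C) :
    Integrable (fun t => η.normed volume t • g t) :=
  η.integrable_normed.smul_bdd C hg (Eventually.of_forall hC)

lemma norm_bump_integral_le (η : ContDiffBump (0 : E)) {g : E → F} {C : ℝ}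
    (hC : ∀ x, ‖g x‖ ≤ C) :
    ‖∫ t, η.normed volume t • g t‖ ≤ C := by
  calc ‖∫ t, η.normed volume t • g t‖ ≤ ∫ t, η.normed volume t * C := by
        refine norm_integral_le_of_norm_le (η.integrable_normed.mul_const C)
          (Eventually.of_forall fun t => ?_)
        rw [norm_smul, Real.norm_of_nonneg (η.nonneg_normed t)]
        exact mul_le_mul_of_nonneg_left (hC t) (η.nonneg_normed t)
    _ = C := by rw [integral_mul_const, η.integral_normed, one_mul]

/-- By Rademacher's theorem `φ` is differentiable at `x - t` for almost every `t`, and the Lipschitz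
constant dominates the difference quotients. So one differentiates under the integral, and
mollification commutes with the almost-everywhere derivative. -/
lemma hasFDerivAt_bump_convolution [FiniteDimensional ℝ F] (η : ContDiffBump (0 : E)) {φ : E → F} {K : NNReal}
    (hφ : LipschitzWith K φ) {C : ℝ} (hC : ∀ x, ‖φ x‖ ≤ C) (x : E) :
    HasFDerivAt (η.normed volume ⋆[lsmul ℝ ℝ, volume] φ)
      ((η.normed volume ⋆[lsmul ℝ ℝ, volume] fderiv ℝ φ) x) x := by
  have hms : ∀ y : E, AEStronglyMeasurable (fun t => η.normed volume t • φ (y - t)) volume := by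
    intro y
    refine (η.continuous_normed.smul (hφ.continuous.comp ?_)).aestronglyMeasurable
    fun_prop
  have hd : ∀ᵐ t ∂(volume : Measure E), DifferentiableAt ℝ φ (x - t) := by
    have := (Measure.measurePreserving_sub_left (volume : Measure E) x).quasiMeasurePreserving
    exact this.ae hφ.ae_differentiableAt
  refine (hasFDerivAt_integral_of_dominated_loc_of_lip (s := univ)
    (bound := fun t => η.normed volume t * K) univ_mem
    (F := fun y t => η.normed volume t • φ (y - t))
    (F' := fun t => η.normed volume t • fderiv ℝ φ (x - t))
    (Eventually.of_forall hms) ?_ ?_ ?_ ?_ ?_).2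
  · exact integrable_bump_smul η (g := fun t => φ (x - t))
      (hφ.continuous.comp (by fun_prop)).aestronglyMeasurable (fun t => hC _)
  · refine η.continuous_normed.aestronglyMeasurable.smul ?_
    exact ((measurable_fderiv ℝ φ).comp (by fun_prop)).aestronglyMeasurable
  · refine Eventually.of_forall fun t => LipschitzOnWith.of_dist_le_mul fun y _ z _ => ?_
    rw [dist_smul₀, Real.norm_of_nonneg (η.nonneg_normed t), Real.coe_nnabs,
      abs_of_nonneg (mul_nonneg (η.nonneg_normed t) K.coe_nonneg), mul_assoc]
    refine mul_le_mul_of_nonneg_left ?_ (η.nonneg_normed t)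
    simpa using hφ.dist_le_mul (y - t) (z - t)
  · exact η.integrable_normed.mul_const _
  · filter_upwards [hd] with t ht
    have h1 : HasFDerivAt (fun y => φ (y - t)) (fderiv ℝ φ (x - t)) x := by
      simpa [Function.comp_def] using ht.hasFDerivAt.comp x ((hasFDerivAt_id x).sub_const t)
    exact h1.const_smul _

/-- Mollification of a compactly supported Lipschitz function. -/
theorem exists_smooth_approx [FiniteDimensional ℝ F] {φ : E → F} {K : NNReal} (hφ : LipschitzWith K φ)
    (hc : HasCompactSupport φ) {Ω : Set E} (hΩ : IsOpen Ω) (hs : tsupport φ ⊆ Ω) :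
    ∃ Φ : ℕ → E → F, (∀ n, ContDiff ℝ ∞ (Φ n)) ∧ (∀ n, HasCompactSupport (Φ n)) ∧
      (∀ n, tsupport (Φ n) ⊆ Ω) ∧
      (∃ C, ∀ n x, ‖Φ n x‖ ≤ C ∧ ‖fderiv ℝ (Φ n) x‖ ≤ C) ∧
      (∀ x, Tendsto (fun n => Φ n x) atTop (𝓝 (φ x))) ∧
      (∀ᵐ x ∂(volume : Measure E),
        Tendsto (fun n => fderiv ℝ (Φ n) x) atTop (𝓝 (fderiv ℝ φ x))) ∧
      ∀ L : F →L[ℝ] ℝ, (∀ x, 0 ≤ L (φ x)) → ∀ n x, 0 ≤ L (Φ n x) := by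
  obtain ⟨δ, hδ, hδΩ⟩ := hc.isCompact.exists_cthickening_subset_open hΩ hs
  obtain ⟨C, hC⟩ := hc.exists_bound_of_continuous hφ.continuous
  -- The outer radius is at most `δ`, which keeps supports inside `Ω`, and tends to zero. Its
  -- bounded ratio to the inner radius is what Lebesgue differentiation needs for the convergence of
  -- the derivatives, which are merely locally integrable.
  let η : ℕ → ContDiffBump (0 : E) := fun n =>
    ⟨δ / (2 * (n + 1)), δ / (n + 1), by positivity, by
      apply div_lt_div_of_pos_left hδ (by positivity)
      have : (0 : ℝ) ≤ n := n.cast_nonneg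
      linarith⟩
  have hη : Tendsto (fun n => (η n).rOut) atTop (𝓝 0) := by
    have := (tendsto_one_div_add_atTop_nhds_zero_nat (𝕜 := ℝ)).const_mul δ
    simpa [η, div_eq_mul_inv] using this
  have hη2 : ∀ n, (η n).rOut ≤ 2 * (η n).rIn := by
    intro n
    change δ / (n + 1) ≤ 2 * (δ / (2 * (n + 1)))
    apply le_of_eq
    field_simp
  have hη3 : ∀ n, (η n).rOut ≤ δ := by
    intro n
    change δ / (n + 1) ≤ δ
    apply div_le_self hδ.le
    have : (0 : ℝ) ≤ n := n.cast_nonneg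
    linarith
  have hloc : LocallyIntegrable φ volume := hφ.continuous.locallyIntegrable
  have hd : ∀ n x, HasFDerivAt ((η n).normed volume ⋆[lsmul ℝ ℝ, volume] φ)
      (((η n).normed volume ⋆[lsmul ℝ ℝ, volume] fderiv ℝ φ) x) x := fun n x =>
    hasFDerivAt_bump_convolution (η n) hφ hC x
  have hsub : ∀ n, tsupport ((η n).normed volume ⋆[lsmul ℝ ℝ, volume] φ) ⊆
      Metric.cthickening δ (tsupport φ) := by
    intro n
    refine closure_minimal ?_ Metric.isClosed_cthickening
    refine (support_convolution_subset _).trans ?_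
    rintro _ ⟨y, hy, z, hz, rfl⟩
    rw [(η n).support_normed_eq] at hy
    refine Metric.mem_cthickening_of_dist_le _ z _ _ (subset_tsupport _ hz) ?_
    have : dist (y + z) z = ‖y‖ := by simp [dist_eq_norm]
    rw [this]
    exact (mem_ball_zero_iff.1 hy).le.trans (hη3 n)
  refine ⟨fun n => (η n).normed volume ⋆[lsmul ℝ ℝ, volume] φ, fun n => ?_, fun n => ?_,
    fun n => (hsub n).trans hδΩ, ⟨max C K, fun n x => ⟨?_, ?_⟩⟩, fun x => ?_, ?_, ?_⟩
  · exact (η n).hasCompactSupport_normed.contDiff_convolution_left _ (η n).contDiff_normed hloc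
  · exact (η n).hasCompactSupport_normed.convolution _ hc
  · exact (norm_bump_integral_le (η n) (g := fun t => φ (x - t)) fun t => hC _).trans
      (le_max_left _ _)
  · rw [(hd n x).fderiv]
    exact (norm_bump_integral_le (η n) (g := fun t => fderiv ℝ φ (x - t))
      fun t => norm_fderiv_le_of_lipschitz ℝ hφ).trans (le_max_right _ _)
  · exact ContDiffBump.convolution_tendsto_right_of_continuous hη hφ.continuous x
  · have hl : LocallyIntegrable (fderiv ℝ φ) (volume : Measure E) := by
      refine (locallyIntegrable_const (K : ℝ)).mono
        (measurable_fderiv ℝ φ).aestronglyMeasurable (Eventually.of_forall fun x => ?_)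
      rw [Real.norm_of_nonneg K.coe_nonneg]
      exact norm_fderiv_le_of_lipschitz ℝ hφ
    filter_upwards [ContDiffBump.ae_convolution_tendsto_right_of_locallyIntegrable hη
      (Eventually.of_forall hη2) hl] with x hx
    refine hx.congr fun n => ?_
    rw [(hd n x).fderiv]
  -- Averaging against a probability density preserves the half-space `L ≥ 0`; for real functions
  -- and `L = id` this keeps test functions nonnegative.
  · intro L hL n x
    have := L.integral_comp_comm (integrable_bump_smul (η n) (g := fun t => φ (x - t))
      (hφ.continuous.comp (by fun_prop)).aestronglyMeasurable (fun t => hC _))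
    change 0 ≤ L (∫ t, (η n).normed volume t • φ (x - t))
    rw [← this]
    refine integral_nonneg fun t => ?_
    rw [map_smul]
    exact mul_nonneg ((η n).nonneg_normed t) (hL _)

end Mollification

/-! ### Integrals over thin layers below a graph -/

section BoundaryLayer

open scoped ENNReal

variable {E : Type*} [NormedAddCommGroup E] [InnerProductSpace ℝ E] [FiniteDimensional ℝ E]
  [MeasurableSpace E] [BorelSpace E]

/-- Integration first along the lines of direction `n`, then over a slab of unit width. -/
lemma lintegral_eq_slab {n : E} (hn : ‖n‖ = 1) {F : E → ℝ≥0∞} (hF : Measurable F) :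
    ∫⁻ y, F y = ∫⁻ y in {y : E | ⟪y, n⟫ ∈ Icc (0 : ℝ) 1}, ∫⁻ τ : ℝ, F (y + τ • n) := by
  set S : Set E := {y : E | ⟪y, n⟫ ∈ Icc (0 : ℝ) 1} with hS
  have hSm : MeasurableSet S :=
    (measurableSet_Icc).preimage (by fun_prop : Continuous fun y : E => ⟪y, n⟫).measurable
  have hnn : ⟪n, n⟫ = (1 : ℝ) := by rw [real_inner_self_eq_norm_sq, hn]; norm_num
  have hm : Measurable fun p : E × ℝ => F (p.1 + p.2 • n) :=
    hF.comp (by fun_prop : Continuous fun p : E × ℝ => p.1 + p.2 • n).measurable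
  symm
  calc ∫⁻ y in S, ∫⁻ τ : ℝ, F (y + τ • n)
      = ∫⁻ τ : ℝ, ∫⁻ y in S, F (y + τ • n) := lintegral_lintegral_swap hm.aemeasurable
    _ = ∫⁻ τ : ℝ, ∫⁻ y, S.indicator 1 (y - τ • n) * F y := by
        refine lintegral_congr fun τ => ?_
        rw [← lintegral_indicator hSm,
          ← lintegral_add_right_eq_self (fun y => S.indicator 1 (y - τ • n) * F y) (τ • n)]
        refine lintegral_congr fun y => ?_
        by_cases hy : y ∈ S <;> simp [hy]
    _ = ∫⁻ y, ∫⁻ τ : ℝ, S.indicator 1 (y - τ • n) * F y := by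
        refine lintegral_lintegral_swap (Measurable.aemeasurable ?_)
        refine Measurable.mul ?_ (hF.comp measurable_snd)
        exact (measurable_one.indicator hSm).comp
          (by fun_prop : Continuous fun p : ℝ × E => p.2 - p.1 • n).measurable
    _ = ∫⁻ y, F y := by
        refine lintegral_congr fun y => ?_
        -- For fixed `y`, the `τ` that move `y` back into the slab form an interval of length `1`,
        -- so each point is counted with total weight one.
        have : ∀ τ : ℝ, S.indicator (1 : E → ℝ≥0∞) (y - τ • n)
            = (Icc (⟪y, n⟫ - 1) ⟪y, n⟫).indicator 1 τ := by
          intro τ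
          have : y - τ • n ∈ S ↔ τ ∈ Icc (⟪y, n⟫ - 1) ⟪y, n⟫ := by
            simp only [hS, mem_ofPred_eq, inner_sub_left, inner_smul_left, hnn, mem_Icc]
            simp only [conj_trivial, mul_one]
            constructor <;> rintro ⟨h1, h2⟩ <;> constructor <;> linarith
          by_cases h : y - τ • n ∈ S
          · rw [indicator_of_mem h, indicator_of_mem (this.1 h)]
            rfl
          · rw [indicator_of_notMem h, indicator_of_notMem (fun h' => h (this.2 h'))]
        simp_rw [this]
        rw [lintegral_mul_const _ (measurable_one.indicator measurableSet_Icc),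
          lintegral_indicator_one measurableSet_Icc, Real.volume_Icc]
        simp

/-- The substitution `τ = h - ε σ`. With `h` the height of the graph, `σ` is the depth in units of
`ε`, and the Jacobian `ε` cancels the weight `ε⁻¹` of the layer. -/
lemma lintegral_sub_mul {ε : ℝ} (hε : 0 < ε) (h : ℝ) (G : ℝ → ℝ≥0∞) (hG : Measurable G) :
    ∫⁻ τ : ℝ, G τ = ENNReal.ofReal ε * ∫⁻ σ : ℝ, G (h - ε * σ) := by
  calc ∫⁻ τ : ℝ, G τ = ∫⁻ τ : ℝ, G (h - τ) := (lintegral_sub_left_eq_self G h).symm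
    _ = ∫⁻ τ : ℝ, G (h - τ) ∂(ENNReal.ofReal |ε| • Measure.map (ε * ·) volume) := by
        rw [Real.smul_map_volume_mul_left hε.ne']
    _ = _ := by
        rw [lintegral_smul_measure, lintegral_map (f := fun τ => G (h - τ))
          (hG.comp (measurable_const.sub measurable_id)) (measurable_const_mul ε), abs_of_pos hε, smul_eq_mul]

/-- Integrals over a boundary layer of width of order `ε` below a graph, with weights of order
`ε⁻¹`, tend to zero if the integrand tends to zero at the graph along almost every line. -/
lemma tendsto_lintegral_boundary_layer {n : E} (hn : ‖n‖ = 1) {γ : E → ℝ} (hγ : Continuous γ)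
    (hγn : ∀ (y : E) (h : ℝ), γ (y + h • n) = γ y) {q : E → ℝ} (hq : Measurable q)
    {B R C : ℝ} (hqB : ∀ y, |q y| ≤ B) (hqR : ∀ y, R < ‖y‖ → q y = 0)
    {θ : ℝ → ℝ} (hθ : Continuous θ) (hθC : ∀ σ, |θ σ| ≤ C)
    (hθs : ∀ σ, σ ∉ Icc (1 : ℝ) 2 → θ σ = 0)
    (hlim : ∀ᵐ y ∂(volume : Measure E),
      Tendsto (fun t : ℝ => q (y + (γ y - ⟪y, n⟫ - t) • n)) (𝓝[>] 0) (𝓝 0)) :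
    Tendsto (fun ε : ℝ => ∫⁻ y, ENNReal.ofReal (ε⁻¹ * θ ((γ y - ⟪y, n⟫) / ε) * q y))
      (𝓝[>] 0) (𝓝 0) := by
  have hnn : ⟪n, n⟫ = (1 : ℝ) := by rw [real_inner_self_eq_norm_sq, hn]; norm_num
  have hB : 0 ≤ B := (abs_nonneg _).trans (hqB 0)
  have hC : 0 ≤ C := (abs_nonneg _).trans (hθC 0)
  set S : Set E := {y : E | ⟪y, n⟫ ∈ Icc (0 : ℝ) 1} with hS
  have hin : Continuous fun y : E => ⟪y, n⟫ := by fun_prop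
  have hmeas : ∀ ε : ℝ, Measurable fun y : E =>
      ENNReal.ofReal (ε⁻¹ * θ ((γ y - ⟪y, n⟫) / ε) * q y) := fun ε =>
    ((measurable_const.mul (hθ.comp ((hγ.sub hin).div_const ε)).measurable).mul hq).ennreal_ofReal
  -- after straightening the boundary
  have key : ∀ ε : ℝ, 0 < ε →
      ∫⁻ y, ENNReal.ofReal (ε⁻¹ * θ ((γ y - ⟪y, n⟫) / ε) * q y)
        = ∫⁻ y in S, ∫⁻ σ : ℝ,
          ENNReal.ofReal (θ σ * q (y + (γ y - ⟪y, n⟫ - ε * σ) • n)) := by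
    intro ε hε
    rw [lintegral_eq_slab hn (hmeas ε)]
    refine lintegral_congr fun y => ?_
    rw [lintegral_sub_mul hε (γ y - ⟪y, n⟫) (fun τ : ℝ => ENNReal.ofReal
        (ε⁻¹ * θ ((γ (y + τ • n) - ⟪y + τ • n, n⟫) / ε) * q (y + τ • n)))
      ((hmeas ε).comp (by fun_prop : Continuous fun τ : ℝ => y + τ • n).measurable),
      ← lintegral_const_mul' _ _ ENNReal.ofReal_ne_top]
    refine lintegral_congr fun σ => ?_
    rw [← ENNReal.ofReal_mul hε.le, hγn, inner_add_left, inner_smul_left, hnn]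
    congr 1
    have : (γ y - (⟪y, n⟫ + (starRingEnd ℝ) (γ y - ⟪y, n⟫ - ε * σ) * 1)) / ε = σ := by
      simp only [conj_trivial]
      field_simp
      ring
    rw [this]
    field_simp
  have hjm : ∀ ε : ℝ, Measurable fun p : E × ℝ =>
      ENNReal.ofReal (θ p.2 * q (p.1 + (γ p.1 - ⟪p.1, n⟫ - ε * p.2) • n)) := by
    intro ε
    refine ((hθ.comp continuous_snd).measurable.mul (hq.comp ?_)).ennreal_ofReal
    have : Continuous fun p : E × ℝ => γ p.1 - ⟪p.1, n⟫ - ε * p.2 :=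
      ((hγ.comp continuous_fst).sub (hin.comp continuous_fst)).sub (by fun_prop)
    exact (continuous_fst.add (this.smul continuous_const)).measurable
  refine Tendsto.congr' (f₁ := fun ε : ℝ => ∫⁻ y in S, ∫⁻ σ : ℝ,
      ENNReal.ofReal (θ σ * q (y + (γ y - ⟪y, n⟫ - ε * σ) • n))) ?_ ?_
  · filter_upwards [self_mem_nhdsWithin] with ε hε using (key ε hε).symm
  have hbd : ∀ ε y (σ : ℝ), ENNReal.ofReal (θ σ * q (y + (γ y - ⟪y, n⟫ - ε * σ) • n))
      ≤ (Icc (1 : ℝ) 2).indicator (fun _ => ENNReal.ofReal (C * B)) σ := by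
    intro ε y σ
    by_cases hσ : σ ∈ Icc (1 : ℝ) 2
    · rw [indicator_of_mem hσ]
      refine ENNReal.ofReal_le_ofReal ((le_abs_self _).trans ?_)
      rw [abs_mul]
      exact mul_le_mul (hθC _) (hqB _) (abs_nonneg _) hC
    · simp [hθs σ hσ]
  have h0 : ∫⁻ _ in S, (0 : ℝ≥0∞) = 0 := by simp
  rw [← h0]
  -- The radius `2 * R + 1`: if `q` is nonzero at a point `z` of the line through `y`, then `‖z‖ ≤
  -- R`, and `y` is the part of `z` orthogonal to `n` plus a component along `n` of size at most
  -- `1`.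
  refine tendsto_lintegral_filter_of_dominated_convergence
    ((Metric.closedBall (0 : E) (2 * R + 1)).indicator fun _ => ENNReal.ofReal (C * B))
    (Eventually.of_forall fun ε => (hjm ε).lintegral_prod_right') ?_ ?_ ?_
  · refine Eventually.of_forall fun ε => (ae_restrict_iff' ?_).2 (Eventually.of_forall ?_)
    · exact measurableSet_Icc.preimage hin.measurable
    intro y hy
    by_cases hyR : y ∈ Metric.closedBall (0 : E) (2 * R + 1)
    · rw [indicator_of_mem hyR]
      refine (lintegral_mono (hbd ε y)).trans (le_of_eq ?_)
      rw [lintegral_indicator_const measurableSet_Icc, Real.volume_Icc]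
      norm_num
    · rw [indicator_of_notMem hyR]
      have : ∀ σ : ℝ, ENNReal.ofReal (θ σ * q (y + (γ y - ⟪y, n⟫ - ε * σ) • n)) = 0 := by
        intro σ
        rw [hqR, mul_zero, ENNReal.ofReal_zero]
        by_contra! hle
        apply hyR
        rw [mem_closedBall_zero_iff]
        set z := y + (γ y - ⟪y, n⟫ - ε * σ) • n with hz
        have e1 : y = z - ⟪z, n⟫ • n + ⟪y, n⟫ • n := by
          rw [hz, inner_add_left, inner_smul_left, hnn]
          simp only [conj_trivial]
          module
        have e2 : |⟪z, n⟫| ≤ ‖z‖ := by simpa [hn] using abs_real_inner_le_norm z n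
        have e3 : |⟪y, n⟫| ≤ 1 := abs_le.2 ⟨by linarith [hy.1], hy.2⟩
        calc ‖y‖ ≤ ‖z‖ + ‖⟪z, n⟫ • n‖ + ‖⟪y, n⟫ • n‖ := by
              conv_lhs => rw [e1]
              exact (norm_add_le _ _).trans (add_le_add_left (norm_sub_le _ _) _)
          _ = ‖z‖ + |⟪z, n⟫| + |⟪y, n⟫| := by simp [norm_smul, hn]
          _ ≤ _ := by linarith
      simp [this]
  · rw [lintegral_indicator_const measurableSet_closedBall]
    exact ENNReal.mul_ne_top ENNReal.ofReal_ne_top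
      ((Measure.restrict_le_self _).trans_lt measure_closedBall_lt_top).ne
  · refine ae_restrict_of_ae ?_
    filter_upwards [hlim] with y hy
    have h00 : ∫⁻ _ : ℝ, (0 : ℝ≥0∞) = 0 := by simp
    rw [← h00]
    refine tendsto_lintegral_filter_of_dominated_convergence
      ((Icc (1 : ℝ) 2).indicator fun _ => ENNReal.ofReal (C * B))
      (Eventually.of_forall fun ε => (hjm ε).comp measurable_prodMk_left)
      (Eventually.of_forall fun ε => Eventually.of_forall (hbd ε y)) ?_
      (Eventually.of_forall fun σ => ?_)
    · rw [lintegral_indicator_const measurableSet_Icc]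
      exact ENNReal.mul_ne_top ENNReal.ofReal_ne_top (by simp)
    · by_cases hσ : σ ∈ Icc (1 : ℝ) 2
      · have hσ0 : 0 < σ := by linarith [hσ.1]
        have ht : Tendsto (fun ε : ℝ => ε * σ) (𝓝[>] 0) (𝓝[>] 0) := by
          refine tendsto_nhdsWithin_iff.2 ⟨?_, ?_⟩
          · have : Tendsto (fun ε : ℝ => ε * σ) (𝓝 0) (𝓝 (0 * σ)) := by
              exact (continuous_id.mul continuous_const).tendsto 0
            rw [zero_mul] at this
            exact this.mono_left nhdsWithin_le_nhds
          · filter_upwards [self_mem_nhdsWithin] with ε hε using mul_pos hε hσ0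
        have := (hy.comp ht).const_mul (θ σ)
        rw [mul_zero] at this
        simpa using! ENNReal.tendsto_ofReal this
      · simp [hθs σ hσ]

end BoundaryLayer

/-! ### Normals of Lipschitz graphs -/

section GraphNormal

variable {d : ℕ} {Ω : Set (Space d)} {n x₀ : Space d} {r : ℝ} {γ : Space d → ℝ}

lemma fderiv_eq_zero_of_invariant (hγn : ∀ (y : Space d) (h : ℝ), γ (y + h • n) = γ y)
    {b : Space d} (hd : DifferentiableAt ℝ γ b) : fderiv ℝ γ b n = 0 := by
  rw [← hd.lineDeriv_eq_fderiv, lineDeriv]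
  simp [hγn]

lemma fderiv_add_smul_of_invariant (hγn : ∀ (y : Space d) (h : ℝ), γ (y + h • n) = γ y)
    (b : Space d) (h : ℝ) : fderiv ℝ γ (b + h • n) = fderiv ℝ γ b := by
  have := fderiv_comp_add_right (𝕜 := ℝ) (f := γ) (x := b) (h • n)
  simp only [hγn] at this
  exact this.symm

lemma differentiableAt_add_smul_of_invariant
    (hγn : ∀ (y : Space d) (h : ℝ), γ (y + h • n) = γ y)
    {b : Space d} (hd : DifferentiableAt ℝ γ b) (h : ℝ) : DifferentiableAt ℝ γ (b + h • n) := by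
  rw [← differentiableAt_comp_add_right]
  simpa only [hγn] using hd

/-- At a boundary point where the local graph function is differentiable, the normalization of
`n - ∇γ` is the outward unit normal. -/
lemma graph_normal (hn : ‖n‖ = 1)
    (hγn : ∀ (y : Space d) (h : ℝ), γ (y + h • n) = γ y)
    (hch : ∀ y ∈ Metric.ball x₀ r, (y ∈ Ω ↔ ⟪y, n⟫ < γ y)) {b : Space d}
    (hb : b ∈ Metric.ball x₀ r) (hbn : ⟪b, n⟫ = γ b) (hd : DifferentiableAt ℝ γ b) :
    0 < ‖n - ∇ γ b‖ ∧ IsOuterUnitNormal Ω b (‖n - ∇ γ b‖⁻¹ • (n - ∇ γ b)) ∧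
      b ∈ frontier Ω ∧ ∀ᶠ t : ℝ in 𝓝[>] 0, b - t • n ∈ Ω := by
  have hnn : ⟪n, n⟫ = (1 : ℝ) := by rw [real_inner_self_eq_norm_sq, hn]; norm_num
  -- `N` is the gradient at `b` of the defining function `⟪y, n⟫ - γ y`. It is nonzero because `γ`
  -- is constant along `n`, whence `⟪N, n⟫ = 1`.
  set N := n - ∇ γ b with hN
  have hNn : ⟪N, n⟫ = (1 : ℝ) := by
    rw [hN, inner_sub_left, inner_gradient_left, fderiv_eq_zero_of_invariant hγn hd, hnn, sub_zero]
  have hNpos : 0 < ‖N‖ := by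
    rw [norm_pos_iff]
    intro h0
    rw [h0, inner_zero_left] at hNn
    exact zero_ne_one hNn
  have hin : Tendsto (fun t : ℝ => b - t • n) (𝓝[>] 0) (𝓝 b) := by
    have : Tendsto (fun t : ℝ => b - t • n) (𝓝 0) (𝓝 (b - (0 : ℝ) • n)) :=
      (by fun_prop : Continuous fun t : ℝ => b - t • n).tendsto 0
    rw [zero_smul, sub_zero] at this
    exact this.mono_left nhdsWithin_le_nhds
  have hins : ∀ᶠ t : ℝ in 𝓝[>] 0, b - t • n ∈ Ω := by
    filter_upwards [hin.eventually (Metric.isOpen_ball.mem_nhds hb), self_mem_nhdsWithin]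
      with t ht ht0
    rw [hch _ ht, sub_eq_add_neg, ← neg_smul, hγn, inner_add_left, inner_smul_left, hnn, hbn]
    have : (0 : ℝ) < t := ht0
    simp only [conj_trivial]
    linarith
  refine ⟨hNpos, ⟨?_, ?_⟩, ⟨?_, ?_⟩, hins⟩
  · rw [norm_smul, norm_inv, norm_norm, inv_mul_cancel₀ hNpos.ne']
  · intro ε hε
    -- The tolerance `ε * ‖N‖` becomes `ε` once the normal is divided by `‖N‖`.
    have hlo := hd.hasFDerivAt.isLittleO.def (mul_pos hε hNpos)
    filter_upwards [hlo, Metric.isOpen_ball.mem_nhds hb] with y hy hyb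
    rw [Real.norm_eq_abs, abs_le] at hy
    have e1 : ⟪y - b, N⟫ = ⟪y, n⟫ - γ b - fderiv ℝ γ b (y - b) := by
      rw [hN, inner_sub_right, real_inner_comm (∇ γ b), inner_gradient_left, inner_sub_left, hbn]
    have e2 : ⟪y - b, ‖N‖⁻¹ • N⟫ = ‖N‖⁻¹ * ⟪y - b, N⟫ := by
      rw [real_inner_smul_right]
    have e3 : ⟪y - b, N⟫ = ‖N‖ * ⟪y - b, ‖N‖⁻¹ • N⟫ := by
      rw [e2]
      field_simp
    constructor
    · intro h
      rw [hch y hyb]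
      have : ⟪y - b, N⟫ < ‖N‖ * (-ε * ‖y - b‖) := by
        rw [e3]
        exact mul_lt_mul_of_pos_left h hNpos
      nlinarith [hy.1]
    · intro h hyΩ
      rw [hch y hyb] at hyΩ
      have : ‖N‖ * (ε * ‖y - b‖) < ⟪y - b, N⟫ := by
        rw [e3]
        exact mul_lt_mul_of_pos_left h hNpos
      nlinarith [hy.2]
  · exact mem_closure_of_tendsto hin hins
  · intro hint
    have := (hch b hb).1 (interior_subset hint)
    linarith

end GraphNormal

/-! ### Weak inequalities with Lipschitz test functions -/

section WeakInequality

variable {d : ℕ} {Ω : Set (Space d)}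

lemma integrableOn_of_bdd (hΩ : IsOpen Ω) (hb : Bornology.IsBounded Ω) {F : Type*}
    [NormedAddCommGroup F] {g : Space d → F}
    (hg : AEStronglyMeasurable g (volume.restrict Ω)) {C : ℝ} (hC : ∀ x ∈ Ω, ‖g x‖ ≤ C) :
    IntegrableOn g Ω := by
  have hfin : IsFiniteMeasure (volume.restrict Ω) := ⟨by simpa using hb.measure_lt_top⟩
  exact Integrable.of_bound hg C
    ((ae_restrict_iff' hΩ.measurableSet).2 (Eventually.of_forall hC))

/-- A weak differential inequality extends from smooth to Lipschitz test functions. -/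
lemma weak_ineq_lipschitz (hΩ : IsOpen Ω) (hb : Bornology.IsBounded Ω) {f : Space d → ℝ}
    (hf : IntegrableOn f Ω) {Z : Space d → Space d} (hZm : Measurable Z) {B : ℝ}
    (hZB : ∀ x, ‖Z x‖ ≤ B)
    (hweak : ∀ ψ : Space d → ℝ, ContDiff ℝ ∞ ψ → HasCompactSupport ψ → tsupport ψ ⊆ Ω →
      (∀ x, 0 ≤ ψ x) → ∫ x in Ω, ψ x * f x ≤ ∫ x in Ω, fderiv ℝ ψ x (Z x))
    {ψ : Space d → ℝ} {K : NNReal} (hψ : LipschitzWith K ψ) (hc : HasCompactSupport ψ)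
    (hs : tsupport ψ ⊆ Ω) (h0 : ∀ x, 0 ≤ ψ x) :
    ∫ x in Ω, ψ x * f x ≤ ∫ x in Ω, fderiv ℝ ψ x (Z x) := by
  obtain ⟨Φ, hΦ, hΦc, hΦs, ⟨C, hC⟩, hΦlim, hΦd, hΦ0⟩ := exists_smooth_approx hψ hc hΩ hs
  have hB : 0 ≤ B := (norm_nonneg _).trans (hZB 0)
  have hfin : IsFiniteMeasure (volume.restrict Ω) := ⟨by simpa using hb.measure_lt_top⟩
  refine le_of_tendsto_of_tendsto' (f := fun k => ∫ x in Ω, Φ k x * f x)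
    (g := fun k => ∫ x in Ω, fderiv ℝ (Φ k) x (Z x)) (b := atTop) ?_ ?_ fun k =>
      hweak (Φ k) (hΦ k) (hΦc k) (hΦs k) (hΦ0 (ContinuousLinearMap.id ℝ ℝ) h0 k)
  · refine tendsto_integral_of_dominated_convergence (fun x => C * ‖f x‖) (fun k => ?_)
      (hf.norm.const_mul C) (fun k => Eventually.of_forall fun x => ?_)
      (Eventually.of_forall fun x => (hΦlim x).mul_const _)
    · exact (hΦ k).continuous.aestronglyMeasurable.mul hf.1
    · rw [norm_mul]
      exact mul_le_mul_of_nonneg_right (hC k x).1 (norm_nonneg _)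
  · refine tendsto_integral_of_dominated_convergence (fun _ => C * B) (fun k => ?_)
      (integrable_const _) (fun k => Eventually.of_forall fun x => ?_) ?_
    · refine Measurable.aestronglyMeasurable ?_
      exact isBoundedBilinearMap_apply.continuous.measurable.comp
        ((measurable_fderiv ℝ (Φ k)).prodMk hZm)
    · refine (ContinuousLinearMap.le_opNorm _ _).trans ?_
      exact mul_le_mul (hC k x).2 (hZB x) (norm_nonneg _) ((norm_nonneg _).trans (hC k x).2)
    · refine ae_restrict_of_ae ?_
      filter_upwards [hΦd] with x hx
      exact (ContinuousLinearMap.apply ℝ ℝ (Z x)).continuous.tendsto _ |>.comp hx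

end WeakInequality

/-! ### The one-dimensional cutoff -/

section Cutoff

/-- A smooth monotone cutoff: `0` on `(-∞, 1]`, `1` on `[2, ∞)`. -/
noncomputable def cutoff (σ : ℝ) : ℝ := Real.smoothTransition (σ - 1)

lemma contDiff_cutoff : ContDiff ℝ ∞ cutoff :=
  Real.smoothTransition.contDiff.comp (contDiff_id.sub contDiff_const)

lemma cutoff_of_le {σ : ℝ} (h : σ ≤ 1) : cutoff σ = 0 :=
  Real.smoothTransition.zero_of_nonpos (by linarith)

lemma cutoff_of_ge {σ : ℝ} (h : 2 ≤ σ) : cutoff σ = 1 :=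
  Real.smoothTransition.one_of_one_le (by linarith)

lemma cutoff_nonneg (σ : ℝ) : 0 ≤ cutoff σ := Real.smoothTransition.nonneg _

lemma cutoff_le_one (σ : ℝ) : cutoff σ ≤ 1 := Real.smoothTransition.le_one _

lemma deriv_cutoff_nonneg (σ : ℝ) : 0 ≤ deriv cutoff σ := by
  have : Monotone cutoff := fun x y h => Real.smoothTransition.monotone (by linarith)
  exact this.deriv_nonneg

lemma continuous_deriv_cutoff : Continuous (deriv cutoff) :=
  contDiff_cutoff.continuous_deriv (by simp)

lemma deriv_cutoff_eq_zero {σ : ℝ} (h : σ ∉ Icc (1 : ℝ) 2) : deriv cutoff σ = 0 := by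
  rw [mem_Icc, not_and_or, not_le, not_le] at h
  rcases h with h | h
  · have : cutoff =ᶠ[𝓝 σ] fun _ => 0 := by
      filter_upwards [Iio_mem_nhds h] with τ hτ using cutoff_of_le (le_of_lt hτ)
    rw [this.deriv_eq, deriv_const]
  · have : cutoff =ᶠ[𝓝 σ] fun _ => 1 := by
      filter_upwards [Ioi_mem_nhds h] with τ hτ using cutoff_of_ge (le_of_lt hτ)
    rw [this.deriv_eq, deriv_const]

lemma exists_deriv_cutoff_bound : ∃ C : ℝ, 0 ≤ C ∧ ∀ σ, |deriv cutoff σ| ≤ C := by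
  obtain ⟨C, hC⟩ := isCompact_Icc.exists_bound_of_continuousOn
    (continuous_deriv_cutoff.continuousOn (s := Icc (1 : ℝ) 2))
  refine ⟨max C 0, le_max_right _ _, fun σ => ?_⟩
  by_cases h : σ ∈ Icc (1 : ℝ) 2
  · exact (hC σ h).trans (le_max_left _ _)
  · rw [deriv_cutoff_eq_zero h, abs_zero]
    exact le_max_right _ _

lemma lipschitz_cutoff : ∃ C : NNReal, LipschitzWith C cutoff := by
  obtain ⟨C, hC0, hC⟩ := exists_deriv_cutoff_bound
  refine ⟨⟨C, hC0⟩, lipschitzWith_of_nnnorm_deriv_le (contDiff_cutoff.differentiable (by simp)) ?_⟩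
  intro σ
  exact hC σ

end Cutoff

/-! ### The divergence inequality in a boundary chart -/

section LocalInequality

variable {d : ℕ} {Ω : Set (Space d)}

lemma lipschitz_mul_of_bdd {E : Type*} [PseudoMetricSpace E] {f g : E → ℝ} {K L : NNReal}
    (hf : LipschitzWith K f) (hg : LipschitzWith L g) {A B : NNReal} (hA : ∀ x, |f x| ≤ A)
    (hB : ∀ x, |g x| ≤ B) : LipschitzWith (K * B + A * L) fun x => f x * g x := by
  refine LipschitzWith.of_dist_le_mul fun x y => ?_
  have h1 := hf.dist_le_mul x y
  have h2 := hg.dist_le_mul x y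
  rw [Real.dist_eq] at h1 h2 ⊢
  have : f x * g x - f y * g y = (f x - f y) * g x + f y * (g x - g y) := by ring
  rw [this]
  push_cast
  calc |(f x - f y) * g x + f y * (g x - g y)|
      ≤ |f x - f y| * |g x| + |f y| * |g x - g y| := by
        rw [← abs_mul, ← abs_mul]
        exact abs_add_le _ _
    _ ≤ (K * dist x y) * B + A * (L * dist x y) := by
        gcongr
        · exact hB x
        · exact hA y
    _ = _ := by ring

/-- The local form of the divergence inequality, in a boundary chart. -/
lemma chart_ineq (hΩ : IsOpen Ω) (hb : Bornology.IsBounded Ω) {f : Space d → ℝ}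
    (hf : IntegrableOn f Ω) {Z : Space d → Space d} (hZm : Measurable Z) {B : ℝ}
    (hZB : ∀ x, ‖Z x‖ ≤ B)
    (hweak : ∀ (ψ : Space d → ℝ) (K : NNReal), LipschitzWith K ψ → HasCompactSupport ψ →
      tsupport ψ ⊆ Ω → (∀ x, 0 ≤ ψ x) → ∫ x in Ω, ψ x * f x ≤ ∫ x in Ω, fderiv ℝ ψ x (Z x))
    (hν : ∀ x ∈ frontier Ω, ∀ ν : Space d, IsOuterUnitNormal Ω x ν →
      ∃ l : ℝ, 0 ≤ l ∧ Tendsto (fun y => ⟪Z y, ν⟫) (𝓝[Ω] x) (𝓝 l))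
    {n x₀ : Space d} {r : ℝ} {γ : Space d → ℝ} {K : NNReal} (hn : ‖n‖ = 1)
    (hγ : LipschitzWith K γ) (hγn : ∀ (y : Space d) (h : ℝ), γ (y + h • n) = γ y)
    (hch : ∀ y ∈ Metric.ball x₀ r, (y ∈ Ω ↔ ⟪y, n⟫ < γ y))
    {χ : Space d → ℝ} (hχ : ContDiff ℝ ∞ χ) (hχc : HasCompactSupport χ)
    (hχs : tsupport χ ⊆ Metric.ball x₀ r) (hχ0 : ∀ x, 0 ≤ χ x) :
    ∫ x in Ω, χ x * f x ≤ ∫ x in Ω, fderiv ℝ χ x (Z x) := by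
  have hB : 0 ≤ B := (norm_nonneg _).trans (hZB 0)
  have hfin : IsFiniteMeasure (volume.restrict Ω) := ⟨by simpa using hb.measure_lt_top⟩
  have hin : Continuous fun y : Space d => ⟪y, n⟫ := by fun_prop
  obtain ⟨A, hA⟩ := hχc.exists_bound_of_continuous hχ.continuous
  have hA0 : 0 ≤ A := (norm_nonneg _).trans (hA 0)
  obtain ⟨Kχ, hKχ⟩ := (hχ.of_le (by simp : (1 : ℕ∞ω) ≤ ∞)).lipschitzWith_of_hasCompactSupport hχc
    one_ne_zero
  obtain ⟨Cθ, hCθ0, hCθ⟩ := exists_deriv_cutoff_bound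
  obtain ⟨Kθ, hKθ⟩ := lipschitz_cutoff
  -- the height below the graph
  set H : Space d → ℝ := fun y => γ y - ⟪y, n⟫ with hH
  have hHc : Continuous H := hγ.continuous.sub hin
  have hHl : LipschitzWith (K + 1) H := by
    refine hγ.sub (LipschitzWith.of_dist_le_mul fun x y => ?_)
    rw [Real.dist_eq, ← inner_sub_left, NNReal.coe_one, one_mul, dist_eq_norm]
    simpa [hn] using abs_real_inner_le_norm (x - y) n
  -- The negative part of the flux of `Z` through the unnormalized outward normal `n - ∇γ`. Only
  -- inward flux can spoil the inequality, so only this part has to vanish at the boundary.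
  set W : Space d → ℝ := fun y => max (-(⟪n, Z y⟫ - fderiv ℝ γ y (Z y))) 0 with hW
  have hWm : Measurable W := by
    refine Measurable.max (Measurable.neg (Measurable.sub ?_ ?_)) measurable_const
    · exact (by fun_prop : Continuous fun z : Space d => ⟪n, z⟫).measurable.comp hZm
    · exact isBoundedBilinearMap_apply.continuous.measurable.comp
        ((measurable_fderiv ℝ γ).prodMk hZm)
  have hW0 : ∀ y, 0 ≤ W y := fun y => le_max_right _ _
  have hWB : ∀ y, W y ≤ (1 + K) * B := by
    intro y
    refine max_le ?_ (by positivity)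
    have h1 : |⟪n, Z y⟫| ≤ B := by
      refine (abs_real_inner_le_norm _ _).trans ?_
      rw [hn, one_mul]
      exact hZB y
    have h2 : |fderiv ℝ γ y (Z y)| ≤ K * B := by
      refine ((fderiv ℝ γ y).le_opNorm _).trans ?_
      exact mul_le_mul (norm_fderiv_le_of_lipschitz ℝ hγ) (hZB y) (norm_nonneg _) K.2
    have h3 := abs_le.1 h1
    have h4 := abs_le.1 h2
    linarith
  set q : Space d → ℝ := Ω.indicator fun y => χ y * W y with hq
  have hqm : Measurable q := (hχ.continuous.measurable.mul hWm).indicator hΩ.measurableSet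
  have hq0 : ∀ y, 0 ≤ q y := fun y =>
    indicator_nonneg (fun y _ => mul_nonneg (hχ0 y) (hW0 y)) y
  have hqχ : ∀ y, q y ≤ χ y * ((1 + K) * B) := by
    intro y
    by_cases hy : y ∈ Ω
    · rw [hq, indicator_of_mem hy]
      exact mul_le_mul_of_nonneg_left (hWB y) (hχ0 y)
    · rw [hq, indicator_of_notMem hy]
      exact mul_nonneg (hχ0 y) (by positivity)
  have hqB : ∀ y, |q y| ≤ A * ((1 + K) * B) := by
    intro y
    rw [abs_of_nonneg (hq0 y)]
    exact (hqχ y).trans (mul_le_mul_of_nonneg_right ((le_abs_self _).trans (hA y)) (by positivity))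
  obtain ⟨R, hR⟩ : ∃ R, ∀ y, R < ‖y‖ → q y = 0 := by
    obtain ⟨R, hR⟩ := hb.exists_norm_le
    refine ⟨R, fun y hy => ?_⟩
    rw [hq, indicator_of_notMem]
    intro h
    exact absurd (hR y h) (not_le.2 hy)
  -- For almost every `y` the line along `n` meets the graph at a point `b` where `γ` is
  -- differentiable. If `b` lies in the chart, it is a boundary point with a normal and the sign
  -- condition sends `W` to zero along the line; otherwise `χ b = 0`.
  have hqlim : ∀ᵐ y ∂(volume : Measure (Space d)),
      Tendsto (fun t : ℝ => q (y + (γ y - ⟪y, n⟫ - t) • n)) (𝓝[>] 0) (𝓝 0) := by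
    filter_upwards [hγ.ae_differentiableAt] with y hy
    set b := y + (γ y - ⟪y, n⟫) • n with hbdef
    have hpt : ∀ t : ℝ, y + (γ y - ⟪y, n⟫ - t) • n = b - t • n := by
      intro t
      rw [hbdef]
      module
    simp_rw [hpt]
    have htend : Tendsto (fun t : ℝ => b - t • n) (𝓝[>] 0) (𝓝 b) := by
      have : Tendsto (fun t : ℝ => b - t • n) (𝓝 0) (𝓝 (b - (0 : ℝ) • n)) :=
        (by fun_prop : Continuous fun t : ℝ => b - t • n).tendsto 0
      rw [zero_smul, sub_zero] at this
      exact this.mono_left nhdsWithin_le_nhds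
    by_cases hbr : b ∈ Metric.ball x₀ r
    · have hnn : ⟪n, n⟫ = (1 : ℝ) := by rw [real_inner_self_eq_norm_sq, hn]; norm_num
      have hbn : ⟪b, n⟫ = γ b := by
        rw [hbdef, hγn, inner_add_left, real_inner_smul_left, hnn]
        ring
      have hdb : DifferentiableAt ℝ γ b := differentiableAt_add_smul_of_invariant hγn hy _
      obtain ⟨hN, hnu, hfr, hev⟩ := graph_normal hn hγn hch hbr hbn hdb
      obtain ⟨l, hl, hlim⟩ := hν b hfr _ hnu
      have hlim2 := hlim.comp (tendsto_nhdsWithin_iff.2 ⟨htend, hev⟩)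
      have hWlim : Tendsto (fun t : ℝ => W (b - t • n)) (𝓝[>] 0)
          (𝓝 (max (-(‖n - ∇ γ b‖ * l)) 0)) := by
        refine (((hlim2.const_mul ‖n - ∇ γ b‖).neg).max tendsto_const_nhds).congr fun t => ?_
        simp only [Function.comp_apply, hW]
        congr 2
        rw [real_inner_smul_right, ← mul_assoc, mul_inv_cancel₀ hN.ne', one_mul,
          inner_sub_right, real_inner_comm (∇ γ b), inner_gradient_left, real_inner_comm n,
          sub_eq_add_neg b, ← neg_smul, fderiv_add_smul_of_invariant hγn b]
      rw [max_eq_right (by nlinarith)] at hWlim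
      have h1 : Tendsto (fun t : ℝ => A * W (b - t • n)) (𝓝[>] 0) (𝓝 0) := by
        simpa using hWlim.const_mul A
      refine squeeze_zero (fun t => hq0 _) (fun t => ?_) h1
      by_cases hy : b - t • n ∈ Ω
      · rw [hq, indicator_of_mem hy]
        exact mul_le_mul_of_nonneg_right ((le_abs_self _).trans (hA _)) (hW0 _)
      · rw [hq, indicator_of_notMem hy]
        exact mul_nonneg hA0 (hW0 _)
    · have hχb : χ b = 0 := by
        by_contra h
        exact hbr (hχs (subset_tsupport _ h))
      have h1 : Tendsto (fun t : ℝ => χ (b - t • n) * ((1 + K) * B)) (𝓝[>] 0) (𝓝 0) := by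
        have := ((hχ.continuous.tendsto b).comp htend).mul_const ((1 + K) * B)
        rw [hχb, zero_mul] at this
        exact this
      exact squeeze_zero (fun t => hq0 _) (fun t => hqχ _) h1
  have hlayer := tendsto_lintegral_boundary_layer hn hγ.continuous hγn hqm hqB hR
    continuous_deriv_cutoff hCθ (fun σ => deriv_cutoff_eq_zero) hqlim
  have hlayer' : Tendsto (fun ε : ℝ => ∫ y, ε⁻¹ * deriv cutoff (H y / ε) * q y)
      (𝓝[>] 0) (𝓝 0) := by
    refine (((ENNReal.tendsto_toReal ENNReal.zero_ne_top).comp hlayer).congr' ?_)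
    filter_upwards [self_mem_nhdsWithin] with ε hε
    have hε0 : (0 : ℝ) < ε := hε
    rw [integral_eq_lintegral_of_nonneg_ae]
    · rfl
    · exact Eventually.of_forall fun y => mul_nonneg
        (mul_nonneg (inv_nonneg.2 hε0.le) (deriv_cutoff_nonneg _)) (hq0 y)
    · exact ((measurable_const.mul (continuous_deriv_cutoff.comp (hHc.div_const ε)).measurable).mul
        hqm).aestronglyMeasurable
  -- pointwise limit of the cutoff
  have hcut : ∀ y ∈ Ω, χ y ≠ 0 → ∀ᶠ ε : ℝ in 𝓝[>] 0, cutoff (H y / ε) = 1 := by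
    intro y hy hχy
    have hHy : 0 < H y := sub_pos.2 ((hch y (hχs (subset_tsupport _ hχy))).1 hy)
    have : ∀ᶠ ε : ℝ in 𝓝[>] 0, ε < H y / 2 :=
      (eventually_lt_nhds (by positivity : (0 : ℝ) < H y / 2)).filter_mono nhdsWithin_le_nhds
    filter_upwards [this, self_mem_nhdsWithin] with ε hε hε0
    have hε0 : (0 : ℝ) < ε := hε0
    refine cutoff_of_ge ?_
    rw [le_div_iff₀ hε0]
    linarith
  -- Zeros of `χ` are minima. This disposes of points of `Ω` outside the chart, where the cutoff
  -- need not tend to one.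
  have hdχ : ∀ y, χ y = 0 → fderiv ℝ χ y = 0 := by
    intro y hy
    refine IsLocalMin.fderiv_eq_zero (Eventually.of_forall fun z => ?_)
    rw [hy]
    exact hχ0 z
  have hdχB : ∀ y, ‖fderiv ℝ χ y‖ ≤ Kχ := fun y => norm_fderiv_le_of_lipschitz ℝ hKχ
  have hdχm : Measurable fun y => fderiv ℝ χ y (Z y) :=
    isBoundedBilinearMap_apply.continuous.measurable.comp ((measurable_fderiv ℝ χ).prodMk hZm)
  have hcm : ∀ ε : ℝ, Continuous fun y => cutoff (H y / ε) := fun ε =>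
    contDiff_cutoff.continuous.comp (hHc.div_const ε)
  have hdχZ : ∀ y, |fderiv ℝ χ y (Z y)| ≤ Kχ * B := fun y =>
    ((fderiv ℝ χ y).le_opNorm _).trans (mul_le_mul (hdχB y) (hZB y) (norm_nonneg _) Kχ.2)
  have hI1 : ∀ ε : ℝ, Integrable (fun y => cutoff (H y / ε) * fderiv ℝ χ y (Z y))
      (volume.restrict Ω) := by
    intro ε
    refine Integrable.of_bound ((hcm ε).measurable.mul hdχm).aestronglyMeasurable (Kχ * B)
      (Eventually.of_forall fun y => ?_)
    rw [norm_mul, Real.norm_of_nonneg (cutoff_nonneg _)]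
    exact (mul_le_of_le_one_left (norm_nonneg _) (cutoff_le_one _)).trans (hdχZ y)
  -- the inequality for the truncated test function
  have hmain : ∀ᶠ ε : ℝ in 𝓝[>] 0, ∫ x in Ω, χ x * cutoff (H x / ε) * f x ≤
      (∫ x in Ω, cutoff (H x / ε) * fderiv ℝ χ x (Z x))
        + ∫ y, ε⁻¹ * deriv cutoff (H y / ε) * q y := by
    filter_upwards [self_mem_nhdsWithin] with ε hε
    have hε0 : (0 : ℝ) < ε := hε
    have hHε : LipschitzWith (Kθ * (ε⁻¹.toNNReal * (K + 1)))
        fun y => cutoff (H y / ε) := by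
      refine hKθ.comp (LipschitzWith.of_dist_le_mul fun x y => ?_)
      rw [Real.dist_eq, ← sub_div, abs_div, abs_of_pos hε0, div_eq_inv_mul]
      rw [NNReal.coe_mul, Real.coe_toNNReal _ (inv_pos.2 hε0).le, mul_assoc]
      refine mul_le_mul_of_nonneg_left ?_ (inv_pos.2 hε0).le
      have := hHl.dist_le_mul x y
      rw [Real.dist_eq] at this
      exact_mod_cast this
    have hψl := lipschitz_mul_of_bdd hKχ hHε (A := ⟨A, hA0⟩) (B := 1) hA fun y => by
      rw [abs_of_nonneg (cutoff_nonneg _)]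
      exact cutoff_le_one _
    have hψs : tsupport (fun y => χ y * cutoff (H y / ε)) ⊆ Ω := by
      have h1 : tsupport (fun y => χ y * cutoff (H y / ε)) ⊆ {y | ε ≤ H y} := by
        refine closure_minimal (fun y hy => ?_) (isClosed_le continuous_const hHc)
        by_contra hlt
        have hlt : H y < ε := not_le.1 hlt
        exact hy (by
          change χ y * cutoff (H y / ε) = 0
          rw [cutoff_of_le ((div_le_one hε0).2 hlt.le), mul_zero])
      intro y hy
      have h2 : ε ≤ H y := h1 hy
      rw [hch y (hχs (tsupport_mul_subset_left hy))]
      have : 0 < γ y - ⟪y, n⟫ := hε0.trans_le h2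
      linarith
    refine (hweak _ _ hψl hχc.mul_right hψs
      fun y => mul_nonneg (hχ0 y) (cutoff_nonneg _)).trans ?_
    have hq2 : ∫ y, ε⁻¹ * deriv cutoff (H y / ε) * q y
        = ∫ y in Ω, ε⁻¹ * deriv cutoff (H y / ε) * (χ y * W y) := by
      rw [← integral_indicator hΩ.measurableSet]
      refine integral_congr_ae (Eventually.of_forall fun y => ?_)
      by_cases hy : y ∈ Ω <;> simp [hq, hy]
    have hI2 : Integrable (fun y => ε⁻¹ * deriv cutoff (H y / ε) * (χ y * W y))
        (volume.restrict Ω) := by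
      refine Integrable.of_bound ?_ (ε⁻¹ * Cθ * (A * ((1 + K) * B)))
        (Eventually.of_forall fun y => ?_)
      · exact ((measurable_const.mul
          (continuous_deriv_cutoff.comp (hHc.div_const ε)).measurable).mul
          (hχ.continuous.measurable.mul hWm)).aestronglyMeasurable
      · rw [norm_mul, norm_mul, norm_mul, Real.norm_of_nonneg (inv_pos.2 hε0).le,
          Real.norm_of_nonneg (hW0 y)]
        gcongr
        · exact hCθ _
        · exact hA y
        · exact hWB y
    rw [hq2, ← integral_add (hI1 ε) hI2]
    refine integral_mono_ae ?_ ((hI1 ε).add hI2) ?_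
    · refine Integrable.of_bound (isBoundedBilinearMap_apply.continuous.measurable.comp
        ((measurable_fderiv ℝ _).prodMk hZm)).aestronglyMeasurable _
        (Eventually.of_forall fun y => ((ContinuousLinearMap.le_opNorm _ _).trans
          (mul_le_mul (norm_fderiv_le_of_lipschitz ℝ hψl) (hZB y) (norm_nonneg _)
            (NNReal.coe_nonneg _))))
    · refine ae_restrict_of_ae ?_
      filter_upwards [hγ.ae_differentiableAt] with y hy
      have hHd : HasFDerivAt H (fderiv ℝ γ y - innerSL ℝ n) y := by
        refine hy.hasFDerivAt.sub ?_
        refine ((innerSL ℝ n).hasFDerivAt (x := y)).congr_of_eventuallyEq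
          (Eventually.of_forall fun z => ?_)
        simp [real_inner_comm]
      have hcd : HasFDerivAt (fun z => cutoff (H z / ε))
          (deriv cutoff (H y / ε) • (ε⁻¹ • (fderiv ℝ γ y - innerSL ℝ n))) y := by
        have h1 : HasFDerivAt (fun z => H z / ε) (ε⁻¹ • (fderiv ℝ γ y - innerSL ℝ n)) y := by
          simp_rw [div_eq_inv_mul]
          exact hHd.const_mul ε⁻¹
        have h2 : HasDerivAt cutoff (deriv cutoff (H y / ε)) (H y / ε) :=
          (contDiff_cutoff.differentiable (by simp) (H y / ε)).hasDerivAt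
        have h3 : HasFDerivAt (cutoff ∘ fun z => H z / ε) _ y :=
          HasDerivAt.comp_hasFDerivAt (h₂ := cutoff) (f := fun z => H z / ε) y h2 h1
        exact h3
      have hψd := ((hχ.differentiable (by simp) y).hasFDerivAt.mul hcd).fderiv
      change fderiv ℝ (fun y => χ y * cutoff (H y / ε)) y (Z y) ≤ _
      rw [show (fun y => χ y * cutoff (H y / ε)) = χ * fun y => cutoff (H y / ε) from rfl, hψd]
      simp only [add_apply, smul_apply, smul_eq_mul,
        sub_apply, innerSL_apply_apply]
      -- The gradient of the cutoff is a nonnegative multiple of `∇γ - n`, so its pairing with `Z`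
      -- is bounded above through `W`.
      have hWy : fderiv ℝ γ y (Z y) - ⟪n, Z y⟫ ≤ W y := by
        refine le_trans (le_of_eq ?_) (le_max_left _ _)
        ring
      have := mul_le_mul_of_nonneg_left hWy
        (mul_nonneg (mul_nonneg (inv_pos.2 hε0).le (deriv_cutoff_nonneg (H y / ε))) (hχ0 y))
      linarith
  refine le_of_tendsto_of_tendsto (b := 𝓝[>] (0 : ℝ)) ?_ ?_ hmain
  · refine tendsto_integral_filter_of_dominated_convergence (fun x => A * ‖f x‖)
      (Eventually.of_forall fun ε => ?_) (Eventually.of_forall fun ε => Eventually.of_forall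
        fun x => ?_) (hf.norm.const_mul A) ?_
    · exact (hχ.continuous.mul (hcm ε)).aestronglyMeasurable.mul hf.1
    · rw [norm_mul, norm_mul, Real.norm_of_nonneg (cutoff_nonneg _)]
      exact mul_le_mul_of_nonneg_right ((mul_le_of_le_one_right (norm_nonneg _)
        (cutoff_le_one _)).trans (hA x)) (norm_nonneg _)
    · refine (ae_restrict_iff' hΩ.measurableSet).2 (Eventually.of_forall fun x hx => ?_)
      by_cases hχx : χ x = 0
      · simp [hχx]
      · refine tendsto_const_nhds.congr' ?_
        filter_upwards [hcut x hx hχx] with ε hε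
        rw [hε, mul_one]
  · rw [← add_zero (∫ x in Ω, fderiv ℝ χ x (Z x))]
    refine Tendsto.add ?_ hlayer'
    refine tendsto_integral_filter_of_dominated_convergence (fun _ => Kχ * B)
      (Eventually.of_forall fun ε => (hI1 ε).1) (Eventually.of_forall fun ε =>
        Eventually.of_forall fun x => ?_) (integrable_const _) ?_
    · rw [norm_mul, Real.norm_of_nonneg (cutoff_nonneg _)]
      exact (mul_le_of_le_one_left (norm_nonneg _) (cutoff_le_one _)).trans (hdχZ x)
    · refine (ae_restrict_iff' hΩ.measurableSet).2 (Eventually.of_forall fun x hx => ?_)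
      by_cases hχx : χ x = 0
      · simp [hdχ x hχx]
      · refine tendsto_const_nhds.congr' ?_
        filter_upwards [hcut x hx hχx] with ε hε
        rw [hε, one_mul]

end LocalInequality

/-! ### The global divergence inequality -/

section DivergenceInequality

variable {d : ℕ} {Ω : Set (Space d)}

/-- The divergence inequality on a bounded Lipschitz domain: if `f ≤ -div Z` weakly in `Ω`, where
`Z` is a bounded field with nonnegative outward normal boundary values, then `∫ f ≤ 0`. -/
theorem divergence_ineq (hΩ : IsLipschitzDomain Ω) {f : Space d → ℝ} (hf : IntegrableOn f Ω)
    {Z : Space d → Space d} (hZc : ContinuousOn Z Ω) {B : ℝ} (hZB : ∀ x ∈ Ω, ‖Z x‖ ≤ B)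
    (hweak : ∀ ψ : Space d → ℝ, ContDiff ℝ ∞ ψ → HasCompactSupport ψ → tsupport ψ ⊆ Ω →
      (∀ x, 0 ≤ ψ x) → ∫ x in Ω, ψ x * f x ≤ ∫ x in Ω, fderiv ℝ ψ x (Z x))
    (hν : ∀ x ∈ frontier Ω, ∀ ν : Space d, IsOuterUnitNormal Ω x ν →
      ∃ l : ℝ, 0 ≤ l ∧ Tendsto (fun y => ⟪Z y, ν⟫) (𝓝[Ω] x) (𝓝 l)) :
    ∫ x in Ω, f x ≤ 0 := by
  classical
  have hfin : IsFiniteMeasure (volume.restrict Ω) := ⟨by simpa using hΩ.bounded.measure_lt_top⟩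
  -- Extension by zero makes the field measurable and bounded on the whole space, and changes
  -- nothing inside `Ω`.
  set Z' : Space d → Space d := Ω.indicator Z with hZ'
  have hZ'eq : ∀ x ∈ Ω, Z' x = Z x := fun x hx => indicator_of_mem hx _
  have hZ'm : Measurable Z' := by
    rw [hZ', ← piecewise_eq_indicator]
    exact hZc.measurable_piecewise continuousOn_const hΩ.isOpen.measurableSet
  have hZ'B : ∀ x, ‖Z' x‖ ≤ max B 0 := by
    intro x
    by_cases hx : x ∈ Ω
    · rw [hZ'eq x hx]
      exact (hZB x hx).trans (le_max_left _ _)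
    · rw [hZ', indicator_of_notMem hx, norm_zero]
      exact le_max_right _ _
  have hweak' : ∀ ψ : Space d → ℝ, ContDiff ℝ ∞ ψ → HasCompactSupport ψ → tsupport ψ ⊆ Ω →
      (∀ x, 0 ≤ ψ x) → ∫ x in Ω, ψ x * f x ≤ ∫ x in Ω, fderiv ℝ ψ x (Z' x) := by
    intro ψ h1 h2 h3 h4
    refine (hweak ψ h1 h2 h3 h4).trans_eq (setIntegral_congr_fun hΩ.isOpen.measurableSet ?_)
    intro x hx
    simp only [hZ'eq x hx]
  have hν' : ∀ x ∈ frontier Ω, ∀ ν : Space d, IsOuterUnitNormal Ω x ν →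
      ∃ l : ℝ, 0 ≤ l ∧ Tendsto (fun y => ⟪Z' y, ν⟫) (𝓝[Ω] x) (𝓝 l) := by
    intro x hx ν hxν
    obtain ⟨l, hl, hlim⟩ := hν x hx ν hxν
    refine ⟨l, hl, hlim.congr' ?_⟩
    filter_upwards [self_mem_nhdsWithin] with y hy
    rw [hZ'eq y hy]
  have hloc : ∀ x ∈ closure Ω, ∃ r : ℝ, 0 < r ∧ ∀ χ : Space d → ℝ, ContDiff ℝ ∞ χ →
      HasCompactSupport χ → tsupport χ ⊆ Metric.ball x r → (∀ y, 0 ≤ χ y) →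
      ∫ x in Ω, χ x * f x ≤ ∫ x in Ω, fderiv ℝ χ x (Z' x) := by
    intro x hx
    by_cases hxΩ : x ∈ Ω
    · obtain ⟨r, hr, hrΩ⟩ := Metric.isOpen_iff.1 hΩ.isOpen x hxΩ
      exact ⟨r, hr, fun χ h1 h2 h3 h4 => hweak' χ h1 h2 (h3.trans hrΩ) h4⟩
    · have hxf : x ∈ frontier Ω := ⟨hx, by rwa [hΩ.isOpen.interior_eq]⟩
      obtain ⟨n, r, K, γ, hn, hr, hγ, hγn, hch⟩ := hΩ.chart x hxf
      refine ⟨r, hr, fun χ h1 h2 h3 h4 => ?_⟩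
      exact chart_ineq hΩ.isOpen hΩ.bounded hf hZ'm hZ'B
        (fun ψ K hψ hc hs h0 => weak_ineq_lipschitz hΩ.isOpen hΩ.bounded hf hZ'm hZ'B hweak' hψ
          hc hs h0) hν' hn hγ hγn hch h1 h2 h3 h4
  choose! r hr hrloc using hloc
  obtain ⟨t, htΩ, htcov⟩ := hΩ.bounded.isCompact_closure.elim_nhds_subcover
    (fun x => Metric.ball x (r x)) (fun x hx => Metric.ball_mem_nhds x (hr x hx))
  obtain ⟨p, hp⟩ := SmoothPartitionOfUnity.exists_isSubordinate (modelWithCornersSelf ℝ (Space d))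
    (isClosed_closure (s := Ω)) (fun i : t => Metric.ball (i : Space d) (r i))
    (fun i => Metric.isOpen_ball) (by
      intro x hx
      obtain ⟨i, hi, hxi⟩ := mem_iUnion₂.1 (htcov hx)
      exact mem_iUnion.2 ⟨⟨i, hi⟩, hxi⟩)
  have hpc : ∀ i, ContDiff ℝ ∞ (p i) := fun i => (p i).contMDiff.contDiff
  have hps : ∀ i, HasCompactSupport (p i) := fun i =>
    (isCompact_closedBall (i : Space d) (r i)).of_isClosed_subset (isClosed_tsupport _)
      ((hp i).trans Metric.ball_subset_closedBall)
  have hsum : ∀ x ∈ Ω, ∑ i, p i x = 1 := by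
    intro x hx
    rw [← finsum_eq_sum_of_fintype]
    exact p.sum_eq_one (subset_closure hx)
  -- The gradients of the partition add up to zero, so the right-hand sides of the local
  -- inequalities cancel in the sum.
  have hsumd : ∀ x ∈ Ω, ∑ i, fderiv ℝ (p i) x = 0 := by
    intro x hx
    rw [← fderiv_fun_sum fun i _ => (hpc i).differentiable (by simp) x]
    have : (fun y => ∑ i, p i y) =ᶠ[𝓝 x] fun _ => 1 := by
      filter_upwards [hΩ.isOpen.mem_nhds hx] with y hy using hsum y hy
    rw [this.fderiv_eq, fderiv_fun_const]
    rfl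
  have hi1 : ∀ i, Integrable (fun x => p i x * f x) (volume.restrict Ω) := by
    intro i
    refine hf.bdd_mul (hpc i).continuous.aestronglyMeasurable (c := 1) (Eventually.of_forall ?_)
    intro x
    rw [Real.norm_of_nonneg (p.nonneg i x)]
    exact p.le_one i x
  have hi2 : ∀ i, Integrable (fun x => fderiv ℝ (p i) x (Z' x)) (volume.restrict Ω) := by
    intro i
    obtain ⟨C, hC⟩ := ((hpc i).of_le (by simp : (1 : ℕ∞ω) ≤ ∞)).lipschitzWith_of_hasCompactSupport
      (hps i) one_ne_zero
    refine Integrable.of_bound (isBoundedBilinearMap_apply.continuous.measurable.comp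
      ((measurable_fderiv ℝ _).prodMk hZ'm)).aestronglyMeasurable (C * max B 0)
      (Eventually.of_forall fun x => ?_)
    exact ((fderiv ℝ (p i) x).le_opNorm _).trans
      (mul_le_mul (norm_fderiv_le_of_lipschitz ℝ hC) (hZ'B x) (norm_nonneg _) C.2)
  calc ∫ x in Ω, f x = ∫ x in Ω, ∑ i, p i x * f x := by
        refine setIntegral_congr_fun hΩ.isOpen.measurableSet fun x hx => ?_
        rw [← Finset.sum_mul, hsum x hx, one_mul]
    _ = ∑ i, ∫ x in Ω, p i x * f x := integral_finsetSum _ fun i _ => hi1 i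
    _ ≤ ∑ i, ∫ x in Ω, fderiv ℝ (p i) x (Z' x) := Finset.sum_le_sum fun i _ =>
        hrloc i (htΩ i i.2) (p i) (hpc i) (hps i) (hp i) (p.nonneg i)
    _ = ∫ x in Ω, ∑ i, fderiv ℝ (p i) x (Z' x) := (integral_finsetSum _ fun i _ => hi2 i).symm
    _ = ∫ x in Ω, (0 : ℝ) := by
        refine setIntegral_congr_fun hΩ.isOpen.measurableSet fun x hx => ?_
        rw [← sum_apply, hsumd x hx]
        rfl
    _ = 0 := by simp

end DivergenceInequality

/-! ### Vector calculus and the Bohm identity -/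

section Calculus

variable {d : ℕ}

lemma sum_mul_single (L : Space d →L[ℝ] ℝ) (v : Space d) :
    ∑ i, L (EuclideanSpace.single i 1) * v i = L v := by
  have : v = ∑ i, v i • EuclideanSpace.single i (1 : ℝ) := by
    ext j
    simp [Finset.sum_apply, Pi.single_apply]
  conv_rhs => rw [this]
  rw [map_sum]
  refine Finset.sum_congr rfl fun i _ => ?_
  rw [map_smul, smul_eq_mul, mul_comm]

lemma divergence_smul {f : Space d → ℝ} {F : Space d → Space d} {x : Space d}
    (hf : DifferentiableAt ℝ f x) (hF : DifferentiableAt ℝ F x) :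
    divergence (fun y => f y • F y) x = f x * divergence F x + fderiv ℝ f x (F x) := by
  unfold divergence
  rw [fderiv_fun_smul hf hF, ← sum_mul_single (fderiv ℝ f x) (F x), Finset.mul_sum,
    ← Finset.sum_add_distrib]
  refine Finset.sum_congr rfl fun i _ => ?_
  simp [smul_eq_mul]

lemma divergence_add {F G : Space d → Space d} {x : Space d}
    (hF : DifferentiableAt ℝ F x) (hG : DifferentiableAt ℝ G x) :
    divergence (fun y => F y + G y) x = divergence F x + divergence G x := by
  unfold divergence
  rw [fderiv_fun_add hF hG, ← Finset.sum_add_distrib]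
  simp

lemma divergence_congr {F G : Space d → Space d} {x : Space d} (h : F =ᶠ[𝓝 x] G) :
    divergence F x = divergence G x := by
  unfold divergence
  rw [h.fderiv_eq]

/-- The Riesz isomorphism from functionals to vectors, as a continuous linear map. -/
noncomputable def riesz (d : ℕ) : (Space d →L[ℝ] ℝ) →L[ℝ] Space d :=
  LinearMap.toContinuousLinearMap
    { toFun := (InnerProductSpace.toDual ℝ (Space d)).symm
      map_add' := map_add _
      map_smul' := fun c L => by simp }

lemma gradient_eq_riesz (f : Space d → ℝ) : ∇ f = fun y => riesz d (fderiv ℝ f y) := rfl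

lemma contDiffAt_gradient {f : Space d → ℝ} {x : Space d} {n m : ℕ} (hf : ContDiffAt ℝ n f x)
    (h : m + 1 ≤ n) : ContDiffAt ℝ m (∇ f) x := by
  rw [gradient_eq_riesz]
  have h1 : ContDiffAt ℝ m (fderiv ℝ f) x := hf.fderiv_right (by exact_mod_cast h)
  exact (riesz d).contDiff.contDiffAt.comp x h1

lemma laplacian_eq_sum (f : Space d → ℝ) :
    Δ f = fun x => ∑ i : Fin d, fderiv ℝ (fderiv ℝ f) x (EuclideanSpace.single i 1)
      (EuclideanSpace.single i 1) := by
  rw [InnerProductSpace.laplacian_eq_iteratedFDeriv_orthonormalBasis f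
    (EuclideanSpace.basisFun (Fin d) ℝ)]
  ext x
  simp [iteratedFDeriv_two_apply]

lemma contDiffAt_laplacian {f : Space d → ℝ} {x : Space d} {n m : ℕ} (hf : ContDiffAt ℝ n f x)
    (h : m + 2 ≤ n) : ContDiffAt ℝ m (Δ f) x := by
  rw [laplacian_eq_sum]
  have h1 : ContDiffAt ℝ (m + 1 : ℕ) (fderiv ℝ f) x :=
    hf.fderiv_right (by exact_mod_cast (by omega : m + 1 + 1 ≤ n))
  have h2 : ContDiffAt ℝ m (fderiv ℝ (fderiv ℝ f)) x := h1.fderiv_right (by exact_mod_cast le_rfl)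
  exact ContDiffAt.sum fun i _ => (h2.clm_apply contDiffAt_const).clm_apply contDiffAt_const

lemma differentiableAt_fderiv {f : Space d → ℝ} {x : Space d} {n : ℕ} (hf : ContDiffAt ℝ n f x)
    (h : 2 ≤ n) : DifferentiableAt ℝ (fderiv ℝ f) x := by
  have : ContDiffAt ℝ (1 : ℕ) (fderiv ℝ f) x := hf.fderiv_right (by exact_mod_cast h)
  exact this.differentiableAt (by simp)

lemma differentiableAt_gradient {f : Space d → ℝ} {x : Space d} {n : ℕ} (hf : ContDiffAt ℝ n f x)
    (h : 2 ≤ n) : DifferentiableAt ℝ (∇ f) x :=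
  (contDiffAt_gradient hf (m := 1) h).differentiableAt (by simp)

lemma inner_fderiv_gradient {f : Space d → ℝ} {x : Space d}
    (hf : DifferentiableAt ℝ (fderiv ℝ f) x) (v w : Space d) :
    ⟪fderiv ℝ (∇ f) x v, w⟫ = fderiv ℝ (fderiv ℝ f) x v w := by
  have h1 : HasFDerivAt (∇ f) ((riesz d).comp (fderiv ℝ (fderiv ℝ f) x)) x := by
    rw [gradient_eq_riesz]
    exact (riesz d).hasFDerivAt.comp x hf.hasFDerivAt
  rw [h1.fderiv]
  exact InnerProductSpace.toDual_symm_apply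

lemma divergence_gradient {f : Space d → ℝ} {x : Space d}
    (hf : DifferentiableAt ℝ (fderiv ℝ f) x) : divergence (∇ f) x = (Δ f) x := by
  rw [laplacian_eq_sum]
  unfold divergence
  refine Finset.sum_congr rfl fun i _ => ?_
  rw [← inner_fderiv_gradient hf, EuclideanSpace.inner_single_right]
  simp

lemma fderiv_inner_gradient {f g : Space d → ℝ} {x : Space d}
    (hf : DifferentiableAt ℝ (fderiv ℝ f) x) (hg : DifferentiableAt ℝ (fderiv ℝ g) x)
    (hf' : DifferentiableAt ℝ (∇ f) x) (hg' : DifferentiableAt ℝ (∇ g) x) (v : Space d) :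
    fderiv ℝ (fun y => ⟪∇ f y, ∇ g y⟫) x v
      = fderiv ℝ (fderiv ℝ f) x v (∇ g x) + fderiv ℝ (fderiv ℝ g) x v (∇ f x) := by
  rw [fderiv_inner_apply ℝ hf' hg', inner_fderiv_gradient hf, real_inner_comm,
    inner_fderiv_gradient hg]
  ring

/-- The flux that remains after the Bohm term tested with `∇a` is brought to a signed form;
here `r = √ρ`. -/
noncomputable def bohmFlux (r a : Space d → ℝ) (y : Space d) : Space d :=
  (-2 * ⟪∇ r y, ∇ a y⟫) • ∇ r y + (⟪∇ r y, ∇ r y⟫ • ∇ a y + ((-(r y * (Δ a) y)) • ∇ r y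
    + (-(1 / 2) * r y ^ 2) • ∇ (fun z => -(Δ a) z) y))

lemma contDiffAt_bohmFlux {r a : Space d → ℝ} {x : Space d} (hr : ContDiffAt ℝ 2 r x)
    (ha : ContDiffAt ℝ 4 a x) : ContDiffAt ℝ 1 (bohmFlux r a) x := by
  have hr1 : ContDiffAt ℝ 1 (∇ r) x := contDiffAt_gradient (n := 2) (m := 1) hr le_rfl
  have ha1 : ContDiffAt ℝ 1 (∇ a) x := contDiffAt_gradient (n := 4) (m := 1) ha (by norm_num)
  have hr0 : ContDiffAt ℝ 1 r x := hr.of_le (by norm_num)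
  have hl : ContDiffAt ℝ 2 (Δ a) x := contDiffAt_laplacian (n := 4) (m := 2) ha le_rfl
  have hl1 : ContDiffAt ℝ 1 (Δ a) x := hl.of_le (by norm_num)
  have hg : ContDiffAt ℝ 1 (∇ (fun z => -(Δ a) z)) x :=
    contDiffAt_gradient (n := 2) (m := 1) hl.neg le_rfl
  exact ((contDiffAt_const.mul (hr1.inner ℝ ha1)).smul hr1).add
    (((hr1.inner ℝ hr1).smul ha1).add (((hr0.mul hl1).neg.smul hr1).add
      ((contDiffAt_const.mul (hr0.pow 2)).smul hg)))

/-- Each summand of the flux removes unwanted terms of another. The terms `Hess r (∇r, ∇a)` of the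
first two cancel by symmetry of the Hessian, the terms `|∇r|² Δa` of the second and third cancel,
and so do the terms `r ∇r · ∇Δa` of the third and fourth, since `g = -Δa`. -/
lemma divergence_bohmFlux {r a : Space d → ℝ} {x : Space d} (hr : ContDiffAt ℝ 2 r x)
    (ha : ContDiffAt ℝ 4 a x) :
    divergence (bohmFlux r a) x = -2 * ⟪∇ r x, ∇ a x⟫ * (Δ r) x
      - 2 * fderiv ℝ (fderiv ℝ a) x (∇ r x) (∇ r x) - r x * (Δ a) x * (Δ r) x
      - 1 / 2 * r x ^ 2 * (Δ (fun z => -(Δ a) z)) x := by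
  have hr1 : DifferentiableAt ℝ (∇ r) x := differentiableAt_gradient (n := 2) hr le_rfl
  have ha1 : DifferentiableAt ℝ (∇ a) x := differentiableAt_gradient (n := 4) ha (by norm_num)
  have hr2 : DifferentiableAt ℝ (fderiv ℝ r) x := differentiableAt_fderiv (n := 2) hr le_rfl
  have ha2 : DifferentiableAt ℝ (fderiv ℝ a) x := differentiableAt_fderiv (n := 4) ha (by norm_num)
  have hr0 : DifferentiableAt ℝ r x := hr.differentiableAt (by norm_num)
  have hl : ContDiffAt ℝ 2 (Δ a) x := contDiffAt_laplacian (n := 4) (m := 2) ha le_rfl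
  have hl0 : DifferentiableAt ℝ (Δ a) x := hl.differentiableAt (by norm_num)
  have hg1 : DifferentiableAt ℝ (∇ (fun z => -(Δ a) z)) x :=
    differentiableAt_gradient (n := 2) hl.neg le_rfl
  have hg2 : DifferentiableAt ℝ (fderiv ℝ (fun z => -(Δ a) z)) x :=
    differentiableAt_fderiv (n := 2) hl.neg le_rfl
  have i1 : DifferentiableAt ℝ (fun y => ⟪∇ r y, ∇ a y⟫) x := hr1.inner ℝ ha1
  have i2 : DifferentiableAt ℝ (fun y => ⟪∇ r y, ∇ r y⟫) x := hr1.inner ℝ hr1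
  have i1' : DifferentiableAt ℝ (fun y => -2 * ⟪∇ r y, ∇ a y⟫) x := i1.const_mul _
  have i3 : DifferentiableAt ℝ (fun y => r y * (Δ a) y) x := hr0.mul hl0
  have i3' : DifferentiableAt ℝ (fun y => -(r y * (Δ a) y)) x := i3.neg
  have i5 : DifferentiableAt ℝ (fun y => r y ^ 2) x := hr0.pow 2
  have i4 : DifferentiableAt ℝ (fun y => -(1 / 2) * r y ^ 2) x := i5.const_mul _
  have hsym : fderiv ℝ (fderiv ℝ r) x (∇ r x) (∇ a x) = fderiv ℝ (fderiv ℝ r) x (∇ a x) (∇ r x) :=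
    (hr.isSymmSndFDerivAt (by simp)) _ _
  have s1 : DifferentiableAt ℝ (fun y => (-2 * ⟪∇ r y, ∇ a y⟫) • ∇ r y) x := i1'.smul hr1
  have s2 : DifferentiableAt ℝ (fun y => ⟪∇ r y, ∇ r y⟫ • ∇ a y) x := i2.smul ha1
  have s3 : DifferentiableAt ℝ (fun y => (-(r y * (Δ a) y)) • ∇ r y) x := i3'.smul hr1
  have s4 : DifferentiableAt ℝ (fun y => (-(1 / 2) * r y ^ 2) • ∇ (fun z => -(Δ a) z) y) x :=
    i4.smul hg1
  have s34 : DifferentiableAt ℝ (fun y => (-(r y * (Δ a) y)) • ∇ r y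
    + (-(1 / 2) * r y ^ 2) • ∇ (fun z => -(Δ a) z) y) x := s3.add s4
  have s234 : DifferentiableAt ℝ (fun y => ⟪∇ r y, ∇ r y⟫ • ∇ a y + ((-(r y * (Δ a) y)) • ∇ r y
    + (-(1 / 2) * r y ^ 2) • ∇ (fun z => -(Δ a) z) y)) x := s2.add s34
  unfold bohmFlux
  rw [divergence_add s1 s234, divergence_add s2 s34, divergence_add s3 s4,
    divergence_smul i1' hr1, divergence_smul i2 ha1, divergence_smul i3' hr1,
    divergence_smul i4 hg1, divergence_gradient hr2, divergence_gradient ha2,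
    divergence_gradient hg2, fderiv_const_mul i1, fderiv_fun_neg, fderiv_fun_mul hr0 hl0,
    fderiv_const_mul i5, fderiv_fun_pow 2 hr0]
  simp only [smul_apply, neg_apply, add_apply, smul_eq_mul]
  rw [fderiv_inner_gradient hr2 ha2 hr1 ha1, fderiv_inner_gradient hr2 hr2 hr1 hr1, hsym]
  have e1 : fderiv ℝ r x (∇ r x) = ⟪∇ r x, ∇ r x⟫ := inner_gradient_left.symm
  have e2 : fderiv ℝ r x (∇ (fun z => -(Δ a) z) x) = - fderiv ℝ (Δ a) x (∇ r x) := by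
    rw [← inner_gradient_left, real_inner_comm, inner_gradient_left, fderiv_fun_neg]
    rfl
  rw [e1, e2]
  ring

/-- The Bohm term tested with `∇a`, plus the divergence of the flux, has a sign. -/
lemma bohm_identity {ρ a : Space d → ℝ} {x : Space d} (hρ : ContDiffAt ℝ 2 ρ x)
    (hpos : 0 < ρ x) (ha : ContDiffAt ℝ 4 a x) :
    -bohm ρ x * divergence (fun y => ρ y • ∇ a y) x
        - divergence (bohmFlux (fun y => √(ρ y)) a) x
      = 2 * fderiv ℝ (fderiv ℝ a) x (∇ (fun y => √(ρ y)) x) (∇ (fun y => √(ρ y)) x)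
        + 1 / 2 * ρ x * (Δ (fun z => -(Δ a) z)) x := by
  set r : Space d → ℝ := fun y => √(ρ y) with hr
  have hr2 : ContDiffAt ℝ 2 r x := hρ.sqrt hpos.ne'
  have hrpos : 0 < r x := Real.sqrt_pos.2 hpos
  have hsq : r x ^ 2 = ρ x := Real.sq_sqrt hpos.le
  have ha1 : DifferentiableAt ℝ (∇ a) x := differentiableAt_gradient (n := 4) ha (by norm_num)
  have ha2 : DifferentiableAt ℝ (fderiv ℝ a) x := differentiableAt_fderiv (n := 4) ha (by norm_num)
  have hr0 : DifferentiableAt ℝ r x := hr2.differentiableAt (by norm_num)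
  have hρr : ρ =ᶠ[𝓝 x] fun y => r y ^ 2 := by
    filter_upwards [hρ.continuousAt.eventually (lt_mem_nhds hpos)] with y hy
    exact (Real.sq_sqrt hy.le).symm
  have hdρ : fderiv ℝ ρ x (∇ a x) = 2 * r x * ⟪∇ r x, ∇ a x⟫ := by
    rw [hρr.fderiv_eq, fderiv_fun_pow 2 hr0, inner_gradient_left]
    simp
  -- With `ρ = r²`, the tested Bohm term is `-r Δa Δr - 2 (∇r · ∇a) Δr`. These are exactly the terms
  -- with `Δr` in the divergence of the flux, so only the two signed terms survive.
  rw [divergence_bohmFlux hr2 ha, divergence_smul (hρ.differentiableAt (by norm_num)) ha1,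
    divergence_gradient ha2, hdρ, bohm, ← hr, ← hsq]
  have : √(ρ x) = r x := rfl
  rw [hsq, this, ← hsq]
  field_simp
  ring

end Calculus

/-! ### Integration by parts and extension of the momentum balance -/

section WeakForms

variable {d : ℕ} {Ω : Set (Space d)}

lemma integrable_of_support_subset_compact {E : Type*} [TopologicalSpace E] [T2Space E]
    [MeasurableSpace E] [OpensMeasurableSpace E] {μ : Measure E} [IsFiniteMeasureOnCompacts μ]
    {Ω K : Set E} {g : E → ℝ} (hK : IsCompact K) (hKΩ : K ⊆ Ω) (hg : ContinuousOn g Ω)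
    (hs : Function.support g ⊆ K) : Integrable g μ := by
  rw [← integrableOn_iff_integrable_of_support_subset hs]
  exact (hg.mono hKΩ).integrableOn_compact hK

lemma integrable_test_mul {ψ : Space d → ℝ} (hψ : Continuous ψ) (hc : HasCompactSupport ψ)
    (hs : tsupport ψ ⊆ Ω) {g : Space d → ℝ} (hg : ContinuousOn g Ω) :
    Integrable (fun x => ψ x * g x) := by
  refine integrable_of_support_subset_compact hc.isCompact hs (hψ.continuousOn.mul hg) ?_
  intro x hx
  exact subset_tsupport _ (left_ne_zero_of_mul hx)

lemma integrable_test_fderiv {ψ : Space d → ℝ} (hψ : ContDiff ℝ 1 ψ) (hc : HasCompactSupport ψ)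
    (hs : tsupport ψ ⊆ Ω) {G : Space d → Space d} (hG : ContinuousOn G Ω) :
    Integrable (fun x => fderiv ℝ ψ x (G x)) := by
  refine integrable_of_support_subset_compact hc.isCompact hs
    ((hψ.continuous_fderiv one_ne_zero).continuousOn.clm_apply hG) ?_
  intro x hx
  refine support_fderiv_subset ℝ (f := ψ) ?_
  intro h0
  exact hx (by simp [h0])

lemma continuousOn_divergence {F : Space d → Space d}
    (hF : ∀ x ∈ Ω, ContDiffAt ℝ 1 F x) : ContinuousOn (divergence F) Ω := by
  intro x hx
  have h1 : ContinuousAt (fderiv ℝ F) x :=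
    ((hF x hx).fderiv_right (m := 0) (by norm_num)).continuousAt
  refine ContinuousAt.continuousWithinAt ?_
  unfold divergence
  refine tendsto_finsetSum _ fun i _ => ?_
  exact (((EuclideanSpace.proj (𝕜 := ℝ) i).continuous.continuousAt).comp
    (h1.clm_apply continuousAt_const) : _)

/-- Integration by parts against a compactly supported test function. -/
lemma integral_fderiv_test {ψ : Space d → ℝ} (hψ : ContDiff ℝ 1 ψ)
    (hc : HasCompactSupport ψ) (hs : tsupport ψ ⊆ Ω) {F : Space d → Space d}
    (hF : ∀ x ∈ Ω, ContDiffAt ℝ 1 F x) :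
    ∫ x in Ω, fderiv ℝ ψ x (F x) = -∫ x in Ω, ψ x * divergence F x := by
  have hFc : ContinuousOn F Ω := fun x hx => (hF x hx).continuousAt.continuousWithinAt
  have hFi : ∀ i x, x ∈ Ω → HasFDerivAt (fun y => F y i)
      ((EuclideanSpace.proj (𝕜 := ℝ) i).comp (fderiv ℝ F x)) x := by
    intro i x hx
    exact (EuclideanSpace.proj (𝕜 := ℝ) i).hasFDerivAt.comp x
      ((hF x hx).differentiableAt one_ne_zero).hasFDerivAt
  have hdc : ContinuousOn (fderiv ℝ F) Ω := fun x hx =>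
    ((hF x hx).fderiv_right (m := 0) (by norm_num)).continuousAt.continuousWithinAt
  have hA : ∀ i : Fin d, Integrable fun x => fderiv ℝ ψ x (EuclideanSpace.single i 1) * F x i := by
    intro i
    refine integrable_of_support_subset_compact hc.isCompact hs
      (((hψ.continuous_fderiv one_ne_zero).continuousOn.clm_apply continuousOn_const).mul
        ((EuclideanSpace.proj (𝕜 := ℝ) i).continuous.comp_continuousOn hFc)) ?_
    intro x hx
    refine support_fderiv_subset ℝ (f := ψ) ?_
    intro h0
    exact hx (by simp [h0])
  have hB : ∀ i : Fin d, Integrable fun x =>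
      ψ x * fderiv ℝ F x (EuclideanSpace.single i 1) i := by
    intro i
    exact integrable_test_mul hψ.continuous hc hs
      ((EuclideanSpace.proj (𝕜 := ℝ) i).continuous.comp_continuousOn
        (hdc.clm_apply continuousOn_const))
  have hC : ∀ i : Fin d, Integrable fun x => ψ x * F x i := fun i =>
    integrable_test_mul hψ.continuous hc hs
      ((EuclideanSpace.proj (𝕜 := ℝ) i).continuous.comp_continuousOn hFc)
  -- Integration by parts over the whole space, one coordinate at a time; `F` has to be
  -- differentiable only on the support of `ψ`.
  have key : ∀ i : Fin d, ∫ x, ψ x * fderiv ℝ F x (EuclideanSpace.single i 1) i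
      = -∫ x, fderiv ℝ ψ x (EuclideanSpace.single i 1) * F x i := by
    intro i
    exact integral_bilinear_hasFDerivAt_right_eq_neg_left_of_integrable
      (B := ContinuousLinearMap.mul ℝ ℝ) (f := ψ) (f' := fderiv ℝ ψ) (g := fun x => F x i)
      (g' := fun x => (EuclideanSpace.proj (𝕜 := ℝ) i).comp (fderiv ℝ F x))
      (v := EuclideanSpace.single i 1) (hA i) (hB i) (hC i)
      (fun x _ => (hψ.differentiable one_ne_zero x).hasFDerivAt) (fun x hx => hFi i x (hs hx))
  have h1 : ∫ x in Ω, fderiv ℝ ψ x (F x) = ∫ x, fderiv ℝ ψ x (F x) := by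
    refine setIntegral_eq_integral_of_forall_compl_eq_zero fun x hx => ?_
    have : fderiv ℝ ψ x = 0 := by
      by_contra h0
      exact hx (hs (support_fderiv_subset ℝ h0))
    simp [this]
  have h2 : ∫ x in Ω, ψ x * divergence F x = ∫ x, ψ x * divergence F x := by
    refine setIntegral_eq_integral_of_forall_compl_eq_zero fun x hx => ?_
    have : ψ x = 0 := by
      by_contra h0
      exact hx (hs (subset_tsupport _ h0))
    simp [this]
  rw [h1, h2]
  simp_rw [← sum_mul_single (fderiv ℝ ψ _) (F _), divergence, Finset.mul_sum]
  rw [integral_finsetSum _ fun i _ => hA i, integral_finsetSum _ fun i _ => hB i,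
    ← Finset.sum_neg_distrib]
  exact Finset.sum_congr rfl fun i _ => by rw [key i, neg_neg]

/-- A trace bound: it turns the uniform derivative bound on mollified fields into one on their
divergences. -/
lemma abs_sum_diag_le (L : Space d →L[ℝ] Space d) :
    |∑ i : Fin d, L (EuclideanSpace.single i 1) i| ≤ d * ‖L‖ := by
  refine (Finset.abs_sum_le_sum_abs _ _).trans ?_
  refine (Finset.sum_le_card_nsmul _ _ ‖L‖ fun i _ => ?_).trans_eq (by simp)
  refine (PiLp.norm_apply_le (L (EuclideanSpace.single i 1)) i).trans ?_
  simpa using L.le_opNorm (EuclideanSpace.single i 1)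

/-- A weak momentum balance extends from smooth to continuously differentiable test fields. -/
lemma momentum_balance_C1 (hΩ : IsOpen Ω) (hb : Bornology.IsBounded Ω)
    {m u : Space d → Space d} {ρ p β : Space d → ℝ} (hm : IntegrableOn m Ω)
    (hρ : ∀ x ∈ Ω, ContDiffAt ℝ 1 ρ x) (hu : ContinuousOn u Ω) (hp : ContinuousOn p Ω)
    (hβ : ContinuousOn β Ω) {C : ℝ} (hC0 : 0 ≤ C) (hρC : ∀ x ∈ Ω, |ρ x| ≤ C)
    (hdρC : ∀ x ∈ Ω, ‖fderiv ℝ ρ x‖ ≤ C)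
    (huC : ∀ x ∈ Ω, ‖u x‖ ≤ C) (hpC : ∀ x ∈ Ω, |p x| ≤ C) (hβC : ∀ x ∈ Ω, |β x| ≤ C)
    (h : ∀ φ : Space d → Space d, ContDiff ℝ ∞ φ → HasCompactSupport φ → tsupport φ ⊆ Ω →
      ∫ x in Ω, ⟪m x, φ x⟫ = ∫ x in Ω, (ρ x * ⟪u x, fderiv ℝ φ x (u x)⟫ + p x * divergence φ x
          - β x * divergence (fun y => ρ y • φ y) x))
    {φ : Space d → Space d} (hφ : ContDiff ℝ 1 φ) (hφc : HasCompactSupport φ)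
    (hφs : tsupport φ ⊆ Ω) :
    ∫ x in Ω, ⟪m x, φ x⟫ = ∫ x in Ω, (ρ x * ⟪u x, fderiv ℝ φ x (u x)⟫ + p x * divergence φ x
          - β x * divergence (fun y => ρ y • φ y) x) := by
  have hfin : IsFiniteMeasure (volume.restrict Ω) := ⟨by simpa using hb.measure_lt_top⟩
  obtain ⟨K, hK⟩ := hφ.lipschitzWith_of_hasCompactSupport hφc one_ne_zero
  obtain ⟨Φ, hΦ, hΦc, hΦs, ⟨A, hA⟩, hΦlim, hΦd, -⟩ := exists_smooth_approx hK hφc hΩ hφs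
  have hA0 : 0 ≤ A := (norm_nonneg _).trans (hA 0 0).1
  have hdiv : ∀ φ : Space d → Space d, Differentiable ℝ φ → ∀ x ∈ Ω,
      divergence (fun y => ρ y • φ y) x = ρ x * divergence φ x + fderiv ℝ ρ x (φ x) :=
    fun φ hφ x hx => divergence_smul ((hρ x hx).differentiableAt one_ne_zero) (hφ x)
  -- With `div (ρ φ)` expanded, the integrand is linear in the pointwise values of `φ` and its first
  -- derivative, which converge boundedly almost everywhere under mollification.
  set I : (Space d → Space d) → Space d → ℝ := fun φ x =>
    ρ x * ⟪u x, fderiv ℝ φ x (u x)⟫ + p x * divergence φ x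
      - β x * (ρ x * divergence φ x + fderiv ℝ ρ x (φ x)) with hI
  have hIeq : ∀ φ : Space d → Space d, Differentiable ℝ φ →
      ∫ x in Ω, (ρ x * ⟪u x, fderiv ℝ φ x (u x)⟫ + p x * divergence φ x
          - β x * divergence (fun y => ρ y • φ y) x) = ∫ x in Ω, I φ x := by
    intro φ hφ
    refine setIntegral_congr_fun hΩ.measurableSet fun x hx => ?_
    simp only [hI, hdiv φ hφ x hx]
  have hρc : ContinuousOn ρ Ω := fun x hx => (hρ x hx).continuousAt.continuousWithinAt
  have hdρc : ContinuousOn (fderiv ℝ ρ) Ω := fun x hx =>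
    ((hρ x hx).fderiv_right (m := 0) (by norm_num)).continuousAt.continuousWithinAt
  have hdivΦ : ∀ n x, |divergence (Φ n) x| ≤ d * A := fun n x =>
    (abs_sum_diag_le _).trans (mul_le_mul_of_nonneg_left (hA n x).2 (Nat.cast_nonneg _))
  refine tendsto_nhds_unique (f := fun n => ∫ x in Ω, ⟪m x, Φ n x⟫) (l := atTop) ?_ ?_
  · refine tendsto_integral_of_dominated_convergence (fun x => ‖m x‖ * A) (fun n => ?_)
      (hm.norm.mul_const A) (fun n => Eventually.of_forall fun x => ?_)
      (Eventually.of_forall fun x => tendsto_const_nhds.inner (hΦlim x))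
    · exact hm.1.inner (hΦ n).continuous.aestronglyMeasurable
    · exact (norm_inner_le_norm _ _).trans
        (mul_le_mul_of_nonneg_left (hA n x).1 (norm_nonneg _))
  · rw [hIeq φ (hφ.differentiable one_ne_zero)]
    simp_rw [fun n => h (Φ n) (hΦ n) (hΦc n) (hΦs n),
      fun n => hIeq (Φ n) ((hΦ n).differentiable (by simp))]
    refine tendsto_integral_of_dominated_convergence
      (fun _ => C * (C * (A * C)) + C * (d * A) + C * (C * (d * A) + C * A)) (fun n => ?_)
      (integrable_const _) (fun n => ?_) ?_
    · refine ContinuousOn.aestronglyMeasurable ?_ hΩ.measurableSet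
      have h1 : ContDiff ℝ 1 (Φ n) := (hΦ n).of_le (by simp)
      have h2 : ContinuousOn (divergence (Φ n)) Ω :=
        continuousOn_divergence fun x _ => h1.contDiffAt
      have h3 : ContinuousOn (fderiv ℝ (Φ n)) Ω :=
        (h1.continuous_fderiv one_ne_zero).continuousOn
      exact ((hρc.mul (hu.inner (h3.clm_apply hu))).add (hp.mul h2)).sub
        (hβ.mul ((hρc.mul h2).add (hdρc.clm_apply h1.continuous.continuousOn)))
    · refine (ae_restrict_iff' hΩ.measurableSet).2 (Eventually.of_forall fun x hx => ?_)
      have e1 : |ρ x * ⟪u x, fderiv ℝ (Φ n) x (u x)⟫| ≤ C * (C * (A * C)) := by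
        rw [abs_mul]
        refine mul_le_mul (hρC x hx) ?_ (abs_nonneg _) hC0
        refine (abs_real_inner_le_norm _ _).trans (mul_le_mul (huC x hx) ?_ (norm_nonneg _) hC0)
        exact ((fderiv ℝ (Φ n) x).le_opNorm _).trans
          (mul_le_mul (hA n x).2 (huC x hx) (norm_nonneg _) hA0)
      have e2 : |p x * divergence (Φ n) x| ≤ C * (d * A) := by
        rw [abs_mul]
        exact mul_le_mul (hpC x hx) (hdivΦ n x) (abs_nonneg _) hC0
      have e3 : |β x * (ρ x * divergence (Φ n) x + fderiv ℝ ρ x (Φ n x))|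
          ≤ C * (C * (d * A) + C * A) := by
        rw [abs_mul]
        refine mul_le_mul (hβC x hx) ((abs_add_le _ _).trans (add_le_add ?_ ?_)) (abs_nonneg _) hC0
        · rw [abs_mul]
          exact mul_le_mul (hρC x hx) (hdivΦ n x) (abs_nonneg _) hC0
        · exact ((fderiv ℝ ρ x).le_opNorm _).trans
            (mul_le_mul (hdρC x hx) (hA n x).1 (norm_nonneg _) hC0)
      exact (abs_sub _ _).trans (add_le_add ((abs_add_le _ _).trans (add_le_add e1 e2)) e3)
    · refine (ae_restrict_of_ae ?_)
      filter_upwards [hΦd] with x hx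
      have hxv : ∀ v, Tendsto (fun n => fderiv ℝ (Φ n) x v) atTop (𝓝 (fderiv ℝ φ x v)) := fun v =>
        ((ContinuousLinearMap.apply ℝ (Space d) v).continuous.tendsto _).comp hx
      have hxd : Tendsto (fun n => divergence (Φ n) x) atTop (𝓝 (divergence φ x)) :=
        tendsto_finsetSum _ fun i _ =>
          ((EuclideanSpace.proj (𝕜 := ℝ) i).continuous.tendsto _).comp (hxv _)
      exact (((tendsto_const_nhds.inner (hxv (u x))).const_mul _).add (hxd.const_mul _)).sub
        (((hxd.const_mul _).add (((fderiv ℝ ρ x).continuous.tendsto _).comp (hΦlim x))).const_mul _)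

end WeakForms

/-! ### Bounds and boundary behaviour of the weight -/

section Weight

variable {d : ℕ} {Ω ΓD : Set (Space d)} {a : Space d → ℝ}

lemma IsWeight.contDiffAt (ha : IsWeight Ω ΓD a) (hΩ : IsOpen Ω) {x : Space d} (hx : x ∈ Ω) :
    ContDiffAt ℝ 4 a x :=
  ha.smooth_interior.contDiffAt (hΩ.mem_nhds hx)

lemma norm_gradient (f : Space d → ℝ) (x : Space d) : ‖∇ f x‖ = ‖fderiv ℝ f x‖ := by
  rw [← toDual_gradient, LinearIsometryEquiv.norm_map]

/-- The derivatives of a weight that occur in the virial identity are bounded. -/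
lemma IsWeight.exists_bound (ha : IsWeight Ω ΓD a) (hΩ : IsOpen Ω)
    (hb : Bornology.IsBounded Ω) :
    ∃ A : ℝ, 0 ≤ A ∧ ∀ x ∈ Ω, |a x| ≤ A ∧ ‖∇ a x‖ ≤ A ∧ ‖fderiv ℝ (fderiv ℝ a) x‖ ≤ A ∧
      |(Δ a) x| ≤ A ∧ ‖∇ (fun z => -(Δ a) z) x‖ ≤ A := by
  have hD : ∀ j ≤ 3, ∃ C, ∀ x ∈ Ω, ‖iteratedFDeriv ℝ j a x‖ ≤ C := by
    intro j hj
    obtain ⟨D, hDc, hD⟩ := ha.smooth_closure.2 j hj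
    obtain ⟨C, hC⟩ := hb.isCompact_closure.exists_bound_of_continuousOn hDc
    exact ⟨C, fun x hx => by rw [← hD x hx]; exact hC x (subset_closure hx)⟩
  obtain ⟨C0, hC0⟩ := hD 0 (by norm_num)
  obtain ⟨C1, hC1⟩ := hD 1 (by norm_num)
  obtain ⟨C2, hC2⟩ := hD 2 (by norm_num)
  obtain ⟨C3, hC3⟩ := hD 3 (by norm_num)
  have n1 : ∀ x, ‖fderiv ℝ a x‖ = ‖iteratedFDeriv ℝ 1 a x‖ := fun x => by
    rw [← norm_iteratedFDeriv_fderiv, norm_iteratedFDeriv_zero]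
  have n2 : ∀ x, ‖fderiv ℝ (fderiv ℝ a) x‖ = ‖iteratedFDeriv ℝ 2 a x‖ := fun x => by
    rw [← norm_iteratedFDeriv_fderiv, ← norm_iteratedFDeriv_fderiv, norm_iteratedFDeriv_zero]
  have hsing : ∀ i : Fin d, ‖(EuclideanSpace.single i 1 : Space d)‖ = 1 := fun i => by simp
  have hlap : ∀ x ∈ Ω, |(Δ a) x| ≤ d * C2 := by
    intro x hx
    rw [laplacian_eq_sum]
    refine (Finset.abs_sum_le_sum_abs _ _).trans ?_
    refine (Finset.sum_le_card_nsmul _ _ C2 fun i _ => ?_).trans_eq (by simp)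
    have := (fderiv ℝ (fderiv ℝ a) x).le_opNorm₂ (EuclideanSpace.single i 1)
      (EuclideanSpace.single i 1)
    rw [hsing, mul_one, mul_one, n2] at this
    exact this.trans (hC2 x hx)
  -- The Laplacian is a sum of diagonal entries of the second derivative, so its gradient is
  -- controlled by the third derivative, the last one known to extend continuously to the compact
  -- closure.
  have hg : ∀ x ∈ Ω, ‖∇ (fun z => -(Δ a) z) x‖ ≤ d * C3 := by
    intro x hx
    have h4 : DifferentiableAt ℝ (iteratedFDeriv ℝ 2 a) x :=
      (ha.contDiffAt hΩ hx).differentiableAt_iteratedFDeriv (by norm_num)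
    have h5 : ∀ i : Fin d, HasFDerivAt (fun y => iteratedFDeriv ℝ 2 a y
        ![EuclideanSpace.basisFun (Fin d) ℝ i, EuclideanSpace.basisFun (Fin d) ℝ i])
        ((ContinuousMultilinearMap.apply ℝ (fun _ : Fin 2 => Space d) ℝ
          ![EuclideanSpace.basisFun (Fin d) ℝ i, EuclideanSpace.basisFun (Fin d) ℝ i]).comp
            (fderiv ℝ (iteratedFDeriv ℝ 2 a) x)) x := fun i =>
      (ContinuousMultilinearMap.apply ℝ (fun _ : Fin 2 => Space d) ℝ
          ![EuclideanSpace.basisFun (Fin d) ℝ i,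
            EuclideanSpace.basisFun (Fin d) ℝ i]).hasFDerivAt.comp x h4.hasFDerivAt
    have h6 := (HasFDerivAt.fun_sum fun i (_ : i ∈ Finset.univ) => h5 i)
    rw [norm_gradient, fderiv_fun_neg, norm_neg,
      InnerProductSpace.laplacian_eq_iteratedFDeriv_orthonormalBasis a
      (EuclideanSpace.basisFun (Fin d) ℝ),
      HasFDerivAt.fderiv h6]
    refine (norm_sum_le _ _).trans ((Finset.sum_le_card_nsmul _ _ C3 fun i _ => ?_).trans_eq
      (by simp))
    refine ContinuousLinearMap.opNorm_le_bound _ ((norm_nonneg _).trans (hC3 x hx)) fun v => ?_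
    refine ((fderiv ℝ (iteratedFDeriv ℝ 2 a) x v).le_opNorm _).trans ?_
    simp only [Fin.prod_univ_two, Matrix.cons_val_zero, Matrix.cons_val_one,
      OrthonormalBasis.norm_eq_one, mul_one]
    refine ((fderiv ℝ (iteratedFDeriv ℝ 2 a) x).le_opNorm v).trans ?_
    rw [norm_fderiv_iteratedFDeriv]
    exact mul_le_mul_of_nonneg_right (hC3 x hx) (norm_nonneg _)
  refine ⟨max 0 (max C0 (max C1 (max C2 (max (d * C2) (d * C3))))), le_max_left _ _,
    fun x hx => ⟨?_, ?_, ?_, ?_, ?_⟩⟩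
  · have := hC0 x hx
    rw [norm_iteratedFDeriv_zero] at this
    refine this.trans ?_
    simp
  · rw [norm_gradient, n1]
    refine (hC1 x hx).trans ?_
    simp
  · rw [n2]
    refine (hC2 x hx).trans ?_
    simp
  · refine (hlap x hx).trans ?_
    simp
  · refine (hg x hx).trans ?_
    simp

lemma tendsto_mul_zero_of_bdd {α : Type*} {l : Filter α} {f g : α → ℝ} {C : ℝ}
    (hf : ∀ᶠ x in l, |f x| ≤ C) (hg : Tendsto g l (𝓝 0)) :
    Tendsto (fun x => f x * g x) l (𝓝 0) := by
  refine squeeze_zero_norm' (a := fun x => C * |g x|) ?_ ?_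
  · filter_upwards [hf] with x hx
    rw [norm_mul]
    exact mul_le_mul_of_nonneg_right hx (abs_nonneg _)
  · simpa using hg.abs.const_mul C

/-- The boundary values of `a ∇a · ν` and the like vanish. -/
lemma IsWeight.tendsto_mul_inner (ha : IsWeight Ω ΓD a) {F : Space d → Space d} {C : ℝ}
    (hF : ∀ x ∈ Ω, ‖F x‖ ≤ C) {x ν : Space d} (hx : x ∈ frontier Ω)
    (hν : IsOuterUnitNormal Ω x ν)
    (hN : x ∈ frontier Ω \ ΓD → Tendsto (fun y => ⟪F y, ν⟫) (𝓝[Ω] x) (𝓝 0)) :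
    Tendsto (fun y => a y * ⟪F y, ν⟫) (𝓝[Ω] x) (𝓝 0) := by
  have hax : Tendsto a (𝓝[Ω] x) (𝓝 (a x)) :=
    (ha.continuousOn x hx.1).mono_left (nhdsWithin_mono _ subset_closure)
  by_cases hD : x ∈ ΓD
  · rw [ha.dirichlet x hD] at hax
    simp_rw [mul_comm (a _)]
    refine tendsto_mul_zero_of_bdd (C := C) ?_ hax
    filter_upwards [self_mem_nhdsWithin] with y hy
    refine (abs_real_inner_le_norm _ _).trans ?_
    rw [hν.1, mul_one]
    exact hF y hy
  · simpa using hax.mul (hN ⟨hx, hD⟩)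

/-- A harmonic weight is locally constant: `∇a = 0`. -/
lemma IsWeight.gradient_eq_zero (ha : IsWeight Ω ΓD a) (hΩ : IsLipschitzDomain Ω)
    (h : ∀ x ∈ Ω, (Δ a) x = 0) : ∀ x ∈ Ω, ∇ a x = 0 := by
  obtain ⟨A, hA0, hA⟩ := ha.exists_bound hΩ.isOpen hΩ.bounded
  have hga : ∀ x ∈ Ω, ContDiffAt ℝ 1 (∇ a) x := fun x hx =>
    contDiffAt_gradient (n := 4) (m := 1) (ha.contDiffAt hΩ.isOpen hx) (by norm_num)
  have hgc : ContinuousOn (∇ a) Ω := fun x hx => (hga x hx).continuousAt.continuousWithinAt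
  have hac : ContinuousOn a Ω := ha.continuousOn.mono subset_closure
  have hF : ∀ x ∈ Ω, ContDiffAt ℝ 1 (fun y => (-a y) • ∇ a y) x := fun x hx =>
    (((ha.contDiffAt hΩ.isOpen hx).of_le (by norm_num)).neg).smul (hga x hx)
  have hdiv : ∀ x ∈ Ω, divergence (fun y => (-a y) • ∇ a y) x = -‖∇ a x‖ ^ 2 := by
    intro x hx
    have hd : DifferentiableAt ℝ a x := (ha.contDiffAt hΩ.isOpen hx).differentiableAt (by norm_num)
    rw [divergence_smul hd.fun_neg ((hga x hx).differentiableAt one_ne_zero),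
      divergence_gradient (differentiableAt_fderiv (n := 4) (ha.contDiffAt hΩ.isOpen hx)
        (by norm_num)), h x hx, fderiv_fun_neg, neg_apply, ← inner_gradient_left,
      real_inner_self_eq_norm_sq]
    ring
  have hint : IntegrableOn (fun x => ‖∇ a x‖ ^ 2) Ω := by
    refine integrableOn_of_bdd hΩ.isOpen hΩ.bounded
      ((hgc.norm.pow 2).aestronglyMeasurable hΩ.isOpen.measurableSet) (C := A ^ 2) fun x hx => ?_
    rw [norm_pow, norm_norm]
    exact pow_le_pow_left₀ (norm_nonneg _) (hA x hx).2.1 2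
  -- The energy argument: for harmonic `a` the field `-a ∇a` has divergence `-|∇a|²`, and its normal
  -- component vanishes at the boundary.
  have hle : ∫ x in Ω, ‖∇ a x‖ ^ 2 ≤ 0 := by
    refine divergence_ineq hΩ hint (Z := fun y => (-a y) • ∇ a y) (B := A * A)
      (hac.neg.smul hgc) (fun x hx => ?_) (fun ψ h1 h2 h3 h4 => ?_) (fun x hx ν hν => ?_)
    · rw [norm_smul, norm_neg]
      exact mul_le_mul (hA x hx).1 (hA x hx).2.1 (norm_nonneg _) hA0
    · rw [integral_fderiv_test (h1.of_le (by simp)) h2 h3 hF, ← integral_neg]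
      refine (setIntegral_congr_fun hΩ.isOpen.measurableSet fun x hx => ?_).le
      simp only [hdiv x hx]
      ring
    · refine ⟨0, le_rfl, ?_⟩
      have := (ha.tendsto_mul_inner (F := ∇ a) (fun x hx => (hA x hx).2.1) hx hν
        fun hx' => ha.neumann x hx' ν hν).neg
      rw [neg_zero] at this
      refine this.congr fun y => ?_
      rw [real_inner_smul_left]
      ring
  have h0 : ∫ x in Ω, ‖∇ a x‖ ^ 2 = 0 :=
    le_antisymm hle (integral_nonneg fun x => by positivity)
  rw [setIntegral_eq_zero_iff_of_nonneg_ae (Eventually.of_forall fun x => by positivity) hint] at h0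
  have h1 := Measure.eqOn_open_of_ae_eq h0 hΩ.isOpen (hgc.norm.pow 2) continuousOn_const
  intro x hx
  have := h1 hx
  simpa using this

end Weight

/-! ### Mass balance and boundary flux at a fixed time -/

section Slice

variable {d : ℕ} {Ω ΓD : Set (Space d)} {a : Space d → ℝ}

/-- The mass balance of a regular state, tested with the weight. -/
lemma mass_slice_ineq (hΩ : IsLipschitzDomain Ω) (ha : IsWeight Ω ΓD a) {R : Space d → ℝ}
    {U : Space d → Space d} (hR : ContDiff ℝ 2 R) (hU : ContDiff ℝ 1 U)
    (hN : ∀ x ∈ frontier Ω \ ΓD, ∀ ν : Space d, IsOuterUnitNormal Ω x ν → ⟪U x, ν⟫ = 0) :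
    -∫ x in Ω, a x * divergence (fun y => R y • U y) x ≤ ∫ x in Ω, R x * ⟪U x, ∇ a x⟫ := by
  have hcpt := hΩ.bounded.isCompact_closure
  obtain ⟨A, hA0, hA⟩ := ha.exists_bound hΩ.isOpen hΩ.bounded
  set F : Space d → Space d := fun y => R y • U y with hF
  have hF1 : ContDiff ℝ 1 F := (hR.of_le (by norm_num)).smul hU
  have hac : ContinuousOn a Ω := ha.continuousOn.mono subset_closure
  have ha1 : ∀ x ∈ Ω, ContDiffAt ℝ 1 a x := fun x hx =>
    (ha.contDiffAt hΩ.isOpen hx).of_le (by norm_num)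
  have hgc : ContinuousOn (∇ a) Ω := fun x hx =>
    (contDiffAt_gradient (n := 4) (m := 1) (ha.contDiffAt hΩ.isOpen hx)
      (by norm_num)).continuousAt.continuousWithinAt
  have hdivc : ContinuousOn (divergence F) univ := continuousOn_divergence fun x _ => hF1.contDiffAt
  obtain ⟨C1, hC1⟩ := hcpt.exists_bound_of_continuousOn hF1.continuous.continuousOn
  obtain ⟨C2, hC2⟩ := hcpt.exists_bound_of_continuousOn (hdivc.mono (subset_univ _))
  have hZ : ∀ x ∈ Ω, ContDiffAt ℝ 1 (fun y => a y • F y) x := fun x hx =>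
    (ha1 x hx).smul hF1.contDiffAt
  have hdiv : ∀ x ∈ Ω, divergence (fun y => a y • F y) x
      = a x * divergence F x + R x * ⟪U x, ∇ a x⟫ := by
    intro x hx
    rw [divergence_smul ((ha1 x hx).differentiableAt one_ne_zero)
      (hF1.differentiable one_ne_zero x), ← inner_gradient_left, hF, real_inner_smul_right,
      real_inner_comm]
  have hi1 : IntegrableOn (fun x => a x * divergence F x) Ω := by
    refine integrableOn_of_bdd hΩ.isOpen hΩ.bounded ((hac.mul
      (hdivc.mono (subset_univ _))).aestronglyMeasurable hΩ.isOpen.measurableSet) (C := A * C2)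
      fun x hx => ?_
    rw [norm_mul]
    exact mul_le_mul (hA x hx).1 (hC2 x (subset_closure hx)) (norm_nonneg _) hA0
  have hi2 : IntegrableOn (fun x => R x * ⟪U x, ∇ a x⟫) Ω := by
    refine integrableOn_of_bdd hΩ.isOpen hΩ.bounded
      ((hR.continuous.continuousOn.mul (hU.continuous.continuousOn.inner hgc)).aestronglyMeasurable
        hΩ.isOpen.measurableSet) (C := C1 * A) fun x hx => ?_
    rw [← real_inner_smul_left]
    refine (norm_inner_le_norm _ _).trans ?_
    exact mul_le_mul (hC1 x (subset_closure hx)) (hA x hx).2.1 (norm_nonneg _)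
      ((norm_nonneg _).trans (hC1 x (subset_closure hx)))
  -- The divergence inequality for the field `a R U`, whose normal boundary value is zero: `a`
  -- vanishes on `ΓD` and `U · ν` vanishes off it.
  have hle : ∫ x in Ω, -(a x * divergence F x + R x * ⟪U x, ∇ a x⟫) ≤ 0 := by
    refine divergence_ineq hΩ (hi1.add hi2).neg (Z := fun y => a y • F y) (B := A * C1)
      (hac.smul hF1.continuous.continuousOn) (fun x hx => ?_) (fun ψ h1 h2 h3 h4 => ?_)
      (fun x hx ν hν => ?_)
    · rw [norm_smul]
      exact mul_le_mul (hA x hx).1 (hC1 x (subset_closure hx)) (norm_nonneg _) hA0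
    · rw [integral_fderiv_test (h1.of_le (by simp)) h2 h3 hZ, ← integral_neg]
      refine (setIntegral_congr_fun hΩ.isOpen.measurableSet fun x hx => ?_).le
      simp only [hdiv x hx]
      ring
    · refine ⟨0, le_rfl, ?_⟩
      simp_rw [real_inner_smul_left]
      refine ha.tendsto_mul_inner (F := F) (fun x hx => hC1 x (subset_closure hx)) hx hν
        fun hx' => ?_
      have : Tendsto (fun y => ⟪F y, ν⟫) (𝓝 x) (𝓝 ⟪F x, ν⟫) :=
        (hF1.continuous.inner continuous_const).tendsto x
      rw [hF, real_inner_smul_left, hN x hx' ν hν, mul_zero] at this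
      exact this.mono_left nhdsWithin_le_nhds
  rw [integral_neg, integral_add hi1 hi2] at hle
  linarith

lemma continuousOn_gradient {s : Set (Space d)} {f : Space d → ℝ}
    (hf : ∀ x ∈ s, ContDiffAt ℝ 1 f x) : ContinuousOn (∇ f) s := fun x hx =>
  (contDiffAt_gradient (n := 1) (m := 0) (hf x hx) (by norm_num)).continuousAt.continuousWithinAt

lemma continuousOn_laplacian {s : Set (Space d)} {f : Space d → ℝ}
    (hf : ∀ x ∈ s, ContDiffAt ℝ 2 f x) : ContinuousOn (Δ f) s := fun x hx =>
  (contDiffAt_laplacian (n := 2) (m := 0) (hf x hx) (by norm_num)).continuousAt.continuousWithinAt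

/-- Boundedness of the quantities built from a regular positive state. -/
lemma exists_state_bound {P : ℝ → ℝ} (hP : ContinuousOn P (Ioi 0))
    (hb : Bornology.IsBounded Ω) {R : Space d → ℝ} {U : Space d → Space d} (hR : ContDiff ℝ 2 R)
    (hU : ContDiff ℝ 1 U) (hpos : ∀ x ∈ closure Ω, 0 < R x) :
    ContinuousOn (bohm R) (closure Ω) ∧ ContinuousOn (fun x => P (R x)) (closure Ω) ∧
    ∃ C : ℝ, 0 ≤ C ∧ ∀ x ∈ Ω, |R x| ≤ C ∧ ‖fderiv ℝ R x‖ ≤ C ∧ ‖U x‖ ≤ C ∧ |P (R x)| ≤ C ∧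
      |bohm R x| ≤ C ∧ |√(R x)| ≤ C ∧ ‖∇ (fun y => √(R y)) x‖ ≤ C := by
  have hcpt := hb.isCompact_closure
  have hr : ∀ x ∈ closure Ω, ContDiffAt ℝ 2 (fun y => √(R y)) x := fun x hx =>
    hR.contDiffAt.sqrt (hpos x hx).ne'
  have hrc : ContinuousOn (fun y => √(R y)) (closure Ω) := hR.continuous.sqrt.continuousOn
  have hβ : ContinuousOn (bohm R) (closure Ω) :=
    (continuousOn_laplacian hr).div hrc fun x hx => (Real.sqrt_pos.2 (hpos x hx)).ne'
  have hp : ContinuousOn (fun x => P (R x)) (closure Ω) :=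
    hP.comp hR.continuous.continuousOn fun x hx => hpos x hx
  obtain ⟨C1, h1⟩ := hcpt.exists_bound_of_continuousOn hR.continuous.continuousOn
  obtain ⟨C2, h2⟩ := hcpt.exists_bound_of_continuousOn
    (hR.continuous_fderiv two_ne_zero).continuousOn
  obtain ⟨C3, h3⟩ := hcpt.exists_bound_of_continuousOn hU.continuous.continuousOn
  obtain ⟨C4, h4⟩ := hcpt.exists_bound_of_continuousOn hp
  obtain ⟨C5, h5⟩ := hcpt.exists_bound_of_continuousOn hβ
  obtain ⟨C6, h6⟩ := hcpt.exists_bound_of_continuousOn hrc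
  obtain ⟨C7, h7⟩ := hcpt.exists_bound_of_continuousOn
    (continuousOn_gradient fun x hx => (hr x hx).of_le (by norm_num))
  refine ⟨hβ, hp, max 0 (max C1 (max C2 (max C3 (max C4 (max C5 (max C6 C7)))))), le_max_left _ _,
    fun x hx => ⟨?_, ?_, ?_, ?_, ?_, ?_, ?_⟩⟩
  · exact (h1 x (subset_closure hx)).trans (by simp)
  · exact (h2 x (subset_closure hx)).trans (by simp)
  · exact (h3 x (subset_closure hx)).trans (by simp)
  · exact (h4 x (subset_closure hx)).trans (by simp)
  · exact (h5 x (subset_closure hx)).trans (by simp)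
  · exact (h6 x (subset_closure hx)).trans (by simp)
  · exact (h7 x (subset_closure hx)).trans (by simp)

/-- The total flux of the virial identity. -/
noncomputable def virialFlux (a : Space d → ℝ) (P : ℝ → ℝ) (R : Space d → ℝ)
    (U : Space d → Space d) (y : Space d) : Space d :=
  (R y * ⟪U y, ∇ a y⟫) • U y + (P (R y) - R y * bohm R y) • ∇ a y
    - bohmFlux (fun z => √(R z)) a y

/-- The boundary values of the normal component of the virial flux are nonnegative. -/
lemma virialFlux_normal (ha : IsWeight Ω ΓD a) (hΩ : IsOpen Ω) (hb : Bornology.IsBounded Ω)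
    {P : ℝ → ℝ} (hP : ContinuousOn P (Ioi 0)) {c : ℝ} (hc : c ≤ 0) {R : Space d → ℝ}
    {U : Space d → Space d} (hR : ContDiff ℝ 2 R)
    (hU : ContDiff ℝ 1 U) (hpos : ∀ x ∈ closure Ω, 0 < R x)
    (hN : ∀ x ∈ frontier Ω \ ΓD, ∀ ν : Space d, IsOuterUnitNormal Ω x ν → ⟪U x, ν⟫ = 0)
    (hD : ∀ x ∈ ΓD, ∀ ν : Space d, IsOuterUnitNormal Ω x ν →
      Tendsto (fun y => ⟪∇ a y, ν⟫ * (bohm R y + ‖∇ (fun z => √(R z)) y‖ ^ 2 / R y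
        - P (R y) / R y) - ⟪U y, ∇ a y⟫ * ⟪U y, ν⟫) (𝓝[Ω] x) (𝓝 c))
    (hρ : ∀ x ∈ frontier Ω, ∀ ν : Space d, IsOuterUnitNormal Ω x ν →
      Tendsto (fun y => ⟪∇ (fun z => √(R z)) y, ν⟫) (𝓝[Ω] x) (𝓝 0))
    {x ν : Space d} (hx : x ∈ frontier Ω) (hν : IsOuterUnitNormal Ω x ν) :
    ∃ l : ℝ, 0 ≤ l ∧ Tendsto (fun y => ⟪virialFlux a P R U y, ν⟫) (𝓝[Ω] x) (𝓝 l) := by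
  obtain ⟨A, hA0, hA⟩ := ha.exists_bound hΩ hb
  obtain ⟨-, -, C, hC0, hC⟩ := exists_state_bound hP hb hR hU hpos
  have hRx : Tendsto R (𝓝[Ω] x) (𝓝 (R x)) := (hR.continuous.tendsto x).mono_left nhdsWithin_le_nhds
  have hUx : Tendsto (fun y => ⟪U y, ν⟫) (𝓝[Ω] x) (𝓝 ⟪U x, ν⟫) :=
    ((hU.continuous.inner continuous_const).tendsto x).mono_left nhdsWithin_le_nhds
  obtain ⟨l, hl, hlim⟩ := ha.normal_deriv_g_nonneg x hx ν hν
  have hRpos : 0 < R x := hpos x hx.1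
  set r : Space d → ℝ := fun z => √(R z) with hr
  have hrsq : ∀ y ∈ Ω, r y ^ 2 = R y := fun y hy => Real.sq_sqrt (hpos y (subset_closure hy)).le
  -- The grouping follows the boundary conditions: the first two terms together are `-R` times the
  -- expression in the Dirichlet condition, the third carries the normal derivative of `√R`, the
  -- last that of `g`.
  have hexp : ∀ y ∈ Ω, ⟪virialFlux a P R U y, ν⟫ =
      R y * ⟪U y, ∇ a y⟫ * ⟪U y, ν⟫ + (P (R y) - R y * bohm R y - ‖∇ r y‖ ^ 2) * ⟪∇ a y, ν⟫
        + (2 * ⟪∇ r y, ∇ a y⟫ + r y * (Δ a) y) * ⟪∇ r y, ν⟫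
        + 1 / 2 * R y * ⟪∇ (fun z => -(Δ a) z) y, ν⟫ := by
    intro y hy
    rw [virialFlux, bohmFlux, ← hr]
    simp only [inner_sub_left, inner_add_left, real_inner_smul_left]
    rw [hrsq y hy, ← real_inner_self_eq_norm_sq]
    ring
  -- the term with the normal derivative of `√ρ`
  have h2 : Tendsto (fun y => (2 * ⟪∇ r y, ∇ a y⟫ + r y * (Δ a) y) * ⟪∇ r y, ν⟫) (𝓝[Ω] x)
      (𝓝 0) := by
    refine tendsto_mul_zero_of_bdd (C := 2 * (C * A) + C * A) ?_ (hρ x hx ν hν)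
    filter_upwards [self_mem_nhdsWithin] with y hy
    refine (abs_add_le _ _).trans (add_le_add ?_ ?_)
    · rw [abs_mul, abs_two]
      refine mul_le_mul_of_nonneg_left ((abs_real_inner_le_norm _ _).trans ?_) zero_le_two
      exact mul_le_mul (hC y hy).2.2.2.2.2.2 (hA y hy).2.1 (norm_nonneg _) hC0
    · rw [abs_mul]
      exact mul_le_mul (hC y hy).2.2.2.2.2.1 (hA y hy).2.2.2.1 (abs_nonneg _) hC0
  have h3 : Tendsto (fun y => 1 / 2 * R y * ⟪∇ (fun z => -(Δ a) z) y, ν⟫) (𝓝[Ω] x)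
      (𝓝 (1 / 2 * R x * l)) := (hRx.const_mul _).mul hlim
  by_cases hxD : x ∈ ΓD
  · refine ⟨-(R x * c) + 0 + 1 / 2 * R x * l, ?_, ?_⟩
    · have h4 := mul_nonneg hRpos.le hl
      have h5 := mul_nonneg hRpos.le (neg_nonneg.2 hc)
      linarith
    · refine (((hRx.mul (hD x hxD ν hν)).neg.add h2).add h3).congr' ?_
      filter_upwards [self_mem_nhdsWithin] with y hy
      rw [hexp y hy]
      have : R y ≠ 0 := (hpos y (subset_closure hy)).ne'
      field_simp
      ring
  -- Off `ΓD` the first two terms vanish separately, as bounded factors times `U · ν` and `∇a · ν`.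
  · refine ⟨0 + 0 + 0 + 1 / 2 * R x * l, ?_, ?_⟩
    · have h4 := mul_nonneg hRpos.le hl
      linarith
    · have hxN : x ∈ frontier Ω \ ΓD := ⟨hx, hxD⟩
      rw [hN x hxN ν hν] at hUx
      have t1 : Tendsto (fun y => R y * ⟪U y, ∇ a y⟫ * ⟪U y, ν⟫) (𝓝[Ω] x) (𝓝 0) := by
        refine tendsto_mul_zero_of_bdd (C := C * (C * A)) ?_ hUx
        filter_upwards [self_mem_nhdsWithin] with y hy
        rw [abs_mul]
        refine mul_le_mul (hC y hy).1 ((abs_real_inner_le_norm _ _).trans ?_) (abs_nonneg _) hC0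
        exact mul_le_mul (hC y hy).2.2.1 (hA y hy).2.1 (norm_nonneg _) hC0
      have t2 : Tendsto (fun y => (P (R y) - R y * bohm R y - ‖∇ r y‖ ^ 2) * ⟪∇ a y, ν⟫)
          (𝓝[Ω] x) (𝓝 0) := by
        refine tendsto_mul_zero_of_bdd (C := C + C * C + C ^ 2) ?_ (ha.neumann x hxN ν hν)
        filter_upwards [self_mem_nhdsWithin] with y hy
        refine (abs_sub _ _).trans (add_le_add ((abs_sub _ _).trans (add_le_add ?_ ?_)) ?_)
        · exact (hC y hy).2.2.2.1
        · rw [abs_mul]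
          exact mul_le_mul (hC y hy).1 (hC y hy).2.2.2.2.1 (abs_nonneg _) hC0
        · rw [abs_pow, abs_norm]
          exact pow_le_pow_left₀ (norm_nonneg _) (hC y hy).2.2.2.2.2.2 2
      refine (((t1.add t2).add h2).add h3).congr' ?_
      filter_upwards [self_mem_nhdsWithin] with y hy
      rw [hexp y hy]

end Slice

/-! ### Momentum balance at a fixed time -/

section MomentumSlice

variable {d : ℕ} {Ω ΓD : Set (Space d)} {a : Space d → ℝ}

/-- The momentum balance of a regular positive state, tested with the gradient of the weight. -/
lemma momentum_slice_ineq (hΩ : IsLipschitzDomain Ω) (ha : IsWeight Ω ΓD a)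
    {P : ℝ → ℝ} (hP : ContinuousOn P (Ioi 0)) {c : ℝ} (hc : c ≤ 0) {R : Space d → ℝ}
    {m U : Space d → Space d} (hm : IntegrableOn m Ω) (hR : ContDiff ℝ 2 R)
    (hU : ContDiff ℝ 1 U) (hpos : ∀ x ∈ closure Ω, 0 < R x)
    (h : ∀ φ : Space d → Space d, ContDiff ℝ ∞ φ → HasCompactSupport φ → tsupport φ ⊆ Ω →
      ∫ x in Ω, ⟪m x, φ x⟫ = ∫ x in Ω, (R x * ⟪U x, fderiv ℝ φ x (U x)⟫
          + P (R x) * divergence φ x - bohm R x * divergence (fun y => R y • φ y) x))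
    (hN : ∀ x ∈ frontier Ω \ ΓD, ∀ ν : Space d, IsOuterUnitNormal Ω x ν → ⟪U x, ν⟫ = 0)
    (hD : ∀ x ∈ ΓD, ∀ ν : Space d, IsOuterUnitNormal Ω x ν →
      Tendsto (fun y => ⟪∇ a y, ν⟫ * (bohm R y + ‖∇ (fun z => √(R z)) y‖ ^ 2 / R y
        - P (R y) / R y) - ⟪U y, ∇ a y⟫ * ⟪U y, ν⟫) (𝓝[Ω] x) (𝓝 c))
    (hρ : ∀ x ∈ frontier Ω, ∀ ν : Space d, IsOuterUnitNormal Ω x ν →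
      Tendsto (fun y => ⟪∇ (fun z => √(R z)) y, ν⟫) (𝓝[Ω] x) (𝓝 0)) :
    IntegrableOn (fun x => ⟪m x, ∇ a x⟫) Ω ∧ IntegrableOn (fun x => P (R x) * (-(Δ a) x)) Ω ∧
    ∫ x in Ω, (⟪m x, ∇ a x⟫ + P (R x) * (-(Δ a) x)) ≤ 0 := by
  have hΩo := hΩ.isOpen
  have hΩm := hΩo.measurableSet
  obtain ⟨A, hA0, hA⟩ := ha.exists_bound hΩo hΩ.bounded
  obtain ⟨hβc, hpc, C, hC0, hC⟩ := exists_state_bound hP hΩ.bounded hR hU hpos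
  replace hβc := hβc.mono subset_closure
  replace hpc := hpc.mono subset_closure
  have ha4 : ∀ x ∈ Ω, ContDiffAt ℝ 4 a x := fun x hx => ha.contDiffAt hΩo hx
  have hga1 : ∀ x ∈ Ω, ContDiffAt ℝ 1 (∇ a) x := fun x hx =>
    contDiffAt_gradient (n := 4) (m := 1) (ha4 x hx) (by norm_num)
  have hgc : ContinuousOn (∇ a) Ω := fun x hx => (hga1 x hx).continuousAt.continuousWithinAt
  have hΔc : ContinuousOn (Δ a) Ω := continuousOn_laplacian fun x hx =>
    (ha4 x hx).of_le (by norm_num)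
  have hD2c : ContinuousOn (fun x => fderiv ℝ (fderiv ℝ a) x) Ω := fun x hx =>
    (((ha4 x hx).fderiv_right (m := 3) (by norm_num)).fderiv_right (m := 2)
      (by norm_num)).continuousAt.continuousWithinAt
  set r : Space d → ℝ := fun z => √(R z) with hr
  have hr2 : ∀ x ∈ Ω, ContDiffAt ℝ 2 r x := fun x hx =>
    hR.contDiffAt.sqrt (hpos x (subset_closure hx)).ne'
  have hB1 : ∀ x ∈ Ω, ContDiffAt ℝ 1 (bohmFlux r a) x := fun x hx =>
    contDiffAt_bohmFlux (hr2 x hx) (ha4 x hx)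
  have hBc : ContinuousOn (bohmFlux r a) Ω := fun x hx =>
    (hB1 x hx).continuousAt.continuousWithinAt
  have hZc : ContinuousOn (virialFlux a P R U) Ω :=
    (((hR.continuous.continuousOn.mul (hU.continuous.continuousOn.inner hgc)).smul
      hU.continuous.continuousOn).add
      ((hpc.sub (hR.continuous.continuousOn.mul hβc)).smul hgc)).sub hBc
  have him : IntegrableOn (fun x => ⟪m x, ∇ a x⟫) Ω := by
    refine Integrable.mono' (g := fun x => ‖m x‖ * A) (hm.norm.mul_const A)
      (hm.aestronglyMeasurable.inner (hgc.aestronglyMeasurable hΩm)) ?_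
    filter_upwards [ae_restrict_mem hΩm] with x hx
    exact (norm_inner_le_norm _ _).trans
      (mul_le_mul_of_nonneg_left (hA x hx).2.1 (norm_nonneg _))
  have hip : IntegrableOn (fun x => P (R x) * (-(Δ a) x)) Ω := by
    refine integrableOn_of_bdd hΩo hΩ.bounded ((hpc.mul hΔc.neg).aestronglyMeasurable hΩm)
      (C := C * A) fun x hx => ?_
    rw [norm_mul, norm_neg]
    exact mul_le_mul (hC x hx).2.2.2.1 (hA x hx).2.2.2.1 (norm_nonneg _) hC0
  -- The bound `B` adds up the bounds of the summands of `virialFlux` in order, with `C` for the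
  -- state and `A` for the weight.
  refine ⟨him, hip, divergence_ineq hΩ (him.add hip) (Z := virialFlux a P R U)
    (B := C * (C * A) * C + (C + C * C) * A
      + (2 * (C * A) * C + (C * C * A + (C * A * C + 1 / 2 * C ^ 2 * A)))) hZc (fun x hx => ?_) (fun ψ hψ hψc hψs hψ0 => ?_)
    (fun x hx ν hν => virialFlux_normal ha hΩo hΩ.bounded hP hc hR hU hpos hN hD hρ hx hν)⟩
  · obtain ⟨h1, -, h2, h3, h4, h5, h6⟩ := hC x hx
    obtain ⟨-, k1, -, k2, k3⟩ := hA x hx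
    have hinner : ∀ {v w : Space d} {α β : ℝ}, ‖v‖ ≤ α → ‖w‖ ≤ β → |⟪v, w⟫| ≤ α * β :=
      fun hv hw => (abs_real_inner_le_norm _ _).trans
        (mul_le_mul hv hw (norm_nonneg _) ((norm_nonneg _).trans hv))
    have hmul : ∀ {v w α β : ℝ}, |v| ≤ α → |w| ≤ β → |v * w| ≤ α * β := fun hv hw => by
      rw [abs_mul]
      exact mul_le_mul hv hw (abs_nonneg _) ((abs_nonneg _).trans hv)
    have hsmul : ∀ {t : ℝ} {v : Space d} {α β : ℝ}, |t| ≤ α → ‖v‖ ≤ β → ‖t • v‖ ≤ α * β :=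
      fun ht hv => by
      rw [norm_smul]
      exact mul_le_mul ht hv (norm_nonneg _) ((abs_nonneg _).trans ht)
    refine (norm_sub_le _ _).trans (add_le_add ((norm_add_le _ _).trans (add_le_add ?_ ?_)) ?_)
    · exact hsmul (hmul h1 (hinner h2 k1)) h2
    · exact hsmul ((abs_sub _ _).trans (add_le_add h3 (hmul h1 h4))) k1
    · refine (norm_add_le _ _).trans (add_le_add ?_ ((norm_add_le _ _).trans (add_le_add ?_
        ((norm_add_le _ _).trans (add_le_add ?_ ?_)))))
      · exact hsmul (hmul (by norm_num) (hinner h6 k1)) h6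
      · exact hsmul (hinner h6 h6) k1
      · exact hsmul (by rw [abs_neg]; exact hmul h5 k2) h6
      · refine hsmul (hmul (by norm_num [abs_div]) ?_) k3
        rw [abs_pow]
        exact pow_le_pow_left₀ (abs_nonneg _) h5 2
  · have hψ1 : ContDiff ℝ 1 ψ := hψ.of_le (by simp)
    -- The weak form of the inequality comes from the test field `ψ ∇a`. Since `a` is not smooth,
    -- this needs the balance for `C¹` fields.
    set φ : Space d → Space d := fun y => ψ y • ∇ a y with hφ
    have hφ1 : ContDiff ℝ 1 φ := by
      rw [contDiff_iff_contDiffAt]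
      intro x
      by_cases hx : x ∈ tsupport ψ
      · exact hψ1.contDiffAt.smul (hga1 x (hψs hx))
      · refine (contDiffAt_const (c := (0 : Space d))).congr_of_eventuallyEq ?_
        filter_upwards [notMem_tsupport_iff_eventuallyEq.1 hx] with y hy
        simp [hφ, hy]
    have hφc : HasCompactSupport φ := hψc.smul_right
    have hφs : tsupport φ ⊆ Ω := (tsupport_smul_subset_left _ _).trans hψs
    have hbal := momentum_balance_C1 hΩo hΩ.bounded hm
      (fun x _ => (hR.of_le (by norm_num)).contDiffAt) hU.continuous.continuousOn hpc hβc hC0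
      (fun x hx => (hC x hx).1) (fun x hx => (hC x hx).2.1) (fun x hx => (hC x hx).2.2.1)
      (fun x hx => (hC x hx).2.2.2.1) (fun x hx => (hC x hx).2.2.2.2.1) h hφ1 hφc hφs
    -- The part of the tested balance that carries `ψ` undifferentiated. The rest is `∇ψ` paired
    -- with `virialFlux + bohmFlux`; the second pairing is integrated back by parts and absorbs the
    -- Bohm term in `q`.
    set q : Space d → ℝ := fun x => R x * fderiv ℝ (fderiv ℝ a) x (U x) (U x)
      + P (R x) * (Δ a) x - bohm R x * divergence (fun y => R y • ∇ a y) x with hq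
    have hRg : ∀ x ∈ Ω, ContDiffAt ℝ 1 (fun y => R y • ∇ a y) x := fun x hx =>
      (hR.of_le (by norm_num)).contDiffAt.smul (hga1 x hx)
    have hqc : ContinuousOn q Ω :=
      ((hR.continuous.continuousOn.mul ((hD2c.clm_apply hU.continuous.continuousOn).clm_apply
        hU.continuous.continuousOn)).add (hpc.mul hΔc)).sub (hβc.mul (continuousOn_divergence hRg))
    have hpt : ∀ x ∈ Ω, R x * ⟪U x, fderiv ℝ φ x (U x)⟫ + P (R x) * divergence φ x
        - bohm R x * divergence (fun y => R y • φ y) x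
        = fderiv ℝ ψ x (virialFlux a P R U x) + fderiv ℝ ψ x (bohmFlux r a x) + ψ x * q x := by
      intro x hx
      have hψd := hψ1.differentiable one_ne_zero x
      have hgd := (hga1 x hx).differentiableAt one_ne_zero
      have e1 : fderiv ℝ φ x (U x) = ψ x • fderiv ℝ (∇ a) x (U x)
          + (fderiv ℝ ψ x (U x)) • ∇ a x := by
        rw [hφ, fderiv_fun_smul hψd hgd]
        simp
      have e2 : divergence (fun y => R y • φ y) x
          = ψ x * divergence (fun y => R y • ∇ a y) x + fderiv ℝ ψ x (R x • ∇ a x) := by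
        rw [← divergence_smul hψd ((hRg x hx).differentiableAt one_ne_zero)]
        refine congrArg (fun F => divergence F x) (funext fun y => ?_)
        exact smul_comm _ _ _
      have e3 : divergence φ x = ψ x * (Δ a) x + fderiv ℝ ψ x (∇ a x) := by
        rw [hφ, divergence_smul hψd hgd, divergence_gradient (differentiableAt_fderiv (ha4 x hx)
          (by norm_num))]
      rw [e1, e2, e3, virialFlux, inner_add_right, real_inner_smul_right, real_inner_smul_right,
        real_inner_comm, inner_fderiv_gradient (differentiableAt_fderiv (ha4 x hx)
          (by norm_num))]
      simp only [map_sub, map_add, map_smul, smul_eq_mul, hq]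
      ring
    have iZ := (integrable_test_fderiv hψ1 hψc hψs hZc).integrableOn (s := Ω)
    have iB := (integrable_test_fderiv hψ1 hψc hψs hBc).integrableOn (s := Ω)
    have iq := (integrable_test_mul hψ.continuous hψc hψs hqc).integrableOn (s := Ω)
    have idB := (integrable_test_mul hψ.continuous hψc hψs
      (continuousOn_divergence hB1)).integrableOn (s := Ω)
    have ipΔ := (integrable_test_mul hψ.continuous hψc hψs (hpc.mul hΔc)).integrableOn (s := Ω)
    have imp : IntegrableOn (fun x => ψ x * (P (R x) * (-(Δ a) x))) Ω := by
      refine ipΔ.neg.congr (Eventually.of_forall fun x => ?_)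
      simp
    have imφ : IntegrableOn (fun x => ⟪m x, φ x⟫) Ω := by
      obtain ⟨K, hK⟩ := hψc.exists_bound_of_continuous hψ.continuous
      refine (him.bdd_mul (c := K) hψ.continuous.aestronglyMeasurable
        (Eventually.of_forall hK)).congr (Eventually.of_forall fun x => ?_)
      exact (real_inner_smul_right _ _ _).symm
    have hB0 : ∫ x in Ω, fderiv ℝ ψ x (bohmFlux r a x)
        = -∫ x in Ω, ψ x * divergence (bohmFlux r a) x :=
      integral_fderiv_test hψ1 hψc hψs hB1
    -- Three nonpositive quantities are dropped here: `R Hess a (U, U)`, and the terms `2 Hess a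
    -- (∇r, ∇r)` and `(1/2) R Δg` of the Bohm identity.
    have hle : ∫ x in Ω, ψ x * q x
        ≤ ∫ x in Ω, (ψ x * divergence (bohmFlux r a) x - ψ x * (P (R x) * (-(Δ a) x))) := by
      refine setIntegral_mono_on iq (idB.sub imp) hΩm fun x hx => ?_
      rw [← mul_sub]
      refine mul_le_mul_of_nonneg_left ?_ (hψ0 x)
      have hid := bohm_identity hR.contDiffAt (hpos x (subset_closure hx)) (ha4 x hx)
      have s1 := mul_nonpos_of_nonneg_of_nonpos (hpos x (subset_closure hx)).le
        (ha.hess_nonpos x hx (U x))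
      have s2 := ha.hess_nonpos x hx (∇ r x)
      have s3 := mul_nonpos_of_nonneg_of_nonpos (hpos x (subset_closure hx)).le
        (ha.laplacian_g_nonpos x hx)
      rw [← hr] at hid
      simp only [hq]
      linarith
    rw [integral_sub idB imp] at hle
    have hsplit : ∫ x in Ω, ψ x * (⟪m x, ∇ a x⟫ + P (R x) * (-(Δ a) x))
        = (∫ x in Ω, ⟪m x, φ x⟫) + ∫ x in Ω, ψ x * (P (R x) * (-(Δ a) x)) := by
      rw [← integral_add imφ imp]
      refine integral_congr_ae (Eventually.of_forall fun x => ?_)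
      simp only [hφ, real_inner_smul_right]
      ring
    have hrhs : ∫ x in Ω, ⟪m x, φ x⟫ = (∫ x in Ω, fderiv ℝ ψ x (virialFlux a P R U x))
        + (∫ x in Ω, fderiv ℝ ψ x (bohmFlux r a x)) + ∫ x in Ω, ψ x * q x := by
      rw [hbal, setIntegral_congr_fun hΩm hpt]
      exact (integral_add (iZ.add iB) iq).trans (congrArg (· + _) (integral_add iZ iB))
    rw [hsplit, hrhs]
    linarith

end MomentumSlice

/-! ### From Sobolev solutions to classical time slices -/

section Regularity

variable {d : ℕ} {Ω ΓD : Set (Space d)} {a : Space d → ℝ}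

/-- Sobolev embedding: a function that is continuous on `closure Ω` and agrees almost everywhere on
`Ω` with an element of `H^σ(ℝ^d)`, `σ > d/2 + k`, is the restriction of a `C^k` function. -/
lemma exists_contDiff_extension (hΩ : IsOpen Ω) {σ : ℝ} {k : ℕ} (hσ : (d : ℝ) / 2 + k < σ)
    {f : Space d → ℝ} (hf : ContinuousOn f (closure Ω))
    {G : Lp ℂ 2 (volume : Measure (Space d))}
    (h : ∃ w : Lp ℂ 2 (volume : Measure (Space d)),
      TemperedDistribution.besselPotential (Space d) ℂ σ (Lp.toTemperedDistribution w)
        = Lp.toTemperedDistribution G ∧ ∀ᵐ x ∂volume.restrict Ω, w x = (f x : ℂ)) :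
    ∃ R : Space d → ℝ, ContDiff ℝ k R ∧ EqOn f R (closure Ω) := by
  obtain ⟨w, hw, hwf⟩ := h
  obtain ⟨F, hF, hwF⟩ := exists_contDiff_ae_eq_of_besselPotential (k := k)
    (by rwa [finrank_euclideanSpace_fin]) w G hw
  have hR : ContDiff ℝ k fun x => (F x).re := Complex.reCLM.contDiff.comp hF
  refine ⟨fun x => (F x).re, hR, ?_⟩
  have hae : f =ᵐ[volume.restrict Ω] fun x => (F x).re := by
    filter_upwards [hwf, ae_restrict_of_ae hwF] with x h1 h2
    rw [← h2, h1, Complex.ofReal_re]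
  exact (Measure.eqOn_open_of_ae_eq hae hΩ (hf.mono subset_closure)
    hR.continuous.continuousOn).of_subset_closure hf hR.continuous.continuousOn subset_closure
    subset_rfl

lemma bohm_congr {f g : Space d → ℝ} {x : Space d} (h : f =ᶠ[𝓝 x] g) : bohm f x = bohm g x := by
  have h1 : (fun y => √(f y)) =ᶠ[𝓝 x] fun y => √(g y) := h.fun_comp Real.sqrt
  unfold bohm
  rw [(InnerProductSpace.laplacian_congr_nhds h1).eq_of_nhds, h.eq_of_nhds]

/-- The space integrals of the time derivatives of mass and momentum against the weight. -/
lemma IsSolution.exists_rates (hΩ : IsLipschitzDomain Ω) (ha : IsWeight Ω ΓD a)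
    {P : ℝ → ℝ} (hP : ContinuousOn P (Ioi 0)) (hPpos : ∀ r : ℝ, 0 < r → 0 < P r) {c s T : ℝ}
    (hc : c ≤ 0) (hs : (d : ℝ) / 2 < s) {ρI : Space d → ℝ} {uI : Space d → Space d}
    {ρ : ℝ → Space d → ℝ} {u : ℝ → Space d → Space d}
    (h : IsSolution Ω ΓD a P c s ρI uI T ρ u) :
    ∃ (r : ℝ → Space d → ℝ) (m : ℝ → Space d → Space d), IsTimeDeriv T Ω ρ r ∧
      IsTimeDeriv T Ω (fun t x => ρ t x • u t x) m ∧
      ∀ᵐ t ∂volume.restrict (Ioo 0 T), 0 ≤ ∫ x in Ω, a x * ρ t x ∧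
        ∫ x in Ω, a x * r t x ≤ ∫ x in Ω, ⟪ρ t x • u t x, ∇ a x⟫ ∧
        ∫ x in Ω, ⟪m t x, ∇ a x⟫ ≤ 0 ∧
        ((∃ x ∈ Ω, (Δ a) x ≠ 0) → ∫ x in Ω, ⟪m t x, ∇ a x⟫ < 0) := by
  obtain ⟨r, hr, hmass⟩ := h.mass
  obtain ⟨m, hm, hmom⟩ := h.momentum
  obtain ⟨G, -, hG⟩ := h.rho_memL2Sobolev
  choose H _ hH using h.u_memL2Sobolev
  refine ⟨r, m, hr, hm, ?_⟩
  have hΩo := hΩ.isOpen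
  have hΩm := hΩo.measurableSet
  filter_upwards [hmass, hmom, hG, ae_all_iff.2 hH, h.rho_continuousOn, h.u_continuousOn, h.pos,
    h.boundary_dirichlet, h.boundary_neumann, h.boundary_rho, hm.1.prod_right_ae] with
    t hmass hmom hG hH hρc huc hpos hD hN hB hmi
  -- Since `s + 2 > d/2 + 2` and `s + 1 > d/2 + 1`, the slices have a `C²` and a `C¹` extension.
  -- They agree with the given representatives on the whole closure, so the boundary conditions
  -- carry over.
  obtain ⟨R, hR, hρR⟩ := exists_contDiff_extension (k := 2) hΩo (by push_cast; linarith) hρc hG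
  have hcomp : ∀ i : Fin d, ∃ V : Space d → ℝ, ContDiff ℝ 1 V ∧
      EqOn (fun x => u t x i) V (closure Ω) := fun i =>
    exists_contDiff_extension (k := 1) hΩo (by push_cast; linarith)
      ((EuclideanSpace.proj (𝕜 := ℝ) i).continuous.comp_continuousOn huc) (hH i)
  choose V hV huV using hcomp
  set U : Space d → Space d := fun x => WithLp.toLp 2 fun i => V i x with hUdef
  have hU : ContDiff ℝ 1 U := (contDiff_euclidean (𝕜 := ℝ)).2 hV
  have huU : EqOn (u t) U (closure Ω) := fun x hx => by
    ext i
    exact huV i hx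
  have hRpos : ∀ x ∈ closure Ω, 0 < R x := fun x hx => hρR hx ▸ hpos x hx
  have hρn : ∀ x ∈ Ω, ρ t =ᶠ[𝓝 x] R := fun x hx => by
    filter_upwards [hΩo.mem_nhds hx] with y hy using hρR (subset_closure hy)
  have hNU : ∀ x ∈ frontier Ω \ ΓD, ∀ ν : Space d, IsOuterUnitNormal Ω x ν → ⟪U x, ν⟫ = 0 :=
    fun x hx ν hν => huU hx.1.1 ▸ hN x hx ν hν
  have hgr : ∀ x ∈ Ω, ∇ (fun z => √(ρ t z)) x = ∇ (fun z => √(R z)) x := fun x hx =>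
    ((hρn x hx).fun_comp Real.sqrt).gradient_eq
  have hρU : ∀ x ∈ Ω, ρ t x • u t x = R x • U x := fun x hx => by
    rw [hρR (subset_closure hx), huU (subset_closure hx)]
  obtain ⟨hi1, hi2, hmle⟩ := momentum_slice_ineq hΩ ha hP hc (m := m t) hmi hR hU hRpos
    (fun φ h1 h2 h3 => by
      rw [hmom φ h1 h2 h3]
      refine setIntegral_congr_fun hΩm fun x hx => ?_
      have hd : divergence (fun y => ρ t y • φ y) x = divergence (fun y => R y • φ y) x :=
        divergence_congr ((hρn x hx).smul EventuallyEq.rfl)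
      simp only [hd, bohm_congr (hρn x hx), hρR (subset_closure hx), huU (subset_closure hx)])
    hNU
    (fun x hx ν hν => (hD x hx ν hν).congr' (by
      filter_upwards [self_mem_nhdsWithin] with y hy
      rw [bohm_congr (hρn y hy), hgr y hy, hρR (subset_closure hy), huU (subset_closure hy)]))
    (fun x hx ν hν => (hB x hx ν hν).congr' (by
      filter_upwards [self_mem_nhdsWithin] with y hy
      rw [hgr y hy]))
  rw [integral_add hi1 hi2] at hmle
  have hp0 : ∀ x ∈ Ω, 0 ≤ P (R x) * (-(Δ a) x) := fun x hx =>
    mul_nonneg (hPpos _ (hRpos x (subset_closure hx))).le (ha.g_nonneg x hx)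
  have hp1 : 0 ≤ ∫ x in Ω, P (R x) * (-(Δ a) x) := setIntegral_nonneg hΩm hp0
  refine ⟨setIntegral_nonneg hΩm fun x hx => mul_nonneg (ha.nonneg x (subset_closure hx))
    (hpos x (subset_closure hx)).le, ?_, by linarith, ?_⟩
  · have hms := mass_slice_ineq hΩ ha hR hU hNU
    have e1 : ∫ x in Ω, a x * r t x
        = -∫ x in Ω, a x * divergence (fun y => R y • U y) x := by
      rw [← integral_neg]
      refine integral_congr_ae ?_
      filter_upwards [hmass, ae_restrict_mem hΩm] with x hx hxΩ
      have hd : divergence (fun y => ρ t y • u t y) x = divergence (fun y => R y • U y) x := by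
        refine divergence_congr ?_
        filter_upwards [hΩo.mem_nhds hxΩ] with y hy using hρU y hy
      rw [hd] at hx
      rw [eq_neg_of_add_eq_zero_left hx, mul_neg]
    rw [e1]
    refine hms.trans_eq (setIntegral_congr_fun hΩm fun x hx => ?_)
    simp only [hρU x hx, real_inner_smul_left]
  · rintro ⟨x₀, hx₀, hne⟩
    -- A zero integral would make the continuous nonnegative integrand vanish throughout `Ω`; as `P
    -- > 0`, this would force `Δa` to vanish at `x₀`.
    have hp2 : 0 < ∫ x in Ω, P (R x) * (-(Δ a) x) := by
      refine hp1.lt_of_ne fun h0 => hne ?_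
      have hae := (setIntegral_eq_zero_iff_of_nonneg_ae (ae_restrict_of_forall_mem hΩm hp0) hi2).1
        h0.symm
      have hΔc : ContinuousOn (Δ a) Ω := continuousOn_laplacian fun x hx =>
        (ha.contDiffAt hΩo hx).of_le (by norm_num)
      have hpc := (exists_state_bound hP hΩ.bounded hR hU hRpos).2.1.mono subset_closure
      have hx := Measure.eqOn_open_of_ae_eq hae hΩo (hpc.mul hΔc.neg) continuousOn_const hx₀
      have hpp := (hPpos _ (hRpos x₀ (subset_closure hx₀))).ne'
      simpa [hpp] using hx
    linarith

end Regularity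

/-! ### Integration in time -/

section TimeIntegration

variable {d : ℕ} {Ω ΓD : Set (Space d)} {a : Space d → ℝ}

/-- Integration in time of the pairing of a time-dependent function with a bounded functional. -/
lemma IsTimeDeriv.integral_pairing {F : Type*} [NormedAddCommGroup F] [NormedSpace ℝ F]
    [CompleteSpace F] {T : ℝ} (hΩ : MeasurableSet Ω) {f f' : ℝ → Space d → F}
    (h : IsTimeDeriv T Ω f f') {L : Space d → F →L[ℝ] ℝ} {C : ℝ}
    (hL : AEStronglyMeasurable L (volume.restrict Ω)) (hC : ∀ x ∈ Ω, ‖L x‖ ≤ C)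
    (h0 : IntegrableOn (f 0) Ω) :
    IntegrableOn (fun s => ∫ x in Ω, L x (f' s x)) (Ioo 0 T) ∧
    ∀ t ∈ Icc 0 T, ∫ x in Ω, L x (f t x)
      = (∫ x in Ω, L x (f 0 x)) + ∫ s in (0 : ℝ)..t, ∫ x in Ω, L x (f' s x) := by
  have hk : Integrable (fun z : ℝ × Space d => L z.2 (f' z.1 z.2)) (cylinder T Ω) := by
    refine Integrable.mono' (g := fun z => C * ‖Function.uncurry f' z‖) (h.1.norm.const_mul C)
      (isBoundedBilinearMap_apply.continuous.comp_aestronglyMeasurable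
        (hL.comp_snd.prodMk h.1.aestronglyMeasurable)) ?_
    rw [cylinder, Measure.prod_restrict]
    filter_upwards [ae_restrict_mem (measurableSet_Ioo.prod hΩ)] with z hz
    exact ((L z.2).le_opNorm _).trans (mul_le_mul_of_nonneg_right (hC z.2 hz.2) (norm_nonneg _))
  refine ⟨hk.integral_prod_left, fun t ht => ?_⟩
  have hle : cylinder t Ω ≤ cylinder T Ω := by
    rw [cylinder, cylinder, Measure.prod_restrict, Measure.prod_restrict]
    exact Measure.restrict_mono (prod_mono (Ioo_subset_Ioo_right ht.2) subset_rfl) le_rfl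
  have hkt := hk.mono_measure hle
  have hf't := h.1.mono_measure hle
  have i0 : IntegrableOn (fun x => L x (f 0 x)) Ω := by
    refine Integrable.mono' (g := fun x => C * ‖f 0 x‖) (h0.norm.const_mul C)
      (isBoundedBilinearMap_apply.continuous.comp_aestronglyMeasurable
        (hL.prodMk h0.aestronglyMeasurable)) ?_
    filter_upwards [ae_restrict_mem hΩ] with x hx
    exact ((L x).le_opNorm _).trans (mul_le_mul_of_nonneg_right (hC x hx) (norm_nonneg _))
  -- The functional passes inside the time integral for almost every `x`; Fubini then exchanges the
  -- two integrals.
  have hpt : ∀ᵐ x ∂volume.restrict Ω, L x (f t x)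
      = L x (f 0 x) + ∫ s in Ioo 0 t, L x (f' s x) := by
    filter_upwards [h.2 t ht, hf't.prod_left_ae] with x hx hxi
    rw [hx, map_add, intervalIntegral.integral_of_le ht.1, integral_Ioc_eq_integral_Ioo]
    exact congrArg _ (ContinuousLinearMap.integral_comp_comm (L x) hxi).symm
  rw [integral_congr_ae hpt, integral_add i0 hkt.integral_prod_right,
    intervalIntegral.integral_of_le ht.1, integral_Ioc_eq_integral_Ioo]
  congr 1
  exact (integral_integral_swap hkt).symm

/-- By continuity, an inequality known at almost every earlier time reaches the right endpoint. This
serves for the end of the lifespan and for the limit of lifespans at `T*`. -/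
lemma nonneg_right_of_ae_nonneg {T₀ T : ℝ} (hT : T₀ < T) {φ : ℝ → ℝ} (hφ : Continuous φ)
    (h : ∀ᵐ t ∂volume.restrict (Ioo T₀ T), 0 ≤ φ t) : 0 ≤ φ T := by
  have hae : (fun t => min (φ t) 0) =ᵐ[volume.restrict (Ioo T₀ T)] fun _ => 0 := by
    filter_upwards [h] with t ht using min_eq_right ht
  have hc : Continuous fun t => min (φ t) 0 := hφ.min continuous_const
  have := (Measure.eqOn_open_of_ae_eq hae isOpen_Ioo hc.continuousOn
    continuousOn_const).of_subset_closure (t := Icc T₀ T) hc.continuousOn continuousOn_const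
    Ioo_subset_Icc_self (closure_Ioo hT.ne).ge (right_mem_Icc.2 hT.le)
  exact min_eq_right_iff.1 this

lemma intervalIntegrable_of_Ioo {T t₁ t₂ : ℝ} {q : ℝ → ℝ} (hq : IntegrableOn q (Ioo 0 T))
    (h1 : 0 ≤ t₁) (h12 : t₁ ≤ t₂) (h2 : t₂ ≤ T) : IntervalIntegrable q volume t₁ t₂ := by
  rw [intervalIntegrable_iff_integrableOn_Ioo_of_le h12]
  exact hq.mono_set (Ioo_subset_Ioo h1 h2)

/-- Integration of `A' ≤ J`, `J' ≤ 0`, `A ≥ 0`. -/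
lemma virial_inequality {T : ℝ} {A J α μ : ℝ → ℝ} (hα : IntegrableOn α (Ioo 0 T))
    (hμ : IntegrableOn μ (Ioo 0 T)) (hA : ∀ t ∈ Icc 0 T, A t = A 0 + ∫ s in (0 : ℝ)..t, α s)
    (hJ : ∀ t ∈ Icc 0 T, J t = J 0 + ∫ s in (0 : ℝ)..t, μ s)
    (hαJ : ∀ᵐ t ∂volume.restrict (Ioo 0 T), α t ≤ J t)
    (hμ0 : ∀ᵐ t ∂volume.restrict (Ioo 0 T), μ t ≤ 0)
    (hA0 : ∀ᵐ t ∂volume.restrict (Ioo 0 T), 0 ≤ A t) :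
    (∀ t₁ t₂, 0 ≤ t₁ → t₁ ≤ t₂ → t₂ ≤ T → A t₂ ≤ A t₁ + (t₂ - t₁) * J t₁) ∧
    ∀ t₁, 0 ≤ t₁ → t₁ < T → 0 ≤ A t₁ + (T - t₁) * J t₁ := by
  have hdiff : ∀ {B β : ℝ → ℝ}, IntegrableOn β (Ioo 0 T) →
      (∀ t ∈ Icc 0 T, B t = B 0 + ∫ s in (0 : ℝ)..t, β s) → ∀ t₁ t₂, 0 ≤ t₁ → t₁ ≤ t₂ → t₂ ≤ T →
      B t₂ = B t₁ + ∫ s in t₁..t₂, β s := by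
    intro B β hβ hB t₁ t₂ h1 h12 h2
    rw [hB t₂ ⟨h1.trans h12, h2⟩, hB t₁ ⟨h1, h12.trans h2⟩, add_assoc,
      intervalIntegral.integral_add_adjacent_intervals
        (intervalIntegrable_of_Ioo hβ le_rfl h1 (h12.trans h2))
        (intervalIntegrable_of_Ioo hβ h1 h12 h2)]
  have hanti : ∀ t₁ t₂, 0 ≤ t₁ → t₁ ≤ t₂ → t₂ ≤ T → J t₂ ≤ J t₁ := by
    intro t₁ t₂ h1 h12 h2
    rw [hdiff hμ hJ t₁ t₂ h1 h12 h2, intervalIntegral.integral_of_le h12,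
      integral_Ioc_eq_integral_Ioo]
    have := integral_nonpos_of_ae
      (ae_restrict_of_ae_restrict_of_subset (Ioo_subset_Ioo h1 h2) hμ0)
    linarith
  have hmain : ∀ t₁ t₂, 0 ≤ t₁ → t₁ ≤ t₂ → t₂ ≤ T → A t₂ ≤ A t₁ + (t₂ - t₁) * J t₁ := by
    intro t₁ t₂ h1 h12 h2
    rw [hdiff hα hA t₁ t₂ h1 h12 h2]
    have hle : ∫ s in t₁..t₂, α s ≤ ∫ _ in t₁..t₂, J t₁ := by
      rw [intervalIntegral.integral_of_le h12, intervalIntegral.integral_of_le h12,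
        integral_Ioc_eq_integral_Ioo, integral_Ioc_eq_integral_Ioo]
      refine integral_mono_ae (hα.mono_set (Ioo_subset_Ioo h1 h2)) (integrable_const _) ?_
      filter_upwards [ae_restrict_of_ae_restrict_of_subset (Ioo_subset_Ioo h1 h2) hαJ,
        ae_restrict_mem measurableSet_Ioo] with t ht htm
      exact ht.trans (hanti t₁ t h1 htm.1.le (htm.2.le.trans h2))
    rw [intervalIntegral.integral_const, smul_eq_mul] at hle
    linarith
  refine ⟨hmain, fun t₁ h1 h1T => ?_⟩
  -- Positivity of `A` is known only at almost every time, so it is transferred to the affine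
  -- majorant of `A`, which is continuous and can be evaluated at `T`.
  refine nonneg_right_of_ae_nonneg (φ := fun t => A t₁ + (t - t₁) * J t₁) h1T (by fun_prop) ?_
  filter_upwards [ae_restrict_of_ae_restrict_of_subset (Ioo_subset_Ioo_left h1) hA0,
    ae_restrict_mem measurableSet_Ioo] with t ht htm
  exact ht.trans (hmain t₁ t h1 htm.1.le htm.2.le)

/-- A vanishing integral of the nonnegative function `-μ` would force `μ = 0` almost everywhere on
an interval of positive length. -/
lemma integral_neg_of_ae_neg {T t : ℝ} (ht : 0 < t) (htT : t ≤ T) {μ : ℝ → ℝ}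
    (hμ : IntegrableOn μ (Ioo 0 T)) (h : ∀ᵐ s ∂volume.restrict (Ioo 0 T), μ s < 0) :
    ∫ s in (0 : ℝ)..t, μ s < 0 := by
  have hsub : Ioo 0 t ⊆ Ioo 0 T := Ioo_subset_Ioo_right htT
  have h' := ae_restrict_of_ae_restrict_of_subset hsub h
  have hi := hμ.mono_set hsub
  rw [intervalIntegral.integral_of_le ht.le, integral_Ioc_eq_integral_Ioo]
  have h0 : 0 ≤ᵐ[volume.restrict (Ioo 0 t)] fun s => -μ s := by
    filter_upwards [h'] with s hs using (neg_pos.2 hs).le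
  have h1 := integral_nonneg_of_ae h0
  refine lt_of_le_of_ne (by rw [integral_neg] at h1; linarith) fun h2 => ?_
  have h3 : (fun s => -μ s) =ᵐ[volume.restrict (Ioo 0 t)] 0 :=
    (integral_eq_zero_iff_of_nonneg_ae h0 hi.neg).1 (by rw [integral_neg, h2, neg_zero])
  have h4 : ∀ᵐ _ ∂volume.restrict (Ioo 0 t), False := by
    filter_upwards [h', h3] with s hs hs'
    simp only [Pi.zero_apply] at hs'
    linarith
  have h5 := ae_iff.1 h4
  simp [ht.not_ge] at h5

/-- The virial inequality for a positive solution. -/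
lemma IsSolution.virial (hΩ : IsLipschitzDomain Ω) (ha : IsWeight Ω ΓD a)
    {P : ℝ → ℝ} (hP : ContinuousOn P (Ioi 0)) (hPpos : ∀ r : ℝ, 0 < r → 0 < P r) {c s T : ℝ}
    (hc : c ≤ 0) (hs : (d : ℝ) / 2 < s) {ρI : Space d → ℝ} {uI : Space d → Space d}
    (hρI : MemLp ρI 2 (volume.restrict Ω)) (huI : MemLp uI 2 (volume.restrict Ω))
    {ρ : ℝ → Space d → ℝ} {u : ℝ → Space d → Space d}
    (h : IsSolution Ω ΓD a P c s ρI uI T ρ u) :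
    (∀ t₁ t₂, 0 ≤ t₁ → t₁ ≤ t₂ → t₂ ≤ T → ∫ x in Ω, a x * ρ t₂ x
      ≤ (∫ x in Ω, a x * ρ t₁ x) + (t₂ - t₁) * ∫ x in Ω, ⟪ρ t₁ x • u t₁ x, ∇ a x⟫) ∧
    (∀ t₁, 0 ≤ t₁ → t₁ < T →
      0 ≤ (∫ x in Ω, a x * ρ t₁ x) + (T - t₁) * ∫ x in Ω, ⟪ρ t₁ x • u t₁ x, ∇ a x⟫) ∧
    ((∃ x ∈ Ω, (Δ a) x ≠ 0) → ∀ t, 0 < t → t ≤ T →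
      ∫ x in Ω, ⟪ρ t x • u t x, ∇ a x⟫ < ∫ x in Ω, ⟪ρ 0 x • u 0 x, ∇ a x⟫) := by
  obtain ⟨r, m, hr, hm, hrates⟩ := h.exists_rates hΩ ha hP hPpos hc hs
  have hΩo := hΩ.isOpen
  have hΩm := hΩo.measurableSet
  obtain ⟨C, hC0, hC⟩ := ha.exists_bound hΩo hΩ.bounded
  have : IsFiniteMeasure (volume.restrict Ω) :=
    isFiniteMeasure_restrict.2 hΩ.bounded.measure_lt_top.ne
  have hgc : ContinuousOn (∇ a) Ω := continuousOn_gradient fun x hx =>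
    (ha.contDiffAt hΩo hx).of_le (by norm_num)
  have hρ0 : IntegrableOn (ρ 0) Ω :=
    (hρI.integrable (by norm_num)).congr (by filter_upwards [h.rho_initial] with x hx using hx.symm)
  -- Integrability of the initial momentum is Hölder's inequality for two square-integrable data.
  have hρu0 : IntegrableOn (fun x => ρ 0 x • u 0 x) Ω := by
    have := memLp_one_iff_integrable.1 (huI.smul (r := 1) hρI)
    refine this.congr ?_
    filter_upwards [h.rho_initial, h.u_initial] with x h1 h2
    simp [h1, h2]
  obtain ⟨hα, hA⟩ := hr.integral_pairing hΩm (L := fun x => ContinuousLinearMap.mul ℝ ℝ (a x))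
    (C := C) ((ContinuousLinearMap.mul ℝ ℝ).continuous.comp_aestronglyMeasurable
      ((ha.continuousOn.mono subset_closure).aestronglyMeasurable hΩm))
    (fun x hx => by rw [ContinuousLinearMap.opNorm_mul_apply]; exact (hC x hx).1) hρ0
  obtain ⟨hμ, hJ⟩ := hm.integral_pairing hΩm (L := fun x => innerSL ℝ (∇ a x)) (C := C)
    ((innerSL ℝ).continuous.comp_aestronglyMeasurable (hgc.aestronglyMeasurable hΩm))
    (fun x hx => by rw [innerSL_apply_norm]; exact (hC x hx).2.1) hρu0
  simp only [ContinuousLinearMap.mul_apply'] at hα hA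
  have hcomm : ∀ x v, ⟪∇ a x, v⟫ = ⟪v, ∇ a x⟫ := fun x v => real_inner_comm _ _
  simp only [innerSL_apply_apply, hcomm] at hμ hJ
  obtain ⟨h1, h2⟩ := virial_inequality (A := fun t => ∫ x in Ω, a x * ρ t x)
    (J := fun t => ∫ x in Ω, ⟪ρ t x • u t x, ∇ a x⟫) hα hμ hA hJ (hrates.mono fun t ht => ht.2.1)
    (hrates.mono fun t ht => ht.2.2.1) (hrates.mono fun t ht => ht.1)
  refine ⟨h1, h2, fun hne t ht htT => ?_⟩
  rw [hJ t ⟨ht.le, htT⟩]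
  have := integral_neg_of_ae_neg ht htT hμ (hrates.mono fun t ht => ht.2.2.2 hne)
  linarith

end TimeIntegration

/-! ### Positivity of the critical time and conclusion -/

section Main

variable {d : ℕ} {Ω ΓD : Set (Space d)} {a : Space d → ℝ}

lemma integral_momentum_eq_zero (h : ∀ x ∈ Ω, ∇ a x = 0) (ρI : Space d → ℝ)
    (uI : Space d → Space d) : ∫ x in Ω, ρI x * ⟪uI x, ∇ a x⟫ = 0 :=
  setIntegral_eq_zero_of_forall_eq_zero fun x hx => by rw [h x hx, inner_zero_right, mul_zero]

/-- As `a ≥ 0` and `ρI > 0`, a zero integral would make the continuous function `a` vanish on `Ω`.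
Then `∇a = 0` and the initial momentum integral is zero, not negative. -/
lemma IsWeight.integral_mul_pos (hΩ : IsLipschitzDomain Ω) (ha : IsWeight Ω ΓD a)
    {ρI : Space d → ℝ} {uI : Space d → Space d} (hρI : MemLp ρI 2 (volume.restrict Ω))
    (hρIpos : ∀ᵐ x ∂volume.restrict Ω, 0 < ρI x)
    (hneg : ∫ x in Ω, ρI x * ⟪uI x, ∇ a x⟫ < 0) : 0 < ∫ x in Ω, a x * ρI x := by
  have hΩo := hΩ.isOpen
  have hΩm := hΩo.measurableSet
  have : IsFiniteMeasure (volume.restrict Ω) :=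
    isFiniteMeasure_restrict.2 hΩ.bounded.measure_lt_top.ne
  obtain ⟨C, -, hC⟩ := ha.exists_bound hΩo hΩ.bounded
  have hac : ContinuousOn a Ω := ha.continuousOn.mono subset_closure
  have hi : IntegrableOn (fun x => a x * ρI x) Ω :=
    (hρI.integrable (by norm_num)).bdd_mul (c := C) (hac.aestronglyMeasurable hΩm)
      (ae_restrict_of_forall_mem hΩm fun x hx => (hC x hx).1)
  have h0 : 0 ≤ᵐ[volume.restrict Ω] fun x => a x * ρI x := by
    filter_upwards [hρIpos, ae_restrict_mem hΩm] with x h1 h2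
    exact mul_nonneg (ha.nonneg x (subset_closure h2)) h1.le
  refine (integral_nonneg_of_ae h0).lt_of_ne fun hzero => hneg.ne ?_
  have hae : a =ᵐ[volume.restrict Ω] fun _ => 0 := by
    filter_upwards [(integral_eq_zero_iff_of_nonneg_ae h0 hi).1 hzero.symm, hρIpos] with x h1 h2
    exact (mul_eq_zero.1 h1).resolve_right h2.ne'
  have heq := Measure.eqOn_open_of_ae_eq hae hΩo hac continuousOn_const
  refine integral_momentum_eq_zero (fun x hx => ?_) ρI uI
  have hev : a =ᶠ[𝓝 x] fun _ => 0 := heq.eventuallyEq_of_mem (hΩo.mem_nhds hx)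
  rw [hev.gradient_eq]
  exact gradient_const x 0

end Main

end QHD

/-- In the last assertion, a solution on every `[0,T]` with `T < Tstar` would turn the virial
inequality into an equality, whereas the pressure makes that inequality strict: `P > 0`, and `Δ a`
does not vanish identically because `∇ a` does not. So such a solution does not exist. -/
theorem theorem2 (d : ℕ) (hd : 1 ≤ d) (Ω ΓD : Set (QHD.Space d)) (hΩ : QHD.IsLipschitzDomain Ω)
    (a : QHD.Space d → ℝ) (ha : QHD.IsWeight Ω ΓD a)
    (P : ℝ → ℝ) (hP : ContDiffOn ℝ 1 P (Ioi 0)) (hPpos : ∀ r : ℝ, 0 < r → 0 < P r)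
    (c : ℝ) (hc : c ≤ 0) (s : ℝ) (hs : (d : ℝ) / 2 < s)
    (ρI : QHD.Space d → ℝ) (uI : QHD.Space d → QHD.Space d)
    (hρI : MemLp ρI 2 (volume.restrict Ω)) (huI : MemLp uI 2 (volume.restrict Ω))
    (hρIpos : ∀ᵐ x ∂volume.restrict Ω, 0 < ρI x)
    (hneg : ∫ x in Ω, ρI x * ⟪uI x, ∇ a x⟫ < 0) :
    ∃ Tstar : ℝ,
      Tstar = -(∫ x in Ω, a x * ρI x) / ∫ x in Ω, ρI x * ⟪uI x, ∇ a x⟫ ∧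
      0 < Tstar ∧
      (∀ (T : ℝ) (ρ : ℝ → QHD.Space d → ℝ) (u : ℝ → QHD.Space d → QHD.Space d), 0 < T →
        QHD.IsSolution Ω ΓD a P c s ρI uI T ρ u →
        T ≤ Tstar ∧
        ∀ t ∈ Icc 0 T, ∫ x in Ω, a x * ρ t x ≤
          (∫ x in Ω, a x * ρI x) + t * ∫ x in Ω, ρI x * ⟪uI x, ∇ a x⟫) ∧
      (∀ (ρ : ℝ → QHD.Space d → ℝ) (u : ℝ → QHD.Space d → QHD.Space d),
        (∀ T : ℝ, 0 < T → T < Tstar → QHD.IsSolution Ω ΓD a P c s ρI uI T ρ u) →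
        ∀ᵐ x ∂volume.restrict Ω, Tendsto (fun t => ρ t x) (𝓝[<] Tstar) (𝓝 0)) := by
  have hA := ha.integral_mul_pos hΩ hρI hρIpos hneg
  have hA0 : ∀ {T : ℝ} {ρ : ℝ → QHD.Space d → ℝ} {u : ℝ → QHD.Space d → QHD.Space d},
      QHD.IsSolution Ω ΓD a P c s ρI uI T ρ u →
      ∫ x in Ω, a x * ρ 0 x = ∫ x in Ω, a x * ρI x := fun h => integral_congr_ae (by
    filter_upwards [h.rho_initial] with x hx
    rw [hx])
  have hM0 : ∀ {T : ℝ} {ρ : ℝ → QHD.Space d → ℝ} {u : ℝ → QHD.Space d → QHD.Space d},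
      QHD.IsSolution Ω ΓD a P c s ρI uI T ρ u →
      ∫ x in Ω, ⟪ρ 0 x • u 0 x, ∇ a x⟫ = ∫ x in Ω, ρI x * ⟪uI x, ∇ a x⟫ := fun h =>
    integral_congr_ae (by
    filter_upwards [h.rho_initial, h.u_initial] with x h1 h2
    rw [h1, h2, real_inner_smul_left])
  have hne : ∃ x ∈ Ω, (Δ a) x ≠ 0 := by
    by_contra! hcon
    exact hneg.ne (QHD.integral_momentum_eq_zero (ha.gradient_eq_zero hΩ hcon) ρI uI)
  have hvir := fun {T : ℝ} {ρ : ℝ → QHD.Space d → ℝ} {u : ℝ → QHD.Space d → QHD.Space d}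
      (h : QHD.IsSolution Ω ΓD a P c s ρI uI T ρ u) =>
    h.virial hΩ ha hP.continuousOn hPpos hc hs hρI huI
  set A : ℝ := ∫ x in Ω, a x * ρI x
  set M : ℝ := ∫ x in Ω, ρI x * ⟪uI x, ∇ a x⟫
  have hT0 : 0 < -A / M := div_pos_of_neg_of_neg (neg_lt_zero.2 hA) hneg
  refine ⟨-A / M, rfl, hT0, fun T ρ u hT h => ?_, fun ρ u h => ?_⟩
  · obtain ⟨h1, h2, -⟩ := hvir h
    have h3 := h2 0 le_rfl hT
    rw [hA0 h, hM0 h] at h3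
    refine ⟨(le_div_iff_of_neg hneg).2 (by linarith), fun t ht => ?_⟩
    have h4 := h1 0 t le_rfl ht.1 ht.2
    rwa [hA0 h, hM0 h, sub_zero] at h4
  -- At `τ = T*/2` (any time strictly between `0` and `T*` would do) one has `A(τ) ≤ A + τ M` and
  -- `J(τ) < M`, so `A(τ) + (T* - τ) J(τ) < A + T* M = 0`. Existence on every `[0,T]`, in the limit
  -- `T → T*`, makes the left side nonnegative.
  · exfalso
    have ht : 0 < -A / M / 2 := half_pos hT0
    have htT : -A / M / 2 < -A / M := half_lt_self hT0
    have hhalf := h _ ht htT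
    obtain ⟨h1, -, h3⟩ := hvir hhalf
    have hAt := h1 0 _ le_rfl ht.le le_rfl
    have hJt := h3 hne _ ht le_rfl
    rw [hA0 hhalf, hM0 hhalf] at hAt
    rw [hM0 hhalf] at hJt
    have hlim := QHD.nonneg_right_of_ae_nonneg htT
      (φ := fun T => (∫ x in Ω, a x * ρ (-A / M / 2) x)
        + (T - -A / M / 2) * ∫ x in Ω, ⟪ρ (-A / M / 2) x • u (-A / M / 2) x, ∇ a x⟫)
      (by fun_prop) (ae_restrict_of_forall_mem measurableSet_Ioo fun T hT =>
        (hvir (h T (ht.trans hT.1) hT.2)).2.1 _ ht.le hT.1)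
    have hlt := mul_lt_mul_of_pos_left hJt (sub_pos.2 htT)
    have hTM : -A / M * M = -A := div_mul_cancel₀ _ hneg.ne
    linarith
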